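/- Let $g\ge 1$, let $p$ be an odd prime and let $\eta\in\mathbb C$ be a primitive $p$-th root of unity. **Braid group.** $\mathrm{Br}_{2g+1}=\langle\sigma_1,\dots,\sigma_{2g}\mid \sigma_l\sigma_{l+1}\sigma_l=\sigma_{l+1}\sigma_l\sigma_{l+1},\ \sigma_l\sigma_m=\sigma_m\sigma_l\ (|l-m|>1)\rangle$. It acts on $H_{2g+1}=\langle y_1,\dots,y_{2g+1}\mid y_i^2\rangle$ by $\sigma_l(y_l)=y_{l+1}$, $\sigma_l(y_{l+1})=y_{l+1}y_ly_{l+1}$, $\sigma_l(y_j)=y_j$ otherwise, and by restriction on the free group $F_{2g}=\langle x_1,\dots,x_{2g}\rangle\subset H_{2g+1}$, $x_i=y_iy_{i+1}$: $\sigma_l(x_{l-1})=x_{l-1}x_l$, $\sigma_l(x_{l+1})=x_l^{-1}x_{l+1}$, the other $x_j$ being fixed. Put $\Delta=y_1y_2\cdots y_{2g+1}$. **The group $G=\mathrm H(p,2g)$.** Let $\omega$ be the bilinear form on $F_{2g}^{ab}$ with $\omega([x_i],[x_j])=j-i$ if $|i-j|=1$ and $0$ otherwise. Let $N\lhd F_{2g}$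 be the normal subgroup generated by $[[F_{2g},F_{2g}],F_{2g}]$, all $p$-th powers, and the kernel of the homomorphism $[F_{2g},F_{2g}]\to\mathbb Z/p$, $[a,b]\mapsto\omega(a,b)\bmod p$. Put $G=\mathrm H(p,2g)=F_{2g}/N$, with quotient map $\rho_N$, and $c=[x_1,x_2]\in G$; the images of the $x_i$ in $G$ are again denoted $x_i$. $N$ is preserved by $\mathrm{Br}_{2g+1}$. **The modules $V_g^\eta$ and $L_g^\eta$.** $V_g^\eta$ is the $\mathbb C$-vector space with basis $e_j$, $j\in(\mathbb Z/p)^g$. With $\epsilon_1,\dots,\epsilon_g$ the coordinate vectors of $(\mathbb Z/p)^g$ and $\epsilon_{g+1}=0$, it is a right $G$-module by $e_jx_{2k-1}=\eta^{j_k}e_j$, $e_jx_{2k}=e_{j-\epsilon_k+\epsilon_{k+1}}$, and carries the operators $$\Psi_{2k-1}(e_j)=\eta^{\binom{j_k+1}{2}}e_j,\qquad \Psi_{2k}(e_j)=\frac{\mathrm G(1/2)}{p}\sum_{s\in\mathbb Z/p}\eta^{-\frac12(s+\frac12)^2}e_{j+s(\epsilon_k-\epsilon_{k+1})}\qquad(1\le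 k\le g),$$ where $\mathrm G(a)=\sum_{t\in\mathbb Z/p}\eta^{at^2}$ and fractions in exponents are taken in $\mathbb Z/p$. Let $L_g^\eta=V_g^\eta\otimes\langle u_1,\dots,u_{2g}\rangle_{\mathbb C}$ with the $u_i$ linearly independent, and, with $u_{-1}=u_{2g+2}=0$, $$\hat\Psi_{2k-1}(v\otimes u_l)=\Psi_{2k-1}(v)\otimes u_l-\delta_{l,2k}\,\Psi_{2k-1}(v)\{x_1x_3\cdots x_{2k-3}\cdot x_{2k}x_{2k+2}\cdots x_{2g}\}\otimes(u_{2k-1}-u_{2k-3}),$$ $$\hat\Psi_{2k}(v\otimes u_l)=\Psi_{2k}(v)\otimes u_l+\delta_{l,2k-1}\,\Psi_{2k}(v)\{x_1x_3\cdots x_{2k-1}\cdot x_{2k}x_{2k+2}\cdots x_{2g}\}^{-1}\otimes(u_{2k}-u_{2k+2}).$$ **The Magnus module.** $L_N=\bigoplus_{i=1}^{2g}\mathbb C[G]f_i$, and $d_N:F_{2g}\to L_N$ is the Fox derivation, i.e. $d_N(x_i)=f_i$ and $d_N(ab)=d_N(a)+\rho_N(a)d_N(b)$. $\mathrm{Br}_{2g+1}$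 acts on $L_N$ by the unique $\mathbb C$-linear action for which $d_N$ is equivariant. Put $\varphi(c;\eta)=\frac1p\sum_{n\in\mathbb Z/p}\eta^{-n}c^n\in\mathbb C[G]$. Let $G^+=H_{2g+1}/N$, and let $L_N^+$ be the quotient of $\bigoplus_{i=1}^{2g+1}\mathbb C[G^+]t_i$, equipped with the Fox derivation of the free group on $y_1,\dots,y_{2g+1}$ with $y_i\mapsto t_i$, by the submodule generated by the derivatives of the elements of the normal closure of $\{y_i^2\}$; let $d^+$ be the induced derivation, and let $\hat\iota:L_N\to L_N^+$ be the $\mathbb C[G]$-linear map with $\hat\iota(d_N(x_i))=d^+(y_iy_{i+1})$. In $L_N^+$ put $$\mathbf u_{2i}=y_1\cdots y_{2i-1}\,d^+(y_{2i}\cdots y_{2g+1}),\qquad \mathbf u_{2i-1}=-y_{2g+1}\cdots y_{2i+1}\,d^+(y_{2i}\cdots y_1)\qquad(1\le i\le g).$$ For $i,j\in(\mathbb Z/p)^g$ put $E^\eta_{i,j}=\varphi(c;\eta)\,\varphi(i;x_{odd})\,\varphi(0;x_{even})\,\varphi(j;x_{odd})\in\mathbb C[G]$, where $\varphi(i;x_{odd})=p^{-g}\sum_{a\in(\mathbb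 Z/p)^g}\eta^{-i\cdot a}x_1^{a_1}x_3^{a_2}\cdots x_{2g-1}^{a_g}$ and $\varphi(i;x_{even})=p^{-g}\sum_a\eta^{-i\cdot a}x_2^{a_1}x_4^{a_2}\cdots x_{2g}^{a_g}$. **Theorem.** (1) The operators $\Psi_l$ define an action of $\mathrm{Br}_{2g+1}$ on $V_g^\eta$ (with $\sigma_l$ acting by $\Psi_l$), and the operators $\hat\Psi_l$ $(1\le l\le 2g)$ are invertible and satisfy the braid relations, hence define an action of $\mathrm{Br}_{2g+1}$ on $L_g^\eta$ (with $\sigma_l$ acting by $\hat\Psi_l$). (2) Let $V_g^{\eta*}$ be the dual representation of $V_g^\eta$, with $(e'_i)$ the dual basis of $(e_j)$. There is an isomorphism of $\mathrm{Br}_{2g+1}$-modules $$e:\ V_g^{\eta*}\otimes_{\mathbb C}L_g^\eta\ \xrightarrow{\ \cong\ }\ \varphi(c;\eta)L_N ,$$ where the left side carries the diagonal action and $\varphi(c;\eta)L_N\subset L_N$ the restricted action; it is the canonical one, given by $\Delta\cdot\hat\iota\bigl(e(e'_i\otimes(e_j\otimes u_l))\bigr)=E^\eta_{i,j}\,\mathbf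 u_l$ in $L_N^+$ for all $i,j\in(\mathbb Z/p)^g$ and $1\le l\le 2g$. -/

import Mathlib

open scoped TensorProduct commutatorElement

noncomputable section

namespace MagnusBraid

/-! ### The braid group -/

/-- The Artin relations on generators `σ₁, …, σ_m` (indexed by `Fin m`, so `σ_{l+1}` is `l`). -/
def artinRels (m : ℕ) : Set (FreeGroup (Fin m)) :=
  {w | ∃ i j : Fin m, (i : ℕ) + 1 = j ∧
      w = (FreeGroup.of i * FreeGroup.of j * FreeGroup.of i) *
        (FreeGroup.of j * FreeGroup.of i * FreeGroup.of j)⁻¹} ∪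
  {w | ∃ i j : Fin m, (i : ℕ) + 1 < j ∧
      w = (FreeGroup.of i * FreeGroup.of j) * (FreeGroup.of j * FreeGroup.of i)⁻¹}

/-- The braid group `Br_{2g+1}` on `2g+1` strings, with its `2g` Artin generators. -/
abbrev Braid (g : ℕ) : Type := PresentedGroup (artinRels (2 * g))

/-- The Artin generator `σ_{l+1}`. -/
def sigma {g : ℕ} (l : Fin (2 * g)) : Braid g := PresentedGroup.of l

/-! ### The free group `F_{2g}` and its braid group action -/

/-- The free group on `x₁, …, x_{2g}`. -/
abbrev F (g : ℕ) : Type := FreeGroup (Fin (2 * g))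

/-- The generator `x_n` with its usual index `1 ≤ n ≤ 2g`. -/
def xF (g n : ℕ) : F g :=
  if h : 1 ≤ n ∧ n ≤ 2 * g then FreeGroup.of ⟨n - 1, by omega⟩ else 1

/-- The endomorphism of `F_{2g}` induced by `σ_l`:
`x_{l-1} ↦ x_{l-1} x_l`, `x_{l+1} ↦ x_l⁻¹ x_{l+1}`, the other generators being fixed. -/
def sigmaF {g : ℕ} (l : Fin (2 * g)) : F g →* F g :=
  FreeGroup.lift fun j =>
    if (j : ℕ) + 1 = l then FreeGroup.of j * FreeGroup.of l
    else if (l : ℕ) + 1 = j then (FreeGroup.of l)⁻¹ * FreeGroup.of j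
    else FreeGroup.of j

/-- The inverse of `sigmaF l`. -/
def sigmaFInv {g : ℕ} (l : Fin (2 * g)) : F g →* F g :=
  FreeGroup.lift fun j =>
    if (j : ℕ) + 1 = l then FreeGroup.of j * (FreeGroup.of l)⁻¹
    else if (l : ℕ) + 1 = j then FreeGroup.of l * FreeGroup.of j
    else FreeGroup.of j

theorem sigmaF_of {g : ℕ} (l j : Fin (2 * g)) : sigmaF l (FreeGroup.of j) =
    if (j : ℕ) + 1 = l then FreeGroup.of j * FreeGroup.of l
    else if (l : ℕ) + 1 = j then (FreeGroup.of l)⁻¹ * FreeGroup.of j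
    else FreeGroup.of j := by
  simp [sigmaF]

theorem sigmaFInv_of {g : ℕ} (l j : Fin (2 * g)) : sigmaFInv l (FreeGroup.of j) =
    if (j : ℕ) + 1 = l then FreeGroup.of j * (FreeGroup.of l)⁻¹
    else if (l : ℕ) + 1 = j then FreeGroup.of l * FreeGroup.of j
    else FreeGroup.of j := by
  simp [sigmaFInv]

theorem sigmaF_of_prev {g : ℕ} {l j : Fin (2 * g)} (h : (j : ℕ) + 1 = l) :
    sigmaF l (FreeGroup.of j) = FreeGroup.of j * FreeGroup.of l := by
  rw [sigmaF_of, if_pos h]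

theorem sigmaF_of_next {g : ℕ} {l j : Fin (2 * g)} (h : (l : ℕ) + 1 = j) :
    sigmaF l (FreeGroup.of j) = (FreeGroup.of l)⁻¹ * FreeGroup.of j := by
  rw [sigmaF_of, if_neg (by omega), if_pos h]

theorem sigmaF_of_far {g : ℕ} {l j : Fin (2 * g)} (h : (j : ℕ) + 1 ≠ l) (h' : (l : ℕ) + 1 ≠ j) :
    sigmaF l (FreeGroup.of j) = FreeGroup.of j := by
  rw [sigmaF_of, if_neg h, if_neg h']

theorem sigmaF_of_self {g : ℕ} (l : Fin (2 * g)) :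
    sigmaF l (FreeGroup.of l) = FreeGroup.of l :=
  sigmaF_of_far (by omega) (by omega)

theorem sigmaF_comp_inv {g : ℕ} (l : Fin (2 * g)) :
    (sigmaF l).comp (sigmaFInv l) = MonoidHom.id _ := by
  ext j
  simp only [MonoidHom.comp_apply, MonoidHom.id_apply, sigmaFInv_of]
  split_ifs with h1 h2
  · simp [sigmaF_of_prev h1, sigmaF_of_self]
  · simp [sigmaF_of_next h2, sigmaF_of_self]
  · exact sigmaF_of_far h1 h2

theorem sigmaFInv_of_self {g : ℕ} (l : Fin (2 * g)) :
    sigmaFInv l (FreeGroup.of l) = FreeGroup.of l := by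
  rw [sigmaFInv_of, if_neg (by omega), if_neg (by omega)]

theorem sigmaFInv_comp {g : ℕ} (l : Fin (2 * g)) :
    (sigmaFInv l).comp (sigmaF l) = MonoidHom.id _ := by
  ext j
  simp only [MonoidHom.comp_apply, MonoidHom.id_apply, sigmaF_of]
  split_ifs with h1 h2
  · rw [map_mul, sigmaFInv_of_self, sigmaFInv_of, if_pos h1]; simp
  · rw [map_mul, map_inv, sigmaFInv_of_self, sigmaFInv_of, if_neg h1, if_pos h2]; simp
  · rw [sigmaFInv_of, if_neg h1, if_neg h2]

/-- `σ_l` as an automorphism of `F_{2g}`. -/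
def sigmaAut {g : ℕ} (l : Fin (2 * g)) : MulAut (F g) :=
  MonoidHom.toMulEquiv (sigmaF l) (sigmaFInv l) (sigmaFInv_comp l) (sigmaF_comp_inv l)

theorem sigmaAut_apply {g : ℕ} (l : Fin (2 * g)) (w : F g) : sigmaAut l w = sigmaF l w := rfl

theorem mulAut_ext_of {g : ℕ} {φ ψ : MulAut (F g)}
    (h : ∀ j, φ (FreeGroup.of j) = ψ (FreeGroup.of j)) : φ = ψ := by
  have : φ.toMonoidHom = ψ.toMonoidHom := FreeGroup.ext_hom _ _ h
  exact MulEquiv.ext fun w => DFunLike.congr_fun this w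

theorem sigmaAut_braid {g : ℕ} {i j : Fin (2 * g)} (h : (i : ℕ) + 1 = j) :
    sigmaAut i * sigmaAut j * sigmaAut i = sigmaAut j * sigmaAut i * sigmaAut j := by
  apply mulAut_ext_of
  intro k
  simp only [MulAut.mul_apply, sigmaAut_apply]
  have hij : sigmaF i (FreeGroup.of j) = (FreeGroup.of i)⁻¹ * FreeGroup.of j := sigmaF_of_next h
  have hji : sigmaF j (FreeGroup.of i) = FreeGroup.of i * FreeGroup.of j := sigmaF_of_prev h
  have hii := sigmaF_of_self i
  have hjj := sigmaF_of_self j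
  by_cases k1 : (k : ℕ) + 1 = i
  · have a := sigmaF_of_prev k1
    have b : sigmaF j (FreeGroup.of k) = FreeGroup.of k := sigmaF_of_far (by omega) (by omega)
    simp [a, b, hij, hji, hii, mul_assoc]
  by_cases k2 : k = i
  · subst k2
    simp [hij, hji, hii, hjj]
  by_cases k3 : k = j
  · subst k3
    simp [hij, hji, hii, hjj, mul_assoc]
  have k2' : (k : ℕ) ≠ i := fun e => k2 (Fin.ext e)
  have k3' : (k : ℕ) ≠ j := fun e => k3 (Fin.ext e)
  by_cases k4 : (j : ℕ) + 1 = k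
  · have a := sigmaF_of_next k4
    have b : sigmaF i (FreeGroup.of k) = FreeGroup.of k := sigmaF_of_far (by omega) (by omega)
    simp [a, b, hij, hji, hjj, mul_assoc]
  · have a : sigmaF j (FreeGroup.of k) = FreeGroup.of k := sigmaF_of_far (by omega) (by omega)
    have b : sigmaF i (FreeGroup.of k) = FreeGroup.of k := sigmaF_of_far (by omega) (by omega)
    simp [a, b]

theorem sigmaAut_comm {g : ℕ} {i j : Fin (2 * g)} (h : (i : ℕ) + 1 < j) :
    sigmaAut i * sigmaAut j = sigmaAut j * sigmaAut i := by
  apply mulAut_ext_of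
  intro k
  simp only [MulAut.mul_apply, sigmaAut_apply]
  have hij : sigmaF i (FreeGroup.of j) = FreeGroup.of j := sigmaF_of_far (by omega) (by omega)
  have hji : sigmaF j (FreeGroup.of i) = FreeGroup.of i := sigmaF_of_far (by omega) (by omega)
  by_cases k1 : (k : ℕ) + 1 = i
  · have a := sigmaF_of_prev k1
    have b : sigmaF j (FreeGroup.of k) = FreeGroup.of k := sigmaF_of_far (by omega) (by omega)
    simp [a, b, hji]
  by_cases k2 : (j : ℕ) + 1 = k
  · have a := sigmaF_of_next k2
    have b : sigmaF i (FreeGroup.of k) = FreeGroup.of k := sigmaF_of_far (by omega) (by omega)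
    simp [a, b, hij]
  by_cases k3 : (i : ℕ) + 1 = k
  · have a := sigmaF_of_next k3
    by_cases k4 : (k : ℕ) + 1 = j
    · have b := sigmaF_of_prev k4
      simp [a, b, hij, hji, mul_assoc]
    · have b : sigmaF j (FreeGroup.of k) = FreeGroup.of k := sigmaF_of_far (by omega) (by omega)
      simp [a, b, hji]
  · have b : sigmaF i (FreeGroup.of k) = FreeGroup.of k := sigmaF_of_far (by omega) (by omega)
    by_cases k4 : (k : ℕ) + 1 = j
    · have a := sigmaF_of_prev k4
      simp [a, b, hij]
    · have a : sigmaF j (FreeGroup.of k) = FreeGroup.of k := sigmaF_of_far (by omega) (by omega)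
      simp [a, b]

/-- The action of the braid group on `F_{2g}`. -/
def braidAut (g : ℕ) : Braid g →* MulAut (F g) :=
  PresentedGroup.toGroup (f := sigmaAut) (by
    rintro r (⟨i, j, h, rfl⟩ | ⟨i, j, h, rfl⟩)
    · simp only [map_mul, map_inv, FreeGroup.lift_apply_of, mul_inv_eq_one]
      exact sigmaAut_braid h
    · simp only [map_mul, map_inv, FreeGroup.lift_apply_of, mul_inv_eq_one]
      exact sigmaAut_comm h)

theorem braidAut_sigma {g : ℕ} (l : Fin (2 * g)) : braidAut g (sigma l) = sigmaAut l :=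
  PresentedGroup.toGroup.of _

theorem F_induction {g : ℕ} {P : F g → Prop} (one : P 1) (of : ∀ j, P (FreeGroup.of j))
    (inv : ∀ a, P a → P a⁻¹) (mul : ∀ a b, P a → P b → P (a * b)) (w : F g) : P w :=
  FreeGroup.induction_on w one of (fun _ h => inv _ h) mul

/-! ### The finite quotient `H(p, 2g)` -/

/-- The exponent sums of a word, i.e. its class in `F_{2g}^{ab} = ℤ^{2g}`. -/
def expo {g : ℕ} (i : Fin (2 * g)) : F g →* Multiplicative ℤ :=
  FreeGroup.lift fun j => Multiplicative.ofAdd (if j = i then 1 else 0)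

/-- `ω_{i,j} = j - i` if `|i - j| = 1`, and `0` otherwise. -/
def omegaMat {g : ℕ} (i j : Fin (2 * g)) : ℤ :=
  if |(i : ℤ) - (j : ℤ)| = 1 then (j : ℤ) - (i : ℤ) else 0

/-- The intersection form `ω` on `F_{2g}^{ab}`, evaluated on the classes of two words. -/
def omega {g : ℕ} (a b : F g) : ℤ :=
  ∑ i, ∑ j, omegaMat i j * (expo i a).toAdd * (expo j b).toAdd

/-- An auxiliary Heisenberg group, used to construct the contraction map. -/
@[ext]
structure Heis (g p : ℕ) where
  v : Fin (2 * g) → ZMod p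
  z : ZMod p

namespace Heis

variable {g p : ℕ}

/-- The cocycle `∑ᵢ vᵢ wᵢ₊₁`. -/
def beta (v w : Fin (2 * g) → ZMod p) : ZMod p :=
  ∑ i : Fin (2 * g), ∑ j : Fin (2 * g), if (i : ℕ) + 1 = (j : ℕ) then v i * w j else 0

theorem beta_add_left (v v' w : Fin (2 * g) → ZMod p) :
    beta (v + v') w = beta v w + beta v' w := by
  simp only [beta, ← Finset.sum_add_distrib]
  refine Finset.sum_congr rfl fun i _ => Finset.sum_congr rfl fun j _ => ?_
  split_ifs <;> simp [add_mul]

theorem beta_add_right (v w w' : Fin (2 * g) → ZMod p) :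
    beta v (w + w') = beta v w + beta v w' := by
  simp only [beta, ← Finset.sum_add_distrib]
  refine Finset.sum_congr rfl fun i _ => Finset.sum_congr rfl fun j _ => ?_
  split_ifs <;> simp [mul_add]

theorem beta_zero_left (w : Fin (2 * g) → ZMod p) : beta 0 w = 0 := by simp [beta]

theorem beta_zero_right (w : Fin (2 * g) → ZMod p) : beta w 0 = 0 := by simp [beta]

theorem beta_neg_left (v w : Fin (2 * g) → ZMod p) : beta (-v) w = -beta v w := by
  rw [eq_neg_iff_add_eq_zero, ← beta_add_left]; simp [beta_zero_left]

instance : Mul (Heis g p) := ⟨fun x y => ⟨x.v + y.v, x.z + y.z + beta x.v y.v⟩⟩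
instance : One (Heis g p) := ⟨⟨0, 0⟩⟩
instance : Inv (Heis g p) := ⟨fun x => ⟨-x.v, -x.z + beta x.v x.v⟩⟩

@[simp] theorem mul_v (x y : Heis g p) : (x * y).v = x.v + y.v := rfl
@[simp] theorem mul_z (x y : Heis g p) : (x * y).z = x.z + y.z + beta x.v y.v := rfl
@[simp] theorem one_v : (1 : Heis g p).v = 0 := rfl
@[simp] theorem one_z : (1 : Heis g p).z = 0 := rfl
@[simp] theorem inv_v (x : Heis g p) : x⁻¹.v = -x.v := rfl
@[simp] theorem inv_z (x : Heis g p) : x⁻¹.z = -x.z + beta x.v x.v := rfl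

instance : Group (Heis g p) :=
  Group.ofLeftAxioms
    (fun a b c => by
      ext i
      · simp [add_assoc]
      · simp only [mul_z, mul_v, beta_add_left, beta_add_right]; ring)
    (fun a => by
      ext i
      · simp
      · simp [beta_zero_left])
    (fun a => by
      ext i
      · simp
      · simp [beta_neg_left])

theorem commutator_eq (x y : Heis g p) : ⁅x, y⁆ = ⟨0, beta x.v y.v - beta y.v x.v⟩ := by
  rw [commutatorElement_def, mul_inv_eq_iff_eq_mul, mul_inv_eq_iff_eq_mul]
  ext i
  · simp [add_comm]
  · simp [beta_zero_left]; ring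

end Heis

/-- The homomorphism from `F_{2g}` to the auxiliary group with `x_i ↦ (e_i, 0)`. -/
def heisF (g p : ℕ) : F g →* Heis g p :=
  FreeGroup.lift fun i => ⟨Pi.single i 1, 0⟩

theorem heisF_v {g : ℕ} (p : ℕ) (w : F g) (i : Fin (2 * g)) :
    (heisF g p w).v i = ((expo i w).toAdd : ZMod p) := by
  induction w using F_induction with
  | one => simp
  | of j =>
    simp only [heisF, expo, FreeGroup.lift_apply_of, toAdd_ofAdd, Pi.single_apply]
    by_cases h : i = j
    · simp [h]
    · simp [h, Ne.symm h]
  | inv a h => simp [h]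
  | mul a b ha hb => simp [ha, hb]

theorem heisF_v_commutator {g : ℕ} (p : ℕ) (w : F g) (hw : w ∈ commutator (F g)) :
    (heisF g p w).v = 0 := by
  have h : commutator (F g) ≤
      (⨅ i : Fin (2 * g), (expo i).ker : Subgroup (F g)) :=
    le_iInf fun i => Abelianization.commutator_subset_ker (expo i)
  funext i
  have hi := (Subgroup.mem_iInf.1 (h hw)) i
  rw [heisF_v, MonoidHom.mem_ker.1 hi]
  simp

/-- The contraction map `[F_{2g}, F_{2g}] → ℤ/p`; it is the homomorphism with
`[a, b] ↦ ω(a, b) mod p`, see `contraction_commutator`. -/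
def contraction (g p : ℕ) : commutator (F g) →* Multiplicative (ZMod p) where
  toFun w := Multiplicative.ofAdd (heisF g p w).z
  map_one' := by simp
  map_mul' a b := by
    simp [heisF_v_commutator p _ a.2, Heis.beta_zero_left]

theorem beta_sub_beta {g : ℕ} (p : ℕ) (a b : F g) :
    Heis.beta (heisF g p a).v (heisF g p b).v - Heis.beta (heisF g p b).v (heisF g p a).v =
      (omega a b : ZMod p) := by
  simp only [Heis.beta, omega, Int.cast_sum]
  conv_lhs => arg 2; rw [Finset.sum_comm]
  rw [← Finset.sum_sub_distrib]
  refine Finset.sum_congr rfl fun i _ => ?_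
  rw [← Finset.sum_sub_distrib]
  refine Finset.sum_congr rfl fun j _ => ?_
  simp only [heisF_v, omegaMat]
  by_cases h1 : (i : ℕ) + 1 = j
  · have e : (j : ℤ) = i + 1 := by omega
    rw [if_pos h1, if_neg (by omega), if_pos (by rw [e]; simp), e]
    push_cast; ring
  · by_cases h2 : (j : ℕ) + 1 = i
    · have e : (i : ℤ) = j + 1 := by omega
      rw [if_neg h1, if_pos h2, if_pos (by rw [e]; simp), e]
      push_cast; ring
    · rw [if_neg h1, if_neg h2, if_neg]
      · simp
      · intro h
        rcases (abs_eq (by norm_num)).1 h with h | h <;> omega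

theorem contraction_commutator (g p : ℕ) (a b : F g)
    (h : ⁅a, b⁆ ∈ commutator (F g)) :
    contraction g p ⟨⁅a, b⁆, h⟩ = Multiplicative.ofAdd (omega a b : ZMod p) := by
  rw [← beta_sub_beta]
  simp [contraction, map_commutatorElement, Heis.commutator_eq]

/-- The kernel of the contraction map, as a set of words. -/
def kerContraction (g p : ℕ) : Set (F g) :=
  {w | ∃ h : w ∈ commutator (F g), contraction g p ⟨w, h⟩ = 1}

/-- The kernel `N` of `F_{2g} → H(p, 2g)`: the normal subgroup generated by the third term of the
lower central series, the `p`-th powers and the kernel of the contraction map. -/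
def N (g p : ℕ) : Subgroup (F g) :=
  Subgroup.normalClosure
    ({w | w ∈ (⁅commutator (F g), ⊤⁆ : Subgroup (F g))} ∪ {w | ∃ a : F g, w = a ^ p} ∪
      kerContraction g p)

instance (g p : ℕ) : (N g p).Normal := Subgroup.normalClosure_normal

/-- The finite group `G = H(p, 2g) = F_{2g} / N`. -/
abbrev G (g p : ℕ) : Type := F g ⧸ N g p

/-- The quotient map `ρ_N`. -/
def rho (g p : ℕ) : F g →* G g p := QuotientGroup.mk' (N g p)

/-- The element `x_n ∈ G`, `1 ≤ n ≤ 2g`. -/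
def x (g p n : ℕ) : G g p := rho g p (xF g n)

/-- The central element `c = [x₁, x₂]`. -/
def c (g p : ℕ) : G g p := ⁅x g p 1, x g p 2⁆

theorem omega_of_right {g : ℕ} (a : F g) (l : Fin (2 * g)) :
    omega a (FreeGroup.of l) = ∑ i, omegaMat i l * (expo i a).toAdd := by
  refine Finset.sum_congr rfl fun i _ => ?_
  rw [Finset.sum_eq_single l] <;> simp +contextual [expo, eq_comm]

theorem omegaMat_antisymm {g : ℕ} (i j : Fin (2 * g)) : omegaMat i j = -omegaMat j i := by
  unfold omegaMat
  rw [abs_sub_comm]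
  split_ifs <;> ring

theorem omegaMat_self {g : ℕ} (i : Fin (2 * g)) : omegaMat i i = 0 := by
  simp [omegaMat]

theorem omega_mul_left {g : ℕ} (a a' b : F g) : omega (a * a') b = omega a b + omega a' b := by
  simp only [omega, ← Finset.sum_add_distrib]
  refine Finset.sum_congr rfl fun i _ => Finset.sum_congr rfl fun j _ => ?_
  simp; ring

theorem omega_inv_left {g : ℕ} (a b : F g) : omega a⁻¹ b = -omega a b := by
  simp only [omega, ← Finset.sum_neg_distrib]
  refine Finset.sum_congr rfl fun i _ => Finset.sum_congr rfl fun j _ => ?_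
  simp

theorem expo_sigma {g : ℕ} (l k : Fin (2 * g)) (w : F g) :
    (expo k (sigmaF l w)).toAdd =
      (expo k w).toAdd + if k = l then omega w (FreeGroup.of l) else 0 := by
  induction w using F_induction with
  | one => simp [omega]
  | of j =>
    have ho : omega (FreeGroup.of j) (FreeGroup.of l) = omegaMat j l := by
      rw [omega_of_right, Finset.sum_eq_single j] <;> simp +contextual [expo, eq_comm]
    rw [ho]
    by_cases h1 : (j : ℕ) + 1 = l
    · have e : (l : ℤ) = j + 1 := by omega
      rw [sigmaF_of_prev h1]
      simp [omegaMat, e, expo, eq_comm]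
    by_cases h2 : (l : ℕ) + 1 = j
    · have e : (j : ℤ) = l + 1 := by omega
      rw [sigmaF_of_next h2]
      simp only [omegaMat, e, expo, eq_comm, map_mul, map_inv, FreeGroup.lift_apply_of]
      by_cases h : k = l
      · simp [h, add_comm]
      · simp [Ne.symm h]
    · rw [sigmaF_of_far h1 h2]
      have : omegaMat j l = 0 := by
        rw [omegaMat, if_neg]
        intro h
        rcases (abs_eq (by norm_num)).1 h with h | h <;> omega
      simp [this]
  | inv a h =>
    simp only [map_inv, toAdd_inv, h, omega_inv_left]
    split_ifs <;> ring
  | mul a b ha hb =>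
    simp only [map_mul, toAdd_mul, ha, hb, omega_mul_left]
    split_ifs <;> ring

theorem omega_antisymm {g : ℕ} (a b : F g) : omega a b = -omega b a := by
  unfold omega
  rw [Finset.sum_comm, ← Finset.sum_neg_distrib]
  refine Finset.sum_congr rfl fun i _ => ?_
  rw [← Finset.sum_neg_distrib]
  refine Finset.sum_congr rfl fun j _ => ?_
  rw [omegaMat_antisymm]; ring

theorem omega_sigma {g : ℕ} (l : Fin (2 * g)) (a b : F g) :
    omega (sigmaF l a) (sigmaF l b) = omega a b := by
  have hL : ∀ u w : F g, omega (sigmaF l u) w =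
      omega u w + omega u (FreeGroup.of l) * omega (FreeGroup.of l) w := by
    intro u w
    have h1 : omega (FreeGroup.of l) w = ∑ j, omegaMat l j * (expo j w).toAdd := by
      unfold omega
      rw [Finset.sum_eq_single l]
      · simp [expo]
      · intro i _ hi
        simp [expo, Ne.symm hi]
      · simp
    have h2 : ∀ i : Fin (2 * g), ∑ j, omegaMat i j * (expo i (sigmaF l u)).toAdd *
        (expo j w).toAdd = ∑ j, omegaMat i j * (expo i u).toAdd * (expo j w).toAdd +
          if i = l then omega u (FreeGroup.of l) * omega (FreeGroup.of l) w else 0 := by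
      intro i
      rw [expo_sigma]
      split_ifs with h
      · subst h
        rw [h1, Finset.mul_sum, ← Finset.sum_add_distrib]
        exact Finset.sum_congr rfl fun j _ => by ring
      · simp
    conv_lhs => unfold omega
    rw [Finset.sum_congr rfl fun i _ => h2 i, Finset.sum_add_distrib]
    simp [omega]
  have hll : omega (FreeGroup.of l) (FreeGroup.of l) = 0 := by
    have := omega_antisymm (FreeGroup.of l) (FreeGroup.of l); omega
  rw [hL, omega_antisymm a (sigmaF l b), omega_antisymm (FreeGroup.of l) (sigmaF l b), hL, hL, hll,
    omega_antisymm a b, omega_antisymm (FreeGroup.of l) a]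
  ring

theorem omega_braid {g : ℕ} (s : Braid g) (a b : F g) :
    omega (braidAut g s a) (braidAut g s b) = omega a b := by
  let S : Subgroup (Braid g) :=
    { carrier := {s | ∀ a b, omega (braidAut g s a) (braidAut g s b) = omega a b}
      one_mem' := fun a b => by simp
      mul_mem' := fun {s t} hs ht a b => by
        simp only [map_mul, MulAut.mul_apply]
        rw [hs, ht]
      inv_mem' := fun {s} hs a b => by
        rw [← hs, ← MulAut.mul_apply, ← MulAut.mul_apply, ← map_mul]
        simp }
  have : s ∈ S := PresentedGroup.generated_by _ S (fun l a b => by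
    show omega (braidAut g (sigma l) a) (braidAut g (sigma l) b) = _
    rw [braidAut_sigma]
    exact omega_sigma l a b) s
  exact this a b

theorem contraction_invariant {g : ℕ} (p : ℕ) (φ : MulAut (F g))
    (hφ : ∀ a b, omega (φ a) (φ b) = omega a b) (w : F g) (hw : w ∈ commutator (F g)) :
    ∃ h : φ w ∈ commutator (F g), contraction g p ⟨φ w, h⟩ = contraction g p ⟨w, hw⟩ := by
  have hc : ∀ a b : F g, ⁅a, b⁆ ∈ commutator (F g) := fun a b =>
    Subgroup.commutator_mem_commutator (Subgroup.mem_top a) (Subgroup.mem_top b)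
  have hw' := hw
  rw [commutator_eq_closure] at hw'
  induction hw' using Subgroup.closure_induction with
  | mem x hx =>
    obtain ⟨a, b, rfl⟩ := hx
    have e : φ ⁅a, b⁆ = ⁅φ a, φ b⁆ := map_commutatorElement _ _ _
    refine ⟨e ▸ hc _ _, ?_⟩
    simp only [e]
    rw [contraction_commutator, contraction_commutator, hφ]
  | one => exact ⟨by simp, by simp [contraction]⟩
  | mul x y hx hy ihx ihy =>
    rw [← commutator_eq_closure] at hx hy
    obtain ⟨h1, e1⟩ := ihx hx
    obtain ⟨h2, e2⟩ := ihy hy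
    refine ⟨by rw [map_mul]; exact mul_mem h1 h2, ?_⟩
    have := congrArg₂ (· * ·) e1 e2
    simp only [← map_mul] at this
    simpa [← map_mul] using this
  | inv x hx ih =>
    rw [← commutator_eq_closure] at hx
    obtain ⟨h1, e1⟩ := ih hx
    refine ⟨by rw [map_inv]; exact inv_mem h1, ?_⟩
    have e2 := congrArg (·⁻¹) e1
    simp only [← map_inv] at e2
    have e3 : (⟨φ x⁻¹, by rw [map_inv]; exact inv_mem h1⟩ : commutator (F g)) =
        ⟨φ x, h1⟩⁻¹ := Subtype.ext (map_inv φ x)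
    rw [e3]
    exact e2

theorem N_le_comap {g : ℕ} (p : ℕ) (φ : MulAut (F g))
    (hφ : ∀ a b, omega (φ a) (φ b) = omega a b) : N g p ≤ (N g p).comap φ.toMonoidHom := by
  refine Subgroup.normalClosure_le_normal ?_
  rintro w ((hw | ⟨a, rfl⟩) | ⟨hw, h⟩)
  · refine Subgroup.subset_normalClosure (Or.inl (Or.inl ?_))
    have : Subgroup.map φ.toMonoidHom ⁅commutator (F g), (⊤ : Subgroup (F g))⁆ ≤
        ⁅commutator (F g), (⊤ : Subgroup (F g))⁆ := by
      rw [Subgroup.map_commutator]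
      refine Subgroup.commutator_mono ?_ le_top
      rw [commutator_def, Subgroup.map_commutator]
      exact Subgroup.commutator_mono le_top le_top
    exact this (Subgroup.mem_map_of_mem _ hw)
  · refine Subgroup.subset_normalClosure (Or.inl (Or.inr ⟨φ a, ?_⟩))
    simp
  · refine Subgroup.subset_normalClosure (Or.inr ?_)
    obtain ⟨h1, h2⟩ := contraction_invariant p φ hφ w hw
    exact ⟨h1, h2.trans h⟩

/-- The automorphism (as an endomorphism) of `G` induced by a braid. -/
def braidG (g p : ℕ) (s : Braid g) : G g p →* G g p :=
  QuotientGroup.map (N g p) (N g p) (braidAut g s).toMonoidHom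
    (N_le_comap p _ (omega_braid s))


/-! ### Fox derivation and Magnus modules -/

section Fox

variable {m : ℕ} {Γ : Type} [Group Γ]

/-- The affine bijection `v ↦ e_i + ρ(x_i) v` of the free module `⨁ ℂ[Γ] e_i`. -/
def foxStep (ρ : FreeGroup (Fin m) →* Γ) (i : Fin m) :
    Equiv.Perm (Fin m → MonoidAlgebra ℂ Γ) where
  toFun v := Pi.single i 1 + MonoidAlgebra.of ℂ Γ (ρ (FreeGroup.of i)) • v
  invFun v := MonoidAlgebra.of ℂ Γ (ρ (FreeGroup.of i))⁻¹ • (v - Pi.single i 1)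
  left_inv v := by
    show MonoidAlgebra.of ℂ Γ (ρ (FreeGroup.of i))⁻¹ • (Pi.single i 1 +
      MonoidAlgebra.of ℂ Γ (ρ (FreeGroup.of i)) • v - Pi.single i 1) = v
    rw [add_sub_cancel_left, smul_smul, ← map_mul, inv_mul_cancel, map_one, one_smul]
  right_inv v := by
    show Pi.single i 1 + MonoidAlgebra.of ℂ Γ (ρ (FreeGroup.of i)) •
      MonoidAlgebra.of ℂ Γ (ρ (FreeGroup.of i))⁻¹ • (v - Pi.single i 1) = v
    rw [smul_smul, ← map_mul, mul_inv_cancel, map_one, one_smul, add_sub_cancel]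

/-- The Fox derivation with values in the free module `⨁ ℂ[Γ] e_i`; it is the crossed
homomorphism with `x_i ↦ e_i`, see `foxDeriv_of` and `foxDeriv_mul`. -/
def foxDeriv (ρ : FreeGroup (Fin m) →* Γ) (w : FreeGroup (Fin m)) :
    Fin m → MonoidAlgebra ℂ Γ :=
  FreeGroup.lift (foxStep ρ) w 0

theorem foxDeriv_of (ρ : FreeGroup (Fin m) →* Γ) (i : Fin m) :
    foxDeriv ρ (FreeGroup.of i) = Pi.single i 1 := by
  simp [foxDeriv, foxStep]

theorem foxLift_apply (ρ : FreeGroup (Fin m) →* Γ) (w : FreeGroup (Fin m))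
    (v : Fin m → MonoidAlgebra ℂ Γ) :
    FreeGroup.lift (foxStep ρ) w v = foxDeriv ρ w + MonoidAlgebra.of ℂ Γ (ρ w) • v := by
  have inv : ∀ a : FreeGroup (Fin m), (∀ v : Fin m → MonoidAlgebra ℂ Γ,
      FreeGroup.lift (foxStep ρ) a v = foxDeriv ρ a + MonoidAlgebra.of ℂ Γ (ρ a) • v) →
      ∀ v : Fin m → MonoidAlgebra ℂ Γ, FreeGroup.lift (foxStep ρ) a⁻¹ v =
        foxDeriv ρ a⁻¹ + MonoidAlgebra.of ℂ Γ (ρ a⁻¹) • v := by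
    intro a h v
    rw [map_inv, Equiv.Perm.inv_eq_iff_eq, h, smul_add, smul_smul, ← map_mul, ← map_mul,
      mul_inv_cancel, map_one, map_one, one_smul, ← add_assoc, ← h, foxDeriv, map_inv]
    simp
  revert v
  refine FreeGroup.induction_on w ?_ ?_ (fun _ h => inv _ h) ?_
  · intro v; rw [map_one, map_one, map_one, one_smul]; simp [foxDeriv]
  · intro i v
    show FreeGroup.lift (foxStep ρ) (FreeGroup.of i) v = foxDeriv ρ (FreeGroup.of i) + _
    rw [foxDeriv_of, FreeGroup.lift_apply_of]
    rfl
  · intro a b ha hb v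
    have e : foxDeriv ρ (a * b) = foxDeriv ρ a + MonoidAlgebra.of ℂ Γ (ρ a) • foxDeriv ρ b := by
      rw [← ha, foxDeriv, foxDeriv, map_mul, Equiv.Perm.mul_apply]
    rw [e, map_mul, Equiv.Perm.mul_apply, hb, ha, smul_add, smul_smul, map_mul, map_mul, add_assoc]

theorem foxDeriv_mul (ρ : FreeGroup (Fin m) →* Γ) (a b : FreeGroup (Fin m)) :
    foxDeriv ρ (a * b) = foxDeriv ρ a + MonoidAlgebra.of ℂ Γ (ρ a) • foxDeriv ρ b := by
  rw [← foxLift_apply, foxDeriv, foxDeriv, map_mul, Equiv.Perm.mul_apply]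

theorem foxDeriv_one (ρ : FreeGroup (Fin m) →* Γ) : foxDeriv ρ 1 = 0 := by simp [foxDeriv]

theorem foxDeriv_inv (ρ : FreeGroup (Fin m) →* Γ) (a : FreeGroup (Fin m)) :
    foxDeriv ρ a⁻¹ = -(MonoidAlgebra.of ℂ Γ (ρ a)⁻¹ • foxDeriv ρ a) := by
  have h := foxDeriv_mul ρ a⁻¹ a
  rw [inv_mul_cancel, foxDeriv_one, map_inv] at h
  exact eq_neg_of_add_eq_zero_left h.symm

end Fox

/-- The (complexified) Magnus module `L_N = ⨁ ℂ[G] e_i`. -/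
abbrev LN (g p : ℕ) : Type := Fin (2 * g) → MonoidAlgebra ℂ (G g p)

/-- The Fox derivation `d_N : F_{2g} → L_N`. -/
def dN (g p : ℕ) : F g → LN g p := foxDeriv (rho g p)

/-- The linear map on `L_N` induced by a braid `s`: it is semilinear with respect to the induced
automorphism of `ℂ[G]` and satisfies `s · d_N(w) = d_N(s · w)`, see `braidL_dN`. -/
def braidL (g p : ℕ) (s : Braid g) : LN g p →ₗ[ℂ] LN g p where
  toFun v := ∑ i, MonoidAlgebra.mapDomainRingHom ℂ (braidG g p s) (v i) •
    dN g p (braidAut g s (FreeGroup.of i))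
  map_add' v w := by
    simp only [Pi.add_apply, map_add, add_smul, Finset.sum_add_distrib]
  map_smul' r v := by
    simp only [Pi.smul_apply, Finset.smul_sum, RingHom.id_apply]
    refine Finset.sum_congr rfl fun i _ => ?_
    rw [← smul_assoc]
    congr 1
    exact MonoidAlgebra.mapDomain_smul ..

theorem braidL_smul (g p : ℕ) (s : Braid g) (a : MonoidAlgebra ℂ (G g p)) (v : LN g p) :
    braidL g p s (a • v) = MonoidAlgebra.mapDomainRingHom ℂ (braidG g p s) a • braidL g p s v := by
  simp only [braidL, LinearMap.coe_mk, AddHom.coe_mk, Pi.smul_apply, smul_eq_mul, map_mul,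
    Finset.smul_sum, smul_smul]

theorem mapDomain_of_rho (g p : ℕ) (s : Braid g) (w : F g) :
    MonoidAlgebra.mapDomainRingHom ℂ (braidG g p s) (MonoidAlgebra.of ℂ (G g p) (rho g p w)) =
      MonoidAlgebra.of ℂ (G g p) (rho g p (braidAut g s w)) := by
  simp [MonoidAlgebra.of_apply, MonoidAlgebra.mapDomain_single]
  rfl

theorem braidL_dN (g p : ℕ) (s : Braid g) (w : F g) :
    braidL g p s (dN g p w) = dN g p (braidAut g s w) := by
  induction w using F_induction with
  | one => simp [dN, foxDeriv_one]
  | of j =>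
    simp only [dN, foxDeriv_of, braidL, LinearMap.coe_mk, AddHom.coe_mk]
    rw [Finset.sum_eq_single j]
    · simp
    · intro i _ hi
      simp [hi]
    · simp
  | inv a h =>
    unfold dN at *
    rw [foxDeriv_inv, map_neg, braidL_smul, h, map_inv (braidAut g s), foxDeriv_inv,
      ← map_inv (rho g p), mapDomain_of_rho, map_inv, map_inv]
  | mul a b ha hb =>
    unfold dN at *
    rw [foxDeriv_mul, map_add, braidL_smul, ha, hb, map_mul (braidAut g s), foxDeriv_mul,
      mapDomain_of_rho]

theorem braidL_ext {g p : ℕ} {φ ψ : LN g p →ₗ[ℂ] LN g p}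
    (h : ∀ (w : F g) (i : Fin (2 * g)),
      φ (MonoidAlgebra.of ℂ (G g p) (rho g p w) • dN g p (FreeGroup.of i)) =
      ψ (MonoidAlgebra.of ℂ (G g p) (rho g p w) • dN g p (FreeGroup.of i))) : φ = ψ := by
  refine LinearMap.pi_ext fun i a => ?_
  induction a using MonoidAlgebra.induction_on with
  | of γ =>
    obtain ⟨w, rfl⟩ := QuotientGroup.mk'_surjective (N g p) γ
    have := h w i
    simpa [dN, foxDeriv_of, ← Pi.single_smul', rho] using this
  | add a b ha hb => rw [Pi.single_add, map_add, map_add, ha, hb]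
  | smul r a ha => rw [Pi.single_smul, map_smul, map_smul, ha]

/-- The action of the braid group on the Magnus module `L_N`. -/
def magnusRep (g p : ℕ) : Representation ℂ (Braid g) (LN g p) where
  toFun := braidL g p
  map_one' := by
    apply braidL_ext
    intro w i
    rw [braidL_smul, mapDomain_of_rho, braidL_dN]
    simp
  map_mul' s t := by
    apply braidL_ext
    intro w i
    rw [Module.End.mul_apply, braidL_smul, braidL_smul, braidL_smul, mapDomain_of_rho, braidL_dN,
      braidL_dN, braidL_dN, mapDomain_of_rho, mapDomain_of_rho]
    simp

/-! ### The module `V_g^η` -/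

/-- `η^a` for a residue class `a` mod `p`. -/
def ePow {p : ℕ} (η : ℂ) (a : ZMod p) : ℂ := η ^ a.val

theorem ePow_zero {p : ℕ} (η : ℂ) : ePow η (0 : ZMod p) = 1 := by simp [ePow]

theorem ePow_natCast {p : ℕ} {η : ℂ} (hη : IsPrimitiveRoot η p) (n : ℕ) :
    ePow η (n : ZMod p) = η ^ n := by
  rw [ePow, ZMod.val_natCast, ← pow_eq_pow_mod n hη.pow_eq_one]

theorem ePow_add {p : ℕ} [NeZero p] {η : ℂ} (hη : IsPrimitiveRoot η p) (a b : ZMod p) :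
    ePow η (a + b) = ePow η a * ePow η b := by
  rw [← ZMod.natCast_zmod_val a, ← ZMod.natCast_zmod_val b, ← Nat.cast_add, ePow_natCast hη,
    ePow_natCast hη, ePow_natCast hη, pow_add]

/-- The vector space `V_g^η` with basis `e_j`, `j ∈ (ℤ/p)^g`. The basis vector `e_j` is
`Finsupp.single j 1`. -/
abbrev V (g p : ℕ) : Type := (Fin g → ZMod p) →₀ ℂ

/-- The coordinate vector `e_{k+1}` of `(ℤ/p)^g`; it is `0` for `k = g`. -/
def eVec (g p k : ℕ) : Fin g → ZMod p := fun m => if (m : ℕ) = k then 1 else 0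

/-- For the generator with (usual) number `2k-1` or `2k`, the index of the `k`-th coordinate. -/
def half {g : ℕ} (l : Fin (2 * g)) : Fin g := ⟨(l : ℕ) / 2, by omega⟩

/-- For the generator with (usual) number `2k-1` or `2k`, the vector `e_k - e_{k+1}`. -/
def step {g : ℕ} (p : ℕ) (l : Fin (2 * g)) : Fin g → ZMod p :=
  eVec g p ((l : ℕ) / 2) - eVec g p ((l : ℕ) / 2 + 1)

/-- The right action of `x_l ^ n` on `V_g^η`:
`e_j x_{2k-1}^n = η^{n j_k} e_j` and `e_j x_{2k}^n = e_{j - n(e_k - e_{k+1})}`.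
(The generator with usual number `2k-1`, resp. `2k`, has even, resp. odd, index.) -/
def xPow {g p : ℕ} (η : ℂ) (l : Fin (2 * g)) (n : ZMod p) : V g p →ₗ[ℂ] V g p :=
  Finsupp.linearCombination ℂ fun j =>
    if (l : ℕ) % 2 = 0 then ePow η (n * j (half l)) • Finsupp.single j 1
    else Finsupp.single (j - n • step p l) 1

theorem xPow_even {g p : ℕ} (η : ℂ) {l : Fin (2 * g)} (h : (l : ℕ) % 2 = 0) (n : ZMod p)
    (j : Fin g → ZMod p) : xPow η l n (Finsupp.single j 1) =
      ePow η (n * j (half l)) • Finsupp.single j 1 := by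
  rw [xPow, Finsupp.linearCombination_single, one_smul, if_pos h]

theorem xPow_odd {g p : ℕ} (η : ℂ) {l : Fin (2 * g)} (h : ¬ (l : ℕ) % 2 = 0) (n : ZMod p)
    (j : Fin g → ZMod p) : xPow η l n (Finsupp.single j 1) =
      Finsupp.single (j - n • step p l) 1 := by
  rw [xPow, Finsupp.linearCombination_single, one_smul, if_neg h]

theorem V_ext {g p : ℕ} {φ ψ : V g p →ₗ[ℂ] V g p}
    (h : ∀ j, φ (Finsupp.single j 1) = ψ (Finsupp.single j 1)) : φ = ψ :=
  Finsupp.lhom_ext' fun j => LinearMap.ext_ring (h j)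

theorem xPow_zero {g p : ℕ} {η : ℂ} (l : Fin (2 * g)) : xPow η l (0 : ZMod p) = 1 := by
  apply V_ext
  intro j
  by_cases h : (l : ℕ) % 2 = 0
  · rw [xPow_even η h]; simp [ePow_zero]
  · rw [xPow_odd η h]; simp

theorem eVec_apply {g p : ℕ} (k : ℕ) (m : Fin g) : eVec g p k m = if (m : ℕ) = k then 1 else 0 := rfl

theorem step_half {g p : ℕ} (l m : Fin (2 * g)) (hl : (l : ℕ) % 2 = 0) (hm : ¬ (m : ℕ) % 2 = 0) :
    step p m (half l) = (omegaMat l m : ZMod p) := by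
  simp only [step, half, omegaMat, Pi.sub_apply, eVec_apply]
  by_cases h1 : (l : ℕ) + 1 = m
  · have e : (m : ℤ) = l + 1 := by omega
    rw [if_pos (by omega), if_neg (by omega), if_pos (by rw [e]; simp), e]
    simp
  · by_cases h2 : (m : ℕ) + 1 = l
    · have e : (l : ℤ) = m + 1 := by omega
      rw [if_neg (by omega), if_pos (by omega), if_pos (by rw [e]; simp), e]
      simp
    · rw [if_neg (by omega), if_neg (by omega), if_neg]
      · simp
      · intro h
        rcases (abs_eq (by norm_num)).1 h with h | h <;> omega

theorem omegaMat_parity {g : ℕ} (l m : Fin (2 * g)) (h : (l : ℕ) % 2 = (m : ℕ) % 2) :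
    omegaMat l m = 0 := by
  rw [omegaMat, if_neg]
  intro h
  rcases (abs_eq (by norm_num)).1 h with h | h <;> omega

section RightAction

variable {g p : ℕ} [NeZero p] {η : ℂ}

theorem xPow_mul (hη : IsPrimitiveRoot η p) (l : Fin (2 * g)) (n m : ZMod p) :
    xPow η l n * xPow η l m = xPow η l (n + m) := by
  apply V_ext
  intro j
  rw [Module.End.mul_apply]
  by_cases h : (l : ℕ) % 2 = 0
  · rw [xPow_even η h, map_smul, xPow_even η h, xPow_even η h, smul_smul, ← ePow_add hη]
    congr 2; ring
  · rw [xPow_odd η h, xPow_odd η h, xPow_odd η h]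
    congr 1
    rw [add_smul]; abel

theorem xPow_pow (hη : IsPrimitiveRoot η p) (l : Fin (2 * g)) (n : ℕ) :
    xPow η l (1 : ZMod p) ^ n = xPow η l (n : ZMod p) := by
  induction n with
  | zero => simp [xPow_zero]
  | succ n ih => rw [pow_succ, ih, xPow_mul hη]; simp

/-- The right action of the generator `x_l` as an invertible element of `(End V)ᵐᵒᵖ`. -/
def xUnit (hη : IsPrimitiveRoot η p) (l : Fin (2 * g)) : (Module.End ℂ (V g p))ᵐᵒᵖˣ where
  val := MulOpposite.op (xPow η l 1)
  inv := MulOpposite.op (xPow η l (-1))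
  val_inv := by rw [← MulOpposite.op_mul, xPow_mul hη]; simp [xPow_zero]
  inv_val := by rw [← MulOpposite.op_mul, xPow_mul hη]; simp [xPow_zero]

/-- The right action of `F_{2g}` on `V_g^η`. -/
def rightF (hη : IsPrimitiveRoot η p) : F g →* (Module.End ℂ (V g p))ᵐᵒᵖˣ :=
  FreeGroup.lift (xUnit hη)

/-- The scalar `η`. -/
def etaUnit (g : ℕ) (hη : IsPrimitiveRoot η p) : (Module.End ℂ (V g p))ᵐᵒᵖˣ :=
  Units.map (algebraMap ℂ (Module.End ℂ (V g p))ᵐᵒᵖ).toMonoidHom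
    (Units.mk0 η (hη.ne_zero (NeZero.ne p)))

theorem etaUnit_comm (hη : IsPrimitiveRoot η p) (u : (Module.End ℂ (V g p))ᵐᵒᵖˣ) :
    Commute (etaUnit g hη) u := by
  apply Units.ext
  exact Algebra.commutes η (u : (Module.End ℂ (V g p))ᵐᵒᵖ)

theorem etaUnit_pow (hη : IsPrimitiveRoot η p) : etaUnit g hη ^ p = 1 := by
  rw [etaUnit, ← map_pow]
  have : Units.mk0 η (hη.ne_zero (NeZero.ne p)) ^ p = 1 := Units.ext (by simp [hη.pow_eq_one])
  rw [this, map_one]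

theorem etaUnit_val (hη : IsPrimitiveRoot η p) (n : ℤ) :
    ((etaUnit g hη ^ n : (Module.End ℂ (V g p))ᵐᵒᵖˣ) : (Module.End ℂ (V g p))ᵐᵒᵖ) =
      MulOpposite.op (ePow η (n : ZMod p) • (1 : Module.End ℂ (V g p))) := by
  have hp := etaUnit_pow (g := g) hη
  obtain ⟨k, hk⟩ : ∃ k : ℕ, (k : ZMod p) = n := ⟨(n : ZMod p).val, by simp⟩
  have hd : (p : ℤ) ∣ n - k := by
    rw [← ZMod.intCast_zmod_eq_zero_iff_dvd]; push_cast; rw [hk]; ring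
  obtain ⟨q, hq⟩ := hd
  have : n = k + p * q := by omega
  rw [← hk, ePow_natCast hη, this, zpow_add, zpow_mul, zpow_natCast, zpow_natCast, hp, one_zpow,
    mul_one, Units.val_pow_eq_pow_val]
  have e : ((etaUnit g hη : (Module.End ℂ (V g p))ᵐᵒᵖˣ) : (Module.End ℂ (V g p))ᵐᵒᵖ) =
    algebraMap ℂ _ η := rfl
  rw [e, ← map_pow, Algebra.algebraMap_eq_smul_one]
  rfl

theorem xUnit_comm_aux (hη : IsPrimitiveRoot η p) (l m : Fin (2 * g))
    (hl : (l : ℕ) % 2 = 0) (hm : ¬ (m : ℕ) % 2 = 0) :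
    xUnit (p := p) hη l * xUnit hη m = etaUnit g hη ^ omegaMat l m * (xUnit hη m * xUnit hη l) := by
  apply Units.ext
  simp only [Units.val_mul, etaUnit_val, xUnit, ← MulOpposite.op_mul]
  congr 1
  apply V_ext
  intro j
  simp only [Module.End.mul_apply, LinearMap.smul_apply, Module.End.one_apply, map_smul]
  rw [xPow_even η hl, map_smul, xPow_odd η hm, xPow_even η hl, smul_smul, ← ePow_add hη,
    ← step_half l m hl hm]
  congr 2
  simp

theorem xUnit_comm (hη : IsPrimitiveRoot η p) (l m : Fin (2 * g)) :
    xUnit (p := p) hη l * xUnit hη m = etaUnit g hη ^ omegaMat l m * (xUnit hη m * xUnit hη l) := by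
  by_cases hl : (l : ℕ) % 2 = 0 <;> by_cases hm : (m : ℕ) % 2 = 0
  · rw [omegaMat_parity l m (by omega), zpow_zero, one_mul]
    apply Units.ext
    simp only [Units.val_mul, xUnit, ← MulOpposite.op_mul]
    congr 1
    apply V_ext
    intro j
    simp only [Module.End.mul_apply]
    rw [xPow_even η hl, map_smul, xPow_even η hm, map_smul, xPow_even η hl, smul_comm]
  · exact xUnit_comm_aux hη l m hl hm
  · rw [xUnit_comm_aux hη m l hm hl, ← mul_assoc, ← zpow_add, omegaMat_antisymm l m]
    simp
  · rw [omegaMat_parity l m (by omega), zpow_zero, one_mul]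
    apply Units.ext
    simp only [Units.val_mul, xUnit, ← MulOpposite.op_mul]
    congr 1
    apply V_ext
    intro j
    simp only [Module.End.mul_apply]
    rw [xPow_odd η hl, xPow_odd η hm, xPow_odd η hm, xPow_odd η hl]
    congr 1
    abel

end RightAction

theorem omega_mul_right {g : ℕ} (a b b' : F g) : omega a (b * b') = omega a b + omega a b' := by
  rw [omega_antisymm, omega_mul_left, omega_antisymm b, omega_antisymm b']; ring

theorem omega_inv_right {g : ℕ} (a b : F g) : omega a b⁻¹ = -omega a b := by
  rw [omega_antisymm, omega_inv_left, omega_antisymm b]; ring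

theorem omega_of_of {g : ℕ} (i j : Fin (2 * g)) :
    omega (FreeGroup.of i) (FreeGroup.of j) = omegaMat i j := by
  rw [omega_of_right, Finset.sum_eq_single i] <;> simp +contextual [expo, eq_comm]

theorem conj_extend {g : ℕ} {U : Type*} [Group U] {z : U} (hz : ∀ u, Commute z u) (R : F g →* U)
    (b : F g) (h : ∀ l, R b * R (FreeGroup.of l) * (R b)⁻¹ =
      z ^ omega b (FreeGroup.of l) * R (FreeGroup.of l)) (a : F g) :
    R b * R a * (R b)⁻¹ = z ^ omega b a * R a := by
  have hz' : ∀ (n : ℤ) u, Commute (z ^ n) u := fun n u => (hz u).zpow_left n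
  have h1 : omega b 1 = 0 := by
    have := omega_mul_right b 1 1
    rw [one_mul] at this; omega
  simp only [← MulAut.conj_apply] at h ⊢
  induction a using F_induction with
  | one => simp [h1]
  | of l => exact h l
  | inv a ha =>
    rw [map_inv, map_inv, ha, omega_inv_right, mul_inv_rev, zpow_neg, (hz' _ _).inv_left.eq]
  | mul a c ha hc =>
    rw [map_mul, map_mul, ha, hc, omega_mul_right, zpow_add, mul_assoc, mul_assoc,
      ← mul_assoc (R a), ← (hz' (omega b c) (R a)).eq, mul_assoc]

theorem comm_extend {g : ℕ} {U : Type*} [Group U] {z : U} (hz : ∀ u, Commute z u) (R : F g →* U)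
    (h : ∀ l m, R (FreeGroup.of l) * R (FreeGroup.of m) =
      z ^ omegaMat l m * (R (FreeGroup.of m) * R (FreeGroup.of l))) (a b : F g) :
    ⁅R a, R b⁆ = z ^ omega a b := by
  have hz' : ∀ (n : ℤ) u, Commute (z ^ n) u := fun n u => (hz u).zpow_left n
  have k1 : ∀ l a, R (FreeGroup.of l) * R a * (R (FreeGroup.of l))⁻¹ =
      z ^ omega (FreeGroup.of l) a * R a := by
    intro l
    refine conj_extend hz R _ fun m => ?_
    rw [h, omega_of_of]; group
  rw [commutatorElement_def, conj_extend hz R a (fun l => ?_) b]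
  · group
  · have e := k1 l a
    rw [mul_inv_eq_iff_eq_mul] at e ⊢
    have e2 : R (FreeGroup.of l) * R a = z ^ (-omega a (FreeGroup.of l)) *
      (R a * R (FreeGroup.of l)) := by rw [e, omega_antisymm a]; group
    rw [mul_assoc, e2, ← mul_assoc, ← zpow_add]; simp

theorem mul_pow_of_comm {U : Type*} [Group U] {z A B : U} (hz : ∀ u, Commute z u)
    (h : B * A = z * (A * B)) (n : ℕ) : (A * B) ^ n = z ^ (n.choose 2) * (A ^ n * B ^ n) := by
  have hB : ∀ n : ℕ, B ^ n * A = z ^ n * (A * B ^ n) := by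
    intro n
    induction n with
    | zero => simp
    | succ n ih =>
      rw [pow_succ', mul_assoc, ih, ← mul_assoc, ← ((hz B).pow_left n).eq, mul_assoc,
        ← mul_assoc B, h, pow_succ]
      simp only [mul_assoc]
  induction n with
  | zero => simp
  | succ n ih =>
    have hc : (n + 1).choose 2 = n.choose 2 + n := by
      rw [Nat.choose_succ_succ' n 1, Nat.choose_one_right, add_comm]
    rw [pow_succ, ih, hc, pow_add z, pow_succ A, pow_succ B]
    have : A ^ n * B ^ n * (A * B) = z ^ n * (A ^ n * A * (B ^ n * B)) := by
      rw [mul_assoc, ← mul_assoc (B ^ n), hB, mul_assoc (z ^ n), ← mul_assoc (A ^ n),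
        ← ((hz (A ^ n)).pow_left n).eq]
      simp only [mul_assoc]
    rw [mul_assoc, this]
    simp only [mul_assoc]

section RightAction

variable {g p : ℕ} [Fact p.Prime] {η : ℂ}

theorem rightF_commutator (hη : IsPrimitiveRoot η p) (a b : F g) :
    ⁅rightF (g := g) hη a, rightF hη b⁆ = etaUnit g hη ^ omega a b :=
  comm_extend (etaUnit_comm hη) (rightF hη)
    (fun l m => by simpa [rightF] using xUnit_comm hη l m) a b

theorem etaUnit_zpow (hη : IsPrimitiveRoot η p) (n : ℤ) :
    etaUnit g hη ^ n = etaUnit g hη ^ (n : ZMod p).val := by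
  apply Units.ext
  have := etaUnit_val (g := g) hη ((n : ZMod p).val : ℤ)
  rw [zpow_natCast] at this
  rw [this, etaUnit_val]
  simp

theorem etaUnit_val_add (hη : IsPrimitiveRoot η p) (a b : ZMod p) :
    etaUnit g hη ^ (a + b).val = etaUnit g hη ^ a.val * etaUnit g hη ^ b.val := by
  have h1 := etaUnit_zpow (g := g) hη ((a.val : ℤ) + b.val)
  rw [zpow_add, zpow_natCast, zpow_natCast] at h1
  rw [h1]
  simp

theorem rightF_contraction (hη : IsPrimitiveRoot η p) (w : F g) (hw : w ∈ commutator (F g)) :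
    rightF hη w = etaUnit g hη ^ (contraction g p ⟨w, hw⟩).toAdd.val := by
  have hw' := hw
  rw [commutator_eq_closure] at hw'
  induction hw' using Subgroup.closure_induction with
  | mem x hx =>
    obtain ⟨a, b, rfl⟩ := hx
    rw [contraction_commutator, map_commutatorElement, rightF_commutator, etaUnit_zpow]
    rfl
  | one =>
    have : (⟨1, hw⟩ : commutator (F g)) = 1 := rfl
    rw [this, map_one, map_one]; simp
  | mul x y hx hy ihx ihy =>
    rw [← commutator_eq_closure] at hx hy
    have : (⟨x * y, hw⟩ : commutator (F g)) = ⟨x, hx⟩ * ⟨y, hy⟩ := rfl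
    rw [this, map_mul, map_mul, ihx hx, ihy hy, toAdd_mul, etaUnit_val_add]
  | inv x hx ih =>
    rw [← commutator_eq_closure] at hx
    have : (⟨x⁻¹, hw⟩ : commutator (F g)) = ⟨x, hx⟩⁻¹ := rfl
    rw [this, map_inv, map_inv, ih hx, toAdd_inv, inv_eq_iff_mul_eq_one, ← etaUnit_val_add]
    simp

theorem rightF_pow (hp : p ≠ 2) (hη : IsPrimitiveRoot η p) (w : F g) :
    rightF hη w ^ p = 1 := by
  have hpp : p.Prime := Fact.out
  have hodd : Odd p := hpp.odd_of_ne_two hp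
  induction w using F_induction with
  | one => simp
  | of j =>
    apply Units.ext
    rw [rightF, FreeGroup.lift_apply_of, Units.val_pow_eq_pow_val]
    show MulOpposite.op (xPow η j 1) ^ p = 1
    rw [← MulOpposite.op_pow, xPow_pow hη]
    simp [xPow_zero]
  | inv a ha => rw [map_inv, inv_pow, ha, inv_one]
  | mul a b ha hb =>
    have h := rightF_commutator hη b a
    rw [commutatorElement_def, mul_inv_eq_iff_eq_mul, mul_inv_eq_iff_eq_mul, mul_assoc] at h
    have hz : ∀ u, Commute (etaUnit g hη ^ omega b a) u :=
      fun u => (etaUnit_comm hη u).zpow_left _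
    rw [map_mul, mul_pow_of_comm hz h, ha, hb, mul_one, mul_one]
    obtain ⟨k, hk⟩ : p ∣ p.choose 2 :=
      hpp.dvd_choose_self (by norm_num) (lt_of_le_of_ne hpp.two_le (Ne.symm hp))
    have : (etaUnit g hη ^ omega b a) ^ p = 1 := by
      rw [← zpow_natCast, ← zpow_mul, mul_comm, zpow_mul, zpow_natCast, etaUnit_pow, one_zpow]
    rw [hk, pow_mul, this, one_pow]

theorem N_le_ker (hp : p ≠ 2) (hη : IsPrimitiveRoot η p) : N g p ≤ (rightF (g := g) hη).ker := by
  refine Subgroup.normalClosure_le_normal ?_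
  rintro w ((hw | ⟨a, rfl⟩) | ⟨hw, h⟩)
  · have : ⁅commutator (F g), (⊤ : Subgroup (F g))⁆ ≤ (rightF (g := g) hη).ker := by
      rw [Subgroup.commutator_le]
      intro a ha b _
      rw [MonoidHom.mem_ker, map_commutatorElement, rightF_contraction hη a ha,
        commutatorElement_eq_one_iff_commute]
      exact (etaUnit_comm hη _).pow_left _
    exact this hw
  · show rightF hη (a ^ p) = 1
    rw [map_pow, rightF_pow hp]
  · show rightF hη w = 1
    rw [rightF_contraction hη w hw, h]
    simp

/-- The right `G`-module structure of `V_g^η`, as a homomorphism into `(End V)ᵐᵒᵖ`; it is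
determined by its values on the generators, see `rightAct_of`. -/
def rightAct (hp : p ≠ 2) (hη : IsPrimitiveRoot η p) : G g p →* (Module.End ℂ (V g p))ᵐᵒᵖ :=
  (Units.coeHom _).comp (QuotientGroup.lift (N g p) (rightF hη) (N_le_ker hp hη))

theorem rightAct_of (hp : p ≠ 2) (hη : IsPrimitiveRoot η p) (l : Fin (2 * g)) :
    rightAct hp hη (rho g p (FreeGroup.of l)) = MulOpposite.op (xPow η l 1) := by
  simp [rightAct, rho, rightF, xUnit]

end RightAction

/-- The quadratic Gauss sum `G(a)`. -/
def gauss (p : ℕ) [Fact p.Prime] (η : ℂ) (a : ZMod p) : ℂ := ∑ t : ZMod p, ePow η (a * t ^ 2)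

/-- The operators `Ψ_l` on `V_g^η`:
`Ψ_{2k-1}(e_j) = η^{binom(j_k+1, 2)} e_j` and
`Ψ_{2k}(e_j) = (G(1/2)/p) ∑_s η^{-(1/2)(s+1/2)^2} e_{j + s(e_k - e_{k+1})}`. -/
def psiV {g p : ℕ} [Fact p.Prime] (η : ℂ) (l : Fin (2 * g)) : V g p →ₗ[ℂ] V g p :=
  Finsupp.linearCombination ℂ fun j =>
    if (l : ℕ) % 2 = 0 then
      ePow η ((j (half l) + 1) * j (half l) / 2) • Finsupp.single j 1
    else
      (gauss p η (1 / 2) / p) • ∑ s : ZMod p,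
        ePow η (-(1 / 2) * (s + 1 / 2) ^ 2) • Finsupp.single (j + s • step p l) 1

/-! ### The module `L_g^η` -/

/-- The vector space with basis `u_1, …, u_{2g}`. -/
abbrev U (g : ℕ) : Type := Fin (2 * g) →₀ ℂ

/-- The vector `u_n` for `1 ≤ n ≤ 2g` with its usual index; `u_n = 0` for all other `n`. -/
def uVec (g : ℕ) (n : ℤ) : U g :=
  ∑ m : Fin (2 * g), if (m : ℤ) + 1 = n then Finsupp.single m 1 else 0

/-- `L_g^η = V_g^η ⊗ ⟨u_1, …, u_{2g}⟩`. -/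
abbrev Lmod (g p : ℕ) : Type := V g p ⊗[ℂ] U g

/-- `x_1 x_3 ⋯ x_{2k-1}` (`k` factors). -/
def oddProd (g p k : ℕ) : G g p := ((List.range k).map fun i => x g p (2 * i + 1)).prod

/-- `x_{2k} x_{2k+2} ⋯ x_{2g}`. -/
def evenProd (g p k : ℕ) : G g p :=
  ((List.range (g + 1 - k)).map fun i => x g p (2 * (k + i))).prod

/-- The operators `Ψ̂_n` on `L_g^η`, where `n = l + 1` is the usual index of the generator:
`Ψ̂_{2k-1}(v ⊗ u_m) = Ψ_{2k-1}(v) ⊗ u_m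
  - δ_{m,2k} Ψ_{2k-1}(v){x_1 x_3 ⋯ x_{2k-3} · x_{2k} x_{2k+2} ⋯ x_{2g}} ⊗ (u_{2k-1} - u_{2k-3})`,
`Ψ̂_{2k}(v ⊗ u_m) = Ψ_{2k}(v) ⊗ u_m
  + δ_{m,2k-1} Ψ_{2k}(v){x_1 x_3 ⋯ x_{2k-1} · x_{2k} x_{2k+2} ⋯ x_{2g}}⁻¹ ⊗ (u_{2k} - u_{2k+2})`. -/
def psiHat {g p : ℕ} [Fact p.Prime] {η : ℂ} (hp : p ≠ 2) (hη : IsPrimitiveRoot η p)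
    (l : Fin (2 * g)) : Lmod g p →ₗ[ℂ] Lmod g p :=
  let n : ℤ := (l : ℤ) + 1
  let k : ℕ := (l : ℕ) / 2 + 1
  TensorProduct.map (psiV η l) LinearMap.id +
    if (l : ℕ) % 2 = 0 then
      TensorProduct.map
        ((rightAct hp hη (oddProd g p (k - 1) * evenProd g p k)).unop ∘ₗ psiV η l)
        (Finsupp.linearCombination ℂ fun m : Fin (2 * g) =>
          if (m : ℤ) + 1 = n + 1 then -(uVec g n - uVec g (n - 2)) else 0)
    else
      TensorProduct.map
        ((rightAct hp hη (oddProd g p k * evenProd g p k)⁻¹).unop ∘ₗ psiV η l)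
        (Finsupp.linearCombination ℂ fun m : Fin (2 * g) =>
          if (m : ℤ) + 1 = n - 1 then uVec g n - uVec g (n + 2) else 0)

/-! ### The isotypic part `φ(c;η) L_N` and matrix units -/

/-- `φ(c;η) = (1/p) ∑_n η^{-n} c^n`. -/
def phiC (g p : ℕ) [Fact p.Prime] (η : ℂ) : MonoidAlgebra ℂ (G g p) :=
  (1 / p : ℂ) • ∑ n : ZMod p, ePow η (-n) • MonoidAlgebra.of ℂ (G g p) (c g p ^ n.val)

/-- The subspace `φ(c;η) L_N` of the Magnus module. -/
def isotypic (g p : ℕ) [Fact p.Prime] (η : ℂ) : Submodule ℂ (LN g p) :=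
  LinearMap.range (Algebra.lsmul ℂ ℂ (LN g p) (phiC g p η))

/-- `φ(i; x_odd) = p^{-g} ∑_a η^{-i·a} x_1^{a_1} x_3^{a_2} ⋯ x_{2g-1}^{a_g}`. -/
def phiOdd {g p : ℕ} [Fact p.Prime] (η : ℂ) (i : Fin g → ZMod p) : MonoidAlgebra ℂ (G g p) :=
  (1 / p ^ g : ℂ) • ∑ a : Fin g → ZMod p, ePow η (-(∑ k, i k * a k)) •
    MonoidAlgebra.of ℂ (G g p) (List.ofFn fun k : Fin g => x g p (2 * (k : ℕ) + 1) ^ (a k).val).prod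

/-- `φ(i; x_even) = p^{-g} ∑_a η^{-i·a} x_2^{a_1} x_4^{a_2} ⋯ x_{2g}^{a_g}`. -/
def phiEven {g p : ℕ} [Fact p.Prime] (η : ℂ) (i : Fin g → ZMod p) : MonoidAlgebra ℂ (G g p) :=
  (1 / p ^ g : ℂ) • ∑ a : Fin g → ZMod p, ePow η (-(∑ k, i k * a k)) •
    MonoidAlgebra.of ℂ (G g p) (List.ofFn fun k : Fin g => x g p (2 * (k : ℕ) + 2) ^ (a k).val).prod

/-- `E_{i,j} = φ(i; x_odd) φ(0; x_even) φ(j; x_odd)`, projected to the `η`-component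
`φ(c;η) ℂ[G]` of the group algebra. -/
def Emat {g p : ℕ} [Fact p.Prime] (η : ℂ) (i j : Fin g → ZMod p) : MonoidAlgebra ℂ (G g p) :=
  phiC g p η * (phiOdd η i * phiEven η 0 * phiOdd η j)

/-! ### The group `H_{2g+1}`, its quotient `G⁺` and the module `L_N⁺` -/

/-- The free group on `y_1, …, y_{2g+1}`. -/
abbrev T (g : ℕ) : Type := FreeGroup (Fin (2 * g + 1))

/-- The squares of the generators. -/
def squares (g : ℕ) : Set (T g) := {w | ∃ i, w = FreeGroup.of i ^ 2}

/-- `H_{2g+1} = ⟨y_1, …, y_{2g+1} | y_i² = 1⟩`. -/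
abbrev H (g : ℕ) : Type := PresentedGroup (squares g)

theorem H_sq {g : ℕ} (i : Fin (2 * g + 1)) :
    (PresentedGroup.of i : H g) * PresentedGroup.of i = 1 := by
  rw [← pow_two]
  exact PresentedGroup.one_of_mem (rels := squares g) ⟨i, rfl⟩

/-- The embedding `F_{2g} → H_{2g+1}`, `x_i ↦ y_i y_{i+1}`. -/
def iota (g : ℕ) : F g →* H g :=
  FreeGroup.lift fun i => PresentedGroup.of i.castSucc * PresentedGroup.of i.succ

/-- The action of `σ_l` on `H_{2g+1}`: `y_l ↦ y_{l+1}`, `y_{l+1} ↦ y_{l+1} y_l y_{l+1}`, the other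
generators being fixed. -/
def sigmaH {g : ℕ} (l : Fin (2 * g)) : H g →* H g :=
  PresentedGroup.toGroup (f := fun j =>
    if j = l.castSucc then PresentedGroup.of l.succ
    else if j = l.succ then
      PresentedGroup.of l.succ * PresentedGroup.of l.castSucc * PresentedGroup.of l.succ
    else PresentedGroup.of j) (by
      rintro r ⟨i, rfl⟩
      rw [map_pow, FreeGroup.lift_apply_of, pow_two]
      split_ifs
      · exact H_sq _
      · simp only [mul_assoc]
        rw [← mul_assoc (PresentedGroup.of l.succ) (PresentedGroup.of l.succ), H_sq, one_mul,
          ← mul_assoc (PresentedGroup.of l.castSucc) (PresentedGroup.of l.castSucc), H_sq,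
          one_mul, H_sq]
      · exact H_sq _)

/-- The action of the braid group on `F_{2g}` is the restriction of its action on `H_{2g+1}`. -/
theorem iota_sigmaF {g : ℕ} (l : Fin (2 * g)) (w : F g) :
    iota g (sigmaF l w) = sigmaH l (iota g w) := by
  have : (iota g).comp (sigmaF l) = (sigmaH l).comp (iota g) := by
    ext j
    rw [MonoidHom.comp_apply, MonoidHom.comp_apply]
    have io : ∀ i : Fin (2 * g), iota g (FreeGroup.of i) =
        PresentedGroup.of i.castSucc * PresentedGroup.of i.succ := fun i => by simp [iota]
    have sq : ∀ (i : Fin (2 * g + 1)) (u : H g),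
        PresentedGroup.of i * (PresentedGroup.of i * u) = u := fun i u => by
      rw [← mul_assoc, H_sq, one_mul]
    have s1 : sigmaH l (PresentedGroup.of l.castSucc) = PresentedGroup.of l.succ := by
      simp [sigmaH]
    have s2 : sigmaH l (PresentedGroup.of l.succ) =
        PresentedGroup.of l.succ * PresentedGroup.of l.castSucc * PresentedGroup.of l.succ := by
      have : l.succ ≠ l.castSucc := fun h => by simp [Fin.ext_iff] at h
      simp [sigmaH, this]
    have s3 : ∀ i : Fin (2 * g + 1), i ≠ l.castSucc → i ≠ l.succ →
        sigmaH l (PresentedGroup.of i) = PresentedGroup.of i := fun i h h' => by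
      simp [sigmaH, h, h']
    rw [io, map_mul]
    by_cases h1 : (j : ℕ) + 1 = l
    · have e : j.succ = l.castSucc := Fin.ext (by simpa using h1)
      rw [sigmaF_of_prev h1, map_mul, io, io, e, s1,
        s3 _ (fun h => by simp [Fin.ext_iff] at h; omega)
          (fun h => by simp [Fin.ext_iff] at h; omega), mul_assoc, sq]
    by_cases h2 : (l : ℕ) + 1 = j
    · have e : j.castSucc = l.succ := Fin.ext (by simpa using h2.symm)
      rw [sigmaF_of_next h2, map_mul, map_inv, io, io, e, s2,
        s3 j.succ (fun h => by simp [Fin.ext_iff] at h; omega)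
          (fun h => by simp [Fin.ext_iff] at h; omega)]
      rw [mul_inv_rev, inv_eq_of_mul_eq_one_left (H_sq l.succ),
        inv_eq_of_mul_eq_one_left (H_sq l.castSucc)]
      simp only [mul_assoc]
    by_cases h3 : j = l
    · subst h3
      rw [sigmaF_of_self, io, s1, s2, mul_assoc, sq]
    · have h3' : (j : ℕ) ≠ l := fun h => h3 (Fin.ext h)
      rw [sigmaF_of_far h1 h2, io, s3 j.castSucc (fun h => by simp [Fin.ext_iff] at h; omega)
          (fun h => by simp [Fin.ext_iff] at h; omega),
        s3 j.succ (fun h => by simp [Fin.ext_iff] at h; omega)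
          (fun h => by simp [Fin.ext_iff] at h; omega)]
  exact DFunLike.congr_fun this w

/-- The image of `N` in `H_{2g+1}`; it is a normal subgroup, so taking the normal closure does not
change it. -/
def Nplus (g p : ℕ) : Subgroup (H g) := Subgroup.normalClosure ((N g p).map (iota g) : Set (H g))

instance (g p : ℕ) : (Nplus g p).Normal := Subgroup.normalClosure_normal

/-- `G⁺ = H_{2g+1} / N`. -/
abbrev Gplus (g p : ℕ) : Type := H g ⧸ Nplus g p

/-- The quotient map from the free group on the `y_i` to `G⁺`. -/
def rhoPlus (g p : ℕ) : T g →* Gplus g p :=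
  (QuotientGroup.mk' (Nplus g p)).comp (PresentedGroup.mk (squares g))

/-- The homomorphism `G → G⁺` induced by `iota`. -/
def iotaG (g p : ℕ) : G g p →* Gplus g p :=
  QuotientGroup.map (N g p) (Nplus g p) (iota g)
    (Subgroup.map_le_iff_le_comap.1 Subgroup.subset_normalClosure)

/-- The `ℂ[G⁺]`-submodule generated by the Fox derivatives of the elements of the normal closure of
the squares `y_i²`. -/
def foxSquares (g p : ℕ) :
    Submodule (MonoidAlgebra ℂ (Gplus g p)) (Fin (2 * g + 1) → MonoidAlgebra ℂ (Gplus g p)) :=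
  Submodule.span _ (foxDeriv (rhoPlus g p) '' (Subgroup.normalClosure (squares g) : Set (T g)))

/-- `L_N⁺`: the Magnus module of the free group on the `y_i` with respect to `G⁺`, modulo the Fox
derivatives of the normal closure of the squares `y_i²`. -/
abbrev LNplus (g p : ℕ) : Type :=
  (Fin (2 * g + 1) → MonoidAlgebra ℂ (Gplus g p)) ⧸ foxSquares g p

/-- The Fox derivation `d⁺` with values in `L_N⁺`, on words in the `y_i`. -/
def dPlus (g p : ℕ) (w : T g) : LNplus g p := (foxSquares g p).mkQ (foxDeriv (rhoPlus g p) w)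

/-- The action of `w ∈ G⁺`, given as a word in the `y_i`, on `L_N⁺`. -/
def actPlus (g p : ℕ) (w : T g) (v : LNplus g p) : LNplus g p :=
  MonoidAlgebra.of ℂ (Gplus g p) (rhoPlus g p w) • v

/-- The `ℂ[G]`-semilinear embedding `L_N → L_N⁺` with `d_N(x_i) ↦ d⁺(y_i y_{i+1})`. -/
def iotaHat (g p : ℕ) (v : LN g p) : LNplus g p :=
  ∑ i : Fin (2 * g), MonoidAlgebra.mapDomainRingHom ℂ (iotaG g p) (v i) •
    dPlus g p (FreeGroup.of i.castSucc * FreeGroup.of i.succ)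

/-- The generator `y_n` with its usual index `1 ≤ n ≤ 2g+1`. -/
def yT (g n : ℕ) : T g :=
  if h : 1 ≤ n ∧ n ≤ 2 * g + 1 then FreeGroup.of ⟨n - 1, by omega⟩ else 1

/-- The ascending product `y_a y_{a+1} ⋯ y_b`. -/
def yUp (g a b : ℕ) : T g := ((List.range (b + 1 - a)).map fun i => yT g (a + i)).prod

/-- The descending product `y_b y_{b-1} ⋯ y_a`. -/
def yDown (g a b : ℕ) : T g := ((List.range (b + 1 - a)).map fun i => yT g (b - i)).prod

/-- The word `Δ = y_1 y_2 ⋯ y_{2g+1}`. -/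
def Delta (g : ℕ) : T g := yUp g 1 (2 * g + 1)

/-- The element `u_n ∈ L_N⁺` (`1 ≤ n ≤ 2g`, usual index):
`u_{2i} = y_1 ⋯ y_{2i-1} d⁺(y_{2i} ⋯ y_{2g+1})` and
`u_{2i-1} = - y_{2g+1} ⋯ y_{2i+1} d⁺(y_{2i} ⋯ y_1)`. -/
def uPlus (g p n : ℕ) : LNplus g p :=
  if n % 2 = 0 then actPlus g p (yUp g 1 (n - 1)) (dPlus g p (yUp g n (2 * g + 1)))
  else -actPlus g p (yDown g (n + 2) (2 * g + 1)) (dPlus g p (yDown g 1 (n + 1)))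


end MagnusBraid

end

/-!
The whole theorem is carried by one intertwining property. Write `O_k = x_1 x_3 ⋯ x_{2k-1}` and
`E_k = x_{2k} x_{2k+2} ⋯ x_{2g}`, so that `O_k = y_1 ⋯ y_{2k}` and `E_k = y_{2k} ⋯ y_{2g+1}` in
`H_{2g+1}`.

*The module `V`.* All operators `Ψ_l` are the same quadratic Gauss sum in the operator `x_l`
(`psiV_eq_sum`). Completing the square gives `Ψ_l(v a) = Ψ_l(v) σ_l(a)` for `a ∈ G`
(`psiV_mul_act_of`), so `Ψ_i` conjugates the Gauss sum in `u` to the Gauss sum in `σ_i(u)`; since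
the Gauss sum in `u` equals the one in `(uc)⁻¹` (`gaussOp_inv`), the braid relations for the `Ψ_l`
follow on the nose, with no scalar left undetermined.

*Matrix units.* The `E_{i,j}` act on `V` as `p^{-g}` times matrix units (`act_Emat`), so
`φ(c;η) ℂ[G] → End V` is onto. As `G / ⟨c⟩` is abelian of exponent `p` with `2g` generators, the
source has dimension at most `p^{2g}`, and the map is bijective (`act_injOn`). Hence
`e'_i ⊗ e_j ↦ E_{i,j}` identifies `V* ⊗ V` with `φ(c;η) ℂ[G]`, compatibly with the braid action and
with the right action of `G` on `V`.

*The Magnus module.* `F_{2g}` embeds in `H_{2g+1}` (`iota_injective`), and conjugation by `Δ`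
restricts to an automorphism of `F_{2g}` commuting with the braid action. In `L_N` the vectors
`Δ⁻¹ u_m` are `Δ⁻² d_N(O_k)` for `m = 2k-1` and `E_k⁻¹ d_N(E_k)` for `m = 2k`. The generators
`σ_l` change at most one letter of these words at an end, and the resulting terms are exactly
the correction terms of the `Ψ̂_l` (`braidL_baseVec`); this uses that `O_{k-1} E_k` and `O_k E_k`
are `Δ` with one letter deleted, so that conjugation by `Δ` maps such an element `h` to `h⁻¹ Δ²`
(`theta_of_deltaH_eq`).

Therefore `e'_i ⊗ e_j ⊗ u_l ↦ (Δ⁻¹ E_{i,j} Δ) (Δ⁻¹ u_l)` intertwines `Ψ_l* ⊗ Ψ̂_l` with `σ_l`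
(`isoMap_psiHat`). It is onto `φ(c;η) L_N` because the `Δ⁻¹ u_m` generate `L_N`, and injective by a
dimension count. The invertibility of the `Ψ̂_l` and their braid relations are consequences: they
hold in `L_N` and for the `Ψ_l`, and a tensor factor of an operator is determined once the other
factor is invertible.
-/

noncomputable section

namespace MagnusBraid

/-! ### Words in the free group and conjugation by `Δ` -/

theorem prod_range_sub {M : Type*} [Monoid M] (f : ℕ → M) {n m : ℕ} (h : n < m) :
    ((List.range (m - n)).map fun i => f (n + i)).prod =
      f n * ((List.range (m - (n + 1))).map fun i => f (n + 1 + i)).prod := by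
  obtain ⟨d, rfl⟩ : ∃ d, m = n + 1 + d := ⟨m - (n + 1), by omega⟩
  rw [show n + 1 + d - n = d + 1 by omega, Nat.add_sub_cancel_left, List.range_succ_eq_map,
    List.map_cons, List.prod_cons, List.map_map]
  congr 3
  funext i
  simp only [Function.comp, Nat.succ_eq_add_one]
  congr 1
  omega

theorem prod_range_sub_succ {M : Type*} [Monoid M] (f : ℕ → M) {n m : ℕ} (h : n ≤ m) :
    ((List.range (m + 1 - n)).map fun i => f (n + i)).prod =
      ((List.range (m - n)).map fun i => f (n + i)).prod * f m := by
  rw [Nat.succ_sub h, List.prod_range_succ]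
  congr 2
  omega

theorem xF_succ (g : ℕ) (l : Fin (2 * g)) : xF g ((l : ℕ) + 1) = FreeGroup.of l := by
  rw [xF, dif_pos ⟨by omega, by omega⟩]
  rfl

theorem xF_eq_of {g n : ℕ} (l : Fin (2 * g)) (h : n = (l : ℕ) + 1) : xF g n = FreeGroup.of l := by
  rw [h, xF_succ]

/-- The word `x_1 x_3 ⋯ x_{2k-1}`. -/
def oddWord (g k : ℕ) : F g := ((List.range k).map fun i => xF g (2 * i + 1)).prod

/-- The word `x_{2k} x_{2k+2} ⋯ x_{2g}`. -/
def evenWord (g k : ℕ) : F g := ((List.range (g + 1 - k)).map fun i => xF g (2 * (k + i))).prod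

theorem oddWord_zero (g : ℕ) : oddWord g 0 = 1 := rfl

theorem oddWord_succ (g k : ℕ) : oddWord g (k + 1) = oddWord g k * xF g (2 * k + 1) :=
  List.prod_range_succ _ _

theorem evenWord_last (g : ℕ) : evenWord g (g + 1) = 1 := by simp [evenWord]

theorem evenWord_eq {g k : ℕ} (h : k ≤ g) :
    evenWord g k = xF g (2 * k) * evenWord g (k + 1) :=
  prod_range_sub (fun i => xF g (2 * i)) (by omega)

theorem rho_oddWord (g p k : ℕ) : rho g p (oddWord g k) = oddProd g p k := by
  simp only [oddWord, oddProd, map_list_prod, List.map_map]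
  rfl

theorem rho_evenWord (g p k : ℕ) : rho g p (evenWord g k) = evenProd g p k := by
  simp only [evenWord, evenProd, map_list_prod, List.map_map]
  rfl

/-- The word `x_{n+1} x_{n+2} ⋯ x_{2g}`; it represents `y_{n+1} y_{2g+1}`. -/
def tailWord (g n : ℕ) : F g := ((List.range (2 * g - n)).map fun i => xF g (n + i + 1)).prod

theorem tailWord_last (g : ℕ) : tailWord g (2 * g) = 1 := by simp [tailWord]

theorem tailWord_eq {g : ℕ} (l : Fin (2 * g)) :
    tailWord g l = FreeGroup.of l * tailWord g (l + 1) := by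
  rw [← xF_succ]
  exact prod_range_sub (fun i => xF g (i + 1)) l.2

/-- Conjugation by the last generator `y_{2g+1}`, as an endomorphism of `F_{2g}`. -/
def tau (g : ℕ) : F g →* F g :=
  FreeGroup.lift fun l => (tailWord g l)⁻¹ * tailWord g (l + 1)

theorem tau_of {g : ℕ} (l : Fin (2 * g)) :
    tau g (FreeGroup.of l) = (tailWord g l)⁻¹ * tailWord g (l + 1) := by
  simp [tau]

theorem tau_tailWord {g n : ℕ} (h : n ≤ 2 * g) : tau g (tailWord g n) = (tailWord g n)⁻¹ := by
  induction h using Nat.decreasingInduction with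
  | self => simp [tailWord_last]
  | of_succ n hn ih =>
    have h1 := tailWord_eq (⟨n, hn⟩ : Fin (2 * g))
    have h2 := tau_of (⟨n, hn⟩ : Fin (2 * g))
    simp only at h1 h2
    conv_lhs => rw [h1]
    rw [map_mul, h2, ih]
    group

theorem tau_tau {g : ℕ} (w : F g) : tau g (tau g w) = w := by
  have : (tau g).comp (tau g) = MonoidHom.id _ := by
    ext l
    rw [MonoidHom.comp_apply, tau_of, map_mul, map_inv, tau_tailWord (by omega),
      tau_tailWord (by omega), inv_inv, MonoidHom.id_apply, tailWord_eq]
    group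
  exact DFunLike.congr_fun this w

theorem expo_tau {g : ℕ} (k : Fin (2 * g)) (w : F g) : expo k (tau g w) = (expo k w)⁻¹ := by
  have : (expo k).comp (tau g) = (expo k)⁻¹ := by
    ext l
    rw [MonoidHom.comp_apply, tau_of, tailWord_eq l, MonoidHom.inv_apply]
    simp
  exact DFunLike.congr_fun this w

/-- `y_{n+1}` acts on `F_{2g} = H_{2g+1} / ⟨y_{2g+1}⟩` by `w ↦ (y_{n+1} y_{2g+1}) τ(w)`. -/
def cosetPerm (g n : ℕ) (h : n ≤ 2 * g) : Equiv.Perm (F g) :=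
  Function.Involutive.toPerm (fun w => tailWord g n * tau g w) fun w => by
    simp [tau_tau, tau_tailWord h]

/-- The action of `H_{2g+1}` on its cosets modulo `y_{2g+1}`. -/
def cosetAction (g : ℕ) : H g →* Equiv.Perm (F g) :=
  PresentedGroup.toGroup (f := fun i : Fin (2 * g + 1) => cosetPerm g i (Nat.le_of_lt_succ i.2)) (by
    rintro r ⟨i, rfl⟩
    rw [map_pow, FreeGroup.lift_apply_of, pow_two]
    exact Equiv.ext fun w => Function.Involutive.toPerm_involutive _ w)

theorem iota_of {g : ℕ} (l : Fin (2 * g)) :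
    iota g (FreeGroup.of l) = PresentedGroup.of l.castSucc * PresentedGroup.of l.succ := by
  simp [iota]

theorem cosetAction_iota {g : ℕ} (w v : F g) : cosetAction g (iota g w) v = w * v := by
  induction w using F_induction generalizing v with
  | one => simp
  | of l =>
    rw [iota_of, map_mul, Equiv.Perm.mul_apply]
    simp only [cosetAction, PresentedGroup.toGroup.of, cosetPerm,
      Function.Involutive.coe_toPerm, map_mul, tau_tau, Fin.val_castSucc, Fin.val_succ]
    rw [tau_tailWord (by omega), tailWord_eq l]
    group
  | inv a h => rw [map_inv, map_inv, Equiv.Perm.inv_eq_iff_eq, h]; simp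
  | mul a b ha hb => rw [map_mul, map_mul, Equiv.Perm.mul_apply, hb, ha, mul_assoc]

/-- `F_{2g}` embeds in `H_{2g+1}`, because it acts simply transitively on the cosets modulo
`y_{2g+1}`. -/
theorem iota_injective (g : ℕ) : Function.Injective (iota g) := by
  intro a b h
  have := cosetAction_iota a 1
  rw [h, cosetAction_iota] at this
  simpa using this.symm

/-- The generator `y_n` of `H_{2g+1}`. -/
def yH (g n : ℕ) : H g := PresentedGroup.mk (squares g) (yT g n)

theorem yH_eq_of {g n : ℕ} (i : Fin (2 * g + 1)) (h : n = (i : ℕ) + 1) :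
    yH g n = PresentedGroup.of i := by
  rw [yH, yT, dif_pos ⟨by omega, by omega⟩]
  simp only [h, Nat.add_sub_cancel]
  rfl

theorem yH_mul_self (g n : ℕ) : yH g n * yH g n = 1 := by
  by_cases h : 1 ≤ n ∧ n ≤ 2 * g + 1
  · rw [yH_eq_of ⟨n - 1, by omega⟩ (by simp; omega), H_sq]
  · rw [yH, yT, dif_neg h]; simp

theorem yH_inv (g n : ℕ) : (yH g n)⁻¹ = yH g n := inv_eq_of_mul_eq_one_left (yH_mul_self g n)

theorem iota_xF {g n : ℕ} (h : 1 ≤ n) (h' : n ≤ 2 * g) :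
    iota g (xF g n) = yH g n * yH g (n + 1) := by
  rw [xF_eq_of ⟨n - 1, by omega⟩ (by simp; omega), iota_of,
    yH_eq_of (Fin.castSucc ⟨n - 1, by omega⟩) (by simp; omega),
    yH_eq_of (Fin.succ ⟨n - 1, by omega⟩) (by simp; omega)]

theorem iota_tailWord {g n : ℕ} (h : n ≤ 2 * g) :
    iota g (tailWord g n) = yH g (n + 1) * yH g (2 * g + 1) := by
  induction h using Nat.decreasingInduction with
  | self => simp [tailWord_last, yH_mul_self]
  | of_succ n hn ih =>
    have h1 := tailWord_eq (⟨n, hn⟩ : Fin (2 * g))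
    simp only at h1
    rw [h1, map_mul, ih, ← xF_succ, iota_xF (by simp) (by simp; omega)]
    simp only [mul_assoc]
    rw [← mul_assoc (yH g (n + 1 + 1)), yH_mul_self, one_mul]

theorem iota_tau {g : ℕ} (w : F g) :
    iota g (tau g w) = yH g (2 * g + 1) * iota g w * yH g (2 * g + 1) := by
  have : (iota g).comp (tau g) = (MulAut.conj (yH g (2 * g + 1))).toMonoidHom.comp (iota g) := by
    ext l
    simp only [MonoidHom.comp_apply, MulEquiv.coe_toMonoidHom, MulAut.conj_apply, yH_inv]
    rw [tau_of, map_mul, map_inv, iota_tailWord (by omega), iota_tailWord (by omega), ← xF_succ,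
      iota_xF (by simp) (by omega), mul_inv_rev, yH_inv, yH_inv]
    simp only [mul_assoc]
  have := DFunLike.congr_fun this w
  simpa [yH_inv] using this

/-- The element `Δ` of `H_{2g+1}`. -/
def deltaH (g : ℕ) : H g := iota g (oddWord g g) * yH g (2 * g + 1)

/-- The word `Δ²` in the `x_i`. -/
def deltaSq (g : ℕ) : F g := oddWord g g * tau g (oddWord g g)

theorem iota_deltaSq (g : ℕ) : iota g (deltaSq g) = deltaH g * deltaH g := by
  rw [deltaSq, map_mul, iota_tau, deltaH]
  simp only [mul_assoc]

/-- Conjugation `w ↦ Δ⁻¹ w Δ` as an automorphism of `F_{2g}`. -/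
def theta (g : ℕ) : MulAut (F g) :=
  (MonoidHom.toMulEquiv (tau g) (tau g) (MonoidHom.ext tau_tau) (MonoidHom.ext tau_tau)) *
    MulAut.conj (oddWord g g)⁻¹

theorem theta_apply {g : ℕ} (w : F g) :
    theta g w = tau g ((oddWord g g)⁻¹ * w * oddWord g g) := by
  simp [theta]

theorem iota_theta {g : ℕ} (w : F g) :
    iota g (theta g w) = (deltaH g)⁻¹ * iota g w * deltaH g := by
  rw [theta_apply, iota_tau, deltaH, mul_inv_rev, yH_inv]
  simp only [map_mul, map_inv, mul_assoc]

theorem omega_theta {g : ℕ} (a b : F g) : omega (theta g a) (theta g b) = omega a b := by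
  have h : ∀ (w : F g) i, (expo i (theta g w)).toAdd = -(expo i w).toAdd := by
    intro w i
    rw [theta_apply, expo_tau]
    simp
  simp [omega, h]

/-! ### The effect of the Artin generators on the words -/

theorem sigmaF_oddWord_of_even {g : ℕ} {l : Fin (2 * g)} (hl : (l : ℕ) % 2 = 0) {k : ℕ}
    (hk : k ≤ g) : sigmaF l (oddWord g k) = oddWord g k := by
  induction k with
  | zero => simp [oddWord_zero]
  | succ k ih =>
    rw [oddWord_succ, map_mul, ih (by omega), xF_succ g ⟨2 * k, by omega⟩,
      sigmaF_of_far (by simp; omega) (by simp; omega)]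

theorem sigmaF_oddWord_of_odd {g : ℕ} {l : Fin (2 * g)} (hl : (l : ℕ) % 2 = 1) {k : ℕ}
    (hk : k ≤ g) : sigmaF l (oddWord g k) =
      oddWord g k * if k = (l : ℕ) / 2 + 1 then FreeGroup.of l else 1 := by
  induction k with
  | zero => simp [oddWord_zero]
  | succ k ih =>
    rw [oddWord_succ, map_mul, ih (by omega), xF_succ g ⟨2 * k, by omega⟩]
    by_cases h1 : k = (l : ℕ) / 2 + 1
    · rw [if_pos h1, sigmaF_of_next (by simp; omega), if_neg (by omega)]
      group
    by_cases h2 : k + 1 = (l : ℕ) / 2 + 1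
    · rw [if_neg h1, sigmaF_of_prev (by simp; omega), if_pos h2]
      group
    · rw [if_neg h1, sigmaF_of_far (by simp; omega) (by simp; omega), if_neg h2]
      group

theorem sigmaF_evenWord_of_odd {g : ℕ} {l : Fin (2 * g)} (hl : (l : ℕ) % 2 = 1) {k : ℕ}
    (h0 : 1 ≤ k) (hk : k ≤ g + 1) : sigmaF l (evenWord g k) = evenWord g k := by
  induction hk using Nat.decreasingInduction with
  | self => simp [evenWord_last]
  | of_succ k hk ih =>
    rw [evenWord_eq (by omega), map_mul, ih (by omega),
      xF_eq_of ⟨2 * k - 1, by omega⟩ (by simp; omega),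
      sigmaF_of_far (by simp; omega) (by simp; omega)]

theorem sigmaF_evenWord_of_even {g : ℕ} {l : Fin (2 * g)} (hl : (l : ℕ) % 2 = 0) {k : ℕ}
    (h0 : 1 ≤ k) (hk : k ≤ g + 1) : sigmaF l (evenWord g k) =
      (if k = (l : ℕ) / 2 + 1 then (FreeGroup.of l)⁻¹ else 1) * evenWord g k := by
  induction hk using Nat.decreasingInduction with
  | self => rw [evenWord_last, if_neg (by omega)]; simp
  | of_succ k hk ih =>
    rw [evenWord_eq (by omega), map_mul, ih (by omega),
      xF_eq_of ⟨2 * k - 1, by omega⟩ (by simp; omega)]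
    by_cases h1 : k = (l : ℕ) / 2 + 1
    · rw [if_pos h1, sigmaF_of_next (by simp; omega), if_neg (by omega)]
      group
    by_cases h2 : k + 1 = (l : ℕ) / 2 + 1
    · rw [if_neg h1, sigmaF_of_prev (by simp; omega), if_pos h2]
      group
    · rw [if_neg h1, sigmaF_of_far (by simp; omega) (by simp; omega), if_neg h2]
      group

theorem sigmaH_deltaH {g : ℕ} (l : Fin (2 * g)) : sigmaH l (deltaH g) = deltaH g := by
  have hz : yH g (2 * g + 1) = PresentedGroup.of (Fin.last (2 * g)) := yH_eq_of _ (by simp)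
  have hfix : l.succ ≠ Fin.last (2 * g) →
      sigmaH l (yH g (2 * g + 1)) = yH g (2 * g + 1) := by
    intro h
    rw [hz]
    simp [sigmaH, h.symm, (Fin.castSucc_lt_last l).ne']
  rw [deltaH, map_mul, ← iota_sigmaF]
  by_cases hl : (l : ℕ) % 2 = 0
  · rw [sigmaF_oddWord_of_even hl le_rfl, hfix]
    simp only [ne_eq, Fin.ext_iff, Fin.val_succ, Fin.val_last]
    omega
  · rw [sigmaF_oddWord_of_odd (by omega) le_rfl]
    by_cases h : g = (l : ℕ) / 2 + 1
    · have e : l.succ = Fin.last (2 * g) := Fin.ext (by simp; omega)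
      have hs : sigmaH l (yH g (2 * g + 1)) =
          PresentedGroup.of l.succ * PresentedGroup.of l.castSucc * PresentedGroup.of l.succ := by
        rw [hz, ← e]
        have : l.succ ≠ l.castSucc := fun h => by simp [Fin.ext_iff] at h
        simp [sigmaH, this]
      rw [if_pos h, map_mul, iota_of, hs, hz, ← e]
      simp only [mul_assoc]
      rw [← mul_assoc (PresentedGroup.of l.succ) (PresentedGroup.of l.succ), H_sq, one_mul,
        ← mul_assoc (PresentedGroup.of l.castSucc) (PresentedGroup.of l.castSucc), H_sq, one_mul]
    · rw [if_neg h, mul_one, hfix]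
      simp only [ne_eq, Fin.ext_iff, Fin.val_succ, Fin.val_last]
      omega

theorem sigmaF_deltaSq {g : ℕ} (l : Fin (2 * g)) : sigmaF l (deltaSq g) = deltaSq g := by
  apply iota_injective
  rw [iota_sigmaF, iota_deltaSq, map_mul, sigmaH_deltaH]

theorem sigmaF_theta {g : ℕ} (l : Fin (2 * g)) (w : F g) :
    sigmaF l (theta g w) = theta g (sigmaF l w) := by
  apply iota_injective
  rw [iota_sigmaF, iota_theta, iota_theta, map_mul, map_mul, map_inv, sigmaH_deltaH, iota_sigmaF]

/-! ### Deleting a letter of `Δ` -/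

/-- `Δ = (y_1 ⋯ y_{2k}) y_{2k+1} (y_{2k+2} ⋯ y_{2g+1})`, and
`Δ = (y_1 ⋯ y_{2k}) y_{2k} (y_{2k} ⋯ y_{2g+1})` since `y_{2k}² = 1`. -/
theorem deltaH_eq {g k : ℕ} (hk : k ≤ g) :
    deltaH g = iota g (oddWord g k) * yH g (2 * k + 1) * iota g (evenWord g (k + 1)) ∧
    (1 ≤ k → deltaH g = iota g (oddWord g k) * yH g (2 * k) * iota g (evenWord g k)) := by
  have hy : ∀ n (u : H g), yH g n * (yH g n * u) = u := fun n u => by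
    rw [← mul_assoc, yH_mul_self, one_mul]
  have step : ∀ k, 1 ≤ k → k ≤ g →
      deltaH g = iota g (oddWord g k) * yH g (2 * k + 1) * iota g (evenWord g (k + 1)) →
      deltaH g = iota g (oddWord g k) * yH g (2 * k) * iota g (evenWord g k) := by
    intro k h1 h2 h
    rw [h, evenWord_eq h2, map_mul, iota_xF (by omega) (by omega)]
    simp only [mul_assoc, hy]
  have main : deltaH g =
      iota g (oddWord g k) * yH g (2 * k + 1) * iota g (evenWord g (k + 1)) := by
    induction hk using Nat.decreasingInduction with
    | self => rw [evenWord_last, map_one, mul_one, deltaH]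
    | of_succ k hk ih =>
      rw [step (k + 1) (by omega) (by omega) ih, oddWord_succ, map_mul,
        iota_xF (by omega) (by omega)]
      simp only [mul_assoc, show 2 * k + 1 + 1 = 2 * (k + 1) by ring, hy]
  exact ⟨main, fun h1 => step k h1 hk main⟩

/-- If `Δ = a y_n b` in `H_{2g+1}`, then `ab` is `Δ` with a letter deleted; hence
`ab Δ⁻¹` is an involution, and `Δ⁻¹ (ab) Δ = (ab)⁻¹ Δ²`. -/
theorem theta_of_deltaH_eq {g n : ℕ} {a b : F g}
    (h : deltaH g = iota g a * yH g n * iota g b) :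
    theta g (a * b) = (a * b)⁻¹ * deltaSq g := by
  apply iota_injective
  rw [iota_theta, map_mul, map_mul, map_inv, iota_deltaSq, map_mul]
  rw [← mul_assoc _ (deltaH g)]
  congr 1
  rw [h]
  simp only [mul_inv_rev, yH_inv]
  group

theorem theta_odd_even_succ {g k : ℕ} (hk : k ≤ g) :
    theta g (oddWord g k * evenWord g (k + 1)) =
      (oddWord g k * evenWord g (k + 1))⁻¹ * deltaSq g :=
  theta_of_deltaH_eq (deltaH_eq hk).1

theorem theta_odd_even {g k : ℕ} (h1 : 1 ≤ k) (hk : k ≤ g) :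
    theta g (oddWord g k * evenWord g k) = (oddWord g k * evenWord g k)⁻¹ * deltaSq g :=
  theta_of_deltaH_eq ((deltaH_eq hk).2 h1)

/-! ### The centre of the Heisenberg group `G` -/

theorem rho_surjective (g p : ℕ) : Function.Surjective (rho g p) :=
  QuotientGroup.mk'_surjective _

theorem rho_eq_one {g p : ℕ} {w : F g} : rho g p w = 1 ↔ w ∈ N g p :=
  QuotientGroup.eq_one_iff w

theorem rho_pow (g p : ℕ) (w : F g) : rho g p w ^ p = 1 := by
  rw [← map_pow, rho_eq_one]
  exact Subgroup.subset_normalClosure (Or.inl (Or.inr ⟨w, rfl⟩))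

theorem G_pow {g p : ℕ} (a : G g p) : a ^ p = 1 := by
  obtain ⟨w, rfl⟩ := rho_surjective g p a
  exact rho_pow g p w

theorem c_eq (g p : ℕ) : c g p = rho g p ⁅xF g 1, xF g 2⁆ := (map_commutatorElement _ _ _).symm

theorem commutatorElement_mem (g : ℕ) (a b : F g) : ⁅a, b⁆ ∈ commutator (F g) :=
  Subgroup.commutator_mem_commutator (Subgroup.mem_top a) (Subgroup.mem_top b)

theorem c_comm {g p : ℕ} (a : G g p) : Commute (c g p) a := by
  obtain ⟨w, rfl⟩ := rho_surjective g p a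
  rw [← commutatorElement_eq_one_iff_commute, c_eq, ← map_commutatorElement, rho_eq_one]
  exact Subgroup.subset_normalClosure (Or.inl (Or.inl
    (Subgroup.commutator_mem_commutator (commutatorElement_mem g _ _) (Subgroup.mem_top _))))

theorem omega_xF {g : ℕ} (hg : 0 < g) : omega (xF g 1) (xF g 2) = 1 := by
  rw [xF_eq_of ⟨0, by omega⟩ (by simp), xF_eq_of ⟨1, by omega⟩ (by simp), omega_of_of]
  simp [omegaMat]

/-- On `[F_{2g}, F_{2g}]` the quotient map to `G` is given by the contraction. -/
theorem rho_of_mem_commutator {g p : ℕ} [NeZero p] (hg : 0 < g) {w : F g}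
    (hw : w ∈ commutator (F g)) :
    rho g p w = c g p ^ (contraction g p ⟨w, hw⟩).toAdd.val := by
  set n := (contraction g p ⟨w, hw⟩).toAdd.val with hn
  rw [c_eq, ← map_pow, ← mul_inv_eq_one, ← map_inv, ← map_mul, rho_eq_one]
  refine Subgroup.subset_normalClosure (Or.inr ?_)
  have hc := commutatorElement_mem g (xF g 1) (xF g 2)
  refine ⟨mul_mem hw (inv_mem (pow_mem hc n)), ?_⟩
  have e : (⟨w * (⁅xF g 1, xF g 2⁆ ^ n)⁻¹, mul_mem hw (inv_mem (pow_mem hc n))⟩ :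
      commutator (F g)) = ⟨w, hw⟩ * (⟨⁅xF g 1, xF g 2⁆, hc⟩ ^ n)⁻¹ := rfl
  rw [e, map_mul, map_inv, map_pow, contraction_commutator, omega_xF hg, mul_inv_eq_one]
  apply Multiplicative.toAdd.injective
  rw [toAdd_pow, toAdd_ofAdd, hn]
  simp

theorem rho_commutator {g p : ℕ} [NeZero p] (hg : 0 < g) (a b : F g) :
    ⁅rho g p a, rho g p b⁆ = c g p ^ (omega a b : ZMod p).val := by
  rw [← map_commutatorElement, rho_of_mem_commutator hg (commutatorElement_mem g a b),
    contraction_commutator]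
  rfl

theorem abelianization_of_eq {g : ℕ} (w : F g) : Abelianization.of w =
    ∏ i, Abelianization.of (FreeGroup.of i : F g) ^ (expo i w).toAdd := by
  induction w using F_induction with
  | one => simp
  | of j =>
    rw [Finset.prod_eq_single j]
    · simp [expo]
    · intro i _ hi
      simp [expo, hi.symm]
    · simp
  | inv a h => simp [h]
  | mul a b ha hb => simp [ha, hb, zpow_add, Finset.prod_mul_distrib]

/-- A word whose exponent sums are divisible by `p` represents a power of `c`. -/
theorem exists_rho_eq_c_pow {g p : ℕ} [NeZero p] (hg : 0 < g) {w : F g}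
    (hw : ∀ i, ((expo i w).toAdd : ZMod p) = 0) : ∃ n : ℕ, rho g p w = c g p ^ n := by
  -- `w = u ^ p` modulo commutators, where `u` has the exponent sums of `w` divided by `p`
  choose b hb using fun i => (ZMod.intCast_zmod_eq_zero_iff_dvd _ p).1 (hw i)
  obtain ⟨u, hu⟩ := QuotientGroup.mk'_surjective (commutator (F g))
    (∏ i, Abelianization.of (FreeGroup.of i : F g) ^ b i : Abelianization (F g))
  have hu' : Abelianization.of u = ∏ i, Abelianization.of (FreeGroup.of i : F g) ^ b i := hu
  have h1 : Abelianization.of ((u ^ p)⁻¹ * w) = 1 := by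
    rw [map_mul, map_inv, map_pow, hu', abelianization_of_eq w, ← Finset.prod_pow,
      inv_mul_eq_one]
    refine Finset.prod_congr rfl fun i _ => ?_
    rw [hb i, mul_comm (p : ℤ), zpow_mul, zpow_natCast]
  have h2 : (u ^ p)⁻¹ * w ∈ commutator (F g) := by
    rwa [← Abelianization.ker_of, MonoidHom.mem_ker]
  refine ⟨(contraction g p ⟨_, h2⟩).toAdd.val, ?_⟩
  rw [← rho_of_mem_commutator hg h2, map_mul, map_inv, map_pow, rho_pow, inv_one, one_mul]

/-! ### The `η`-component of the group algebra -/

section phi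

variable {g p : ℕ} [Fact p.Prime] {η : ℂ}

theorem of_c_mul_phiC (hη : IsPrimitiveRoot η p) :
    MonoidAlgebra.of ℂ (G g p) (c g p) * phiC g p η = η • phiC g p η := by
  have h1 : ∀ n : ZMod p, c g p * c g p ^ n.val = c g p ^ (n + 1).val := by
    intro n
    have hc := G_pow (c g p)
    rw [← pow_succ', ZMod.val_add, ZMod.val_one_eq_one_mod, Nat.add_mod_mod,
      ← pow_mod_orderOf _ (n.val + 1), ← pow_mod_orderOf _ ((n.val + 1) % p)]
    congr 1
    rw [Nat.mod_mod_of_dvd _ (orderOf_dvd_of_pow_eq_one hc)]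
  have h2 : ∀ n : ZMod p, ePow η (-n) = η * ePow η (-(n + 1)) := by
    intro n
    have : ePow η (1 : ZMod p) = η := by
      have := ePow_natCast hη 1
      simpa using this
    nth_rewrite 2 [← this]
    rw [← ePow_add hη]
    congr 1
    ring
  rw [phiC, mul_smul_comm, smul_comm η]
  congr 1
  rw [Finset.mul_sum, Finset.smul_sum]
  rw [← Equiv.sum_comp (Equiv.addRight (1 : ZMod p))
    (fun n => η • ePow η (-n) • MonoidAlgebra.of ℂ (G g p) (c g p ^ n.val))]
  refine Finset.sum_congr rfl fun n _ => ?_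
  rw [mul_smul_comm, ← map_mul, h1, h2, smul_smul]
  rfl

theorem of_c_pow_mul_phiC (hη : IsPrimitiveRoot η p) (n : ℕ) :
    MonoidAlgebra.of ℂ (G g p) (c g p ^ n) * phiC g p η = η ^ n • phiC g p η := by
  induction n with
  | zero => rw [pow_zero, pow_zero, map_one, one_mul, one_smul]
  | succ n ih => rw [pow_succ', map_mul, mul_assoc, ih, mul_smul_comm, of_c_mul_phiC hη, smul_smul,
      pow_succ]

theorem phiC_comm (a : MonoidAlgebra ℂ (G g p)) : Commute (phiC g p η) a := by
  induction a using MonoidAlgebra.induction_on with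
  | of γ =>
    rw [phiC]
    refine Commute.smul_left (Finset.sum_induction _ (fun b => Commute b _)
      (fun _ _ => Commute.add_left) (Commute.zero_left _) fun n _ => Commute.smul_left ?_ _) _
    exact ((c_comm γ).pow_left _).map (MonoidAlgebra.of ℂ (G g p))
  | add a b ha hb => exact ha.add_right hb
  | smul r a ha => exact ha.smul_right r

theorem phiC_mul_self (hη : IsPrimitiveRoot η p) : phiC g p η * phiC g p η = phiC g p η := by
  have hp0 : (p : ℂ) ≠ 0 := Nat.cast_ne_zero.2 (NeZero.ne p)
  conv_lhs => arg 1; rw [phiC]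
  rw [smul_mul_assoc, Finset.sum_mul]
  have : ∀ n : ZMod p, (ePow η (-n) • MonoidAlgebra.of ℂ (G g p) (c g p ^ n.val)) * phiC g p η =
      phiC g p η := by
    intro n
    rw [smul_mul_assoc, of_c_pow_mul_phiC hη, smul_smul, ← ePow_natCast hη,
      ZMod.natCast_zmod_val, ← ePow_add hη]
    simp [ePow_zero]
  rw [Finset.sum_congr rfl fun n _ => this n]
  simp [ZMod.card, ← Nat.cast_smul_eq_nsmul ℂ, smul_smul, hp0]

/-- The subspace `φ(c;η) ℂ[G]` of the group algebra, a two-sided ideal. -/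
def phiPart (g p : ℕ) [Fact p.Prime] (η : ℂ) : Submodule ℂ (MonoidAlgebra ℂ (G g p)) :=
  LinearMap.range (LinearMap.mulLeft ℂ (phiC g p η))

theorem mem_phiPart (hη : IsPrimitiveRoot η p) {a : MonoidAlgebra ℂ (G g p)} :
    a ∈ phiPart g p η ↔ phiC g p η * a = a := by
  constructor
  · rintro ⟨b, rfl⟩
    simp only [LinearMap.mulLeft_apply]
    rw [← mul_assoc, phiC_mul_self hη]
  · intro h
    exact ⟨a, h⟩

theorem phiPart_mul (hη : IsPrimitiveRoot η p) {a : MonoidAlgebra ℂ (G g p)}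
    (ha : a ∈ phiPart g p η) (b : MonoidAlgebra ℂ (G g p)) : a * b ∈ phiPart g p η := by
  rw [mem_phiPart hη] at *
  rw [← mul_assoc, ha]

/-- `φ(c;η) γ` depends up to a scalar only on the class of `γ` in `G / ⟨c⟩ = (ℤ/p)^{2g}`, which
bounds the dimension of `φ(c;η) ℂ[G]`. -/
theorem phiPart_le_span (hg : 0 < g) (hη : IsPrimitiveRoot η p) :
    ∃ s : (Fin (2 * g) → ZMod p) → MonoidAlgebra ℂ (G g p),
      phiPart g p η ≤ Submodule.span ℂ (Set.range s) := by
  let v : F g → Fin (2 * g) → ZMod p := fun w i => ((expo i w).toAdd : ZMod p)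
  let s : (Fin (2 * g) → ZMod p) → MonoidAlgebra ℂ (G g p) := fun u =>
    phiC g p η * MonoidAlgebra.of ℂ (G g p) (rho g p (Function.invFun v u))
  refine ⟨s, ?_⟩
  rintro _ ⟨a, rfl⟩
  rw [LinearMap.mulLeft_apply]
  induction a using MonoidAlgebra.induction_on with
  | of γ =>
    obtain ⟨w, rfl⟩ := rho_surjective g p γ
    set w' := Function.invFun v (v w) with hw'
    have hv : v w' = v w := Function.invFun_eq ⟨w, rfl⟩
    obtain ⟨n, hn⟩ := exists_rho_eq_c_pow (p := p) hg (w := w * w'⁻¹) fun i => by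
      have := congrFun hv i
      simp only [v] at this
      simp [this]
    have e : rho g p w = c g p ^ n * rho g p w' := by
      rw [← hn, ← map_mul, inv_mul_cancel_right]
    have : phiC g p η * MonoidAlgebra.of ℂ (G g p) (rho g p w) = η ^ n • s (v w) := by
      rw [e, map_mul, ← mul_assoc, (phiC_comm _).eq, of_c_pow_mul_phiC hη, smul_mul_assoc]
    rw [this]
    exact Submodule.smul_mem _ _ (Submodule.subset_span ⟨_, rfl⟩)
  | add a b ha hb => rw [mul_add]; exact add_mem ha hb
  | smul r a ha => rw [mul_smul_comm]; exact Submodule.smul_mem _ _ ha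

theorem finite_phiPart (hg : 0 < g) (hη : IsPrimitiveRoot η p) :
    Module.Finite ℂ (phiPart g p η) ∧ Module.finrank ℂ (phiPart g p η) ≤ p ^ (2 * g) := by
  obtain ⟨s, hs⟩ := phiPart_le_span hg hη
  have : Module.Finite ℂ (Submodule.span ℂ (Set.range s)) :=
    Module.Finite.span_of_finite ℂ (Set.finite_range s)
  have := Submodule.finiteDimensional_of_le hs
  refine ⟨this, (Submodule.finrank_mono hs).trans ((finrank_range_le_card s).trans ?_)⟩
  simp [ZMod.card]

end phi

/-! ### Gauss sums -/

section gauss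

variable {p : ℕ} [Fact p.Prime] {η : ℂ}

theorem sum_ePow_mul (hη : IsPrimitiveRoot η p) (a : ZMod p) :
    ∑ t : ZMod p, ePow η (a * t) = if a = 0 then (p : ℂ) else 0 := by
  split_ifs with h
  · simp [h, ePow_zero, ZMod.card]
  · have h1 : ∑ t : ZMod p, ePow η (a * t) = ePow η a * ∑ t : ZMod p, ePow η (a * t) := by
      rw [Finset.mul_sum, ← Equiv.sum_comp (Equiv.addRight (1 : ZMod p))]
      refine Finset.sum_congr rfl fun t _ => ?_
      rw [← ePow_add hη, Equiv.coe_addRight]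
      congr 1
      ring
    have h2 : ePow η a ≠ 1 := by
      rw [ePow, Ne, hη.pow_eq_one_iff_dvd]
      intro hd
      exact h ((ZMod.val_eq_zero a).1 (Nat.eq_zero_of_dvd_of_lt hd (ZMod.val_lt a)))
    by_contra hne
    exact h2 (mul_right_cancel₀ hne (by rw [one_mul]; exact h1.symm))

theorem two_ne_zero_zmod (hp : p ≠ 2) : (2 : ZMod p) ≠ 0 := by
  intro h
  have h2 : ((2 : ℕ) : ZMod p) = 0 := by exact_mod_cast h
  rw [ZMod.natCast_eq_zero_iff] at h2
  exact hp ((Nat.prime_dvd_prime_iff_eq Fact.out Nat.prime_two).1 h2)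

/-- `G(1/2) G(-1/2) = p`. -/
theorem gauss_mul_gauss_neg (hp : p ≠ 2) (hη : IsPrimitiveRoot η p) :
    gauss p η (1 / 2) * gauss p η (-(1 / 2)) = p := by
  have h2 := two_ne_zero_zmod hp
  rw [mul_comm, gauss, gauss, Finset.sum_mul_sum]
  have h1 : ∀ t : ZMod p, ∑ s : ZMod p, ePow η (-(1 / 2) * t ^ 2) * ePow η (1 / 2 * s ^ 2) =
      ∑ u : ZMod p, ePow η (1 / 2 * u ^ 2) * ePow η (u * t) := by
    intro t
    rw [← Equiv.sum_comp (Equiv.addRight t)]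
    refine Finset.sum_congr rfl fun u _ => ?_
    rw [← ePow_add hη, ← ePow_add hη, Equiv.coe_addRight]
    congr 1
    field_simp
    ring
  rw [Finset.sum_congr rfl fun t _ => h1 t, Finset.sum_comm]
  simp_rw [← Finset.mul_sum, sum_ePow_mul hη]
  simp [ePow_zero]

end gauss

/-! ### The right action on `V` -/

section operators

variable {g p : ℕ} [Fact p.Prime] {η : ℂ} (hp : p ≠ 2) (hη : IsPrimitiveRoot η p)

/-- The right action of the group algebra on `V`, as an anti-homomorphism to `End V`. -/
def act : MonoidAlgebra ℂ (G g p) →ₗ[ℂ] Module.End ℂ (V g p) :=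
  (MulOpposite.opLinearEquiv ℂ).symm.toLinearMap ∘ₗ
    (MonoidAlgebra.lift ℂ (Module.End ℂ (V g p))ᵐᵒᵖ (G g p) (rightAct hp hη)).toLinearMap

theorem act_of (γ : G g p) : act hp hη (MonoidAlgebra.of ℂ _ γ) = (rightAct hp hη γ).unop := by
  show MulOpposite.unop (MonoidAlgebra.lift ℂ _ _ _ (MonoidAlgebra.of ℂ _ γ)) = _
  rw [MonoidAlgebra.lift_of]

theorem act_mul (a b : MonoidAlgebra ℂ (G g p)) :
    act hp hη (a * b) = act hp hη b * act hp hη a := by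
  show MulOpposite.unop (MonoidAlgebra.lift ℂ _ _ _ (a * b)) = _
  rw [map_mul, MulOpposite.unop_mul]
  rfl

theorem act_one : act hp hη (1 : MonoidAlgebra ℂ (G g p)) = 1 := by
  show MulOpposite.unop (MonoidAlgebra.lift ℂ _ _ _ 1) = _
  rw [map_one]
  rfl

theorem act_of_mul (a b : G g p) : act hp hη (MonoidAlgebra.of ℂ _ (a * b)) =
    act hp hη (MonoidAlgebra.of ℂ _ b) * act hp hη (MonoidAlgebra.of ℂ _ a) := by
  rw [map_mul, act_mul]

theorem act_of_inv_mul (a : G g p) : act hp hη (MonoidAlgebra.of ℂ _ a⁻¹) *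
    act hp hη (MonoidAlgebra.of ℂ _ a) = 1 := by
  rw [← act_of_mul, mul_inv_cancel, map_one, act_one]

theorem act_mul_of_inv (a : G g p) : act hp hη (MonoidAlgebra.of ℂ _ a) *
    act hp hη (MonoidAlgebra.of ℂ _ a⁻¹) = 1 := by
  rw [← act_of_mul, inv_mul_cancel, map_one, act_one]

theorem act_gen (l : Fin (2 * g)) :
    act hp hη (MonoidAlgebra.of ℂ _ (rho g p (FreeGroup.of l))) = xPow η l 1 := by
  rw [act_of, rightAct_of, MulOpposite.unop_op]

theorem act_gen_pow (l : Fin (2 * g)) (n : ZMod p) :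
    act hp hη (MonoidAlgebra.of ℂ _ (rho g p (FreeGroup.of l) ^ n.val)) = xPow η l n := by
  rw [act_of, map_pow, rightAct_of, ← MulOpposite.op_pow, MulOpposite.unop_op, xPow_pow hη,
    ZMod.natCast_zmod_val]

theorem act_gen_inv (l : Fin (2 * g)) :
    act hp hη (MonoidAlgebra.of ℂ _ (rho g p (FreeGroup.of l))⁻¹) = xPow η l (-1) := by
  have h1 := act_of_inv_mul hp hη (rho g p (FreeGroup.of l))
  rw [act_gen] at h1
  have h2 : xPow η l (1 : ZMod p) * xPow η l (-1) = 1 := by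
    rw [xPow_mul hη, add_neg_cancel, xPow_zero]
  exact left_inv_eq_right_inv h1 h2

theorem act_of_c (hg : 0 < g) :
    act hp hη (MonoidAlgebra.of ℂ _ (c g p)) = η • (1 : Module.End ℂ (V g p)) := by
  have h1 : ePow η (1 : ZMod p) = η := by
    have := ePow_natCast hη 1
    simpa using this
  have h : rightAct hp hη (c g p) = ((rightF hη ⁅xF g 1, xF g 2⁆ : _ˣ) : (Module.End ℂ (V g p))ᵐᵒᵖ) := by
    rw [c_eq]
    rfl
  rw [act_of, h, map_commutatorElement, rightF_commutator, omega_xF hg, etaUnit_val]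
  simp [h1]

theorem act_of_c_pow (hg : 0 < g) (n : ℕ) :
    act hp hη (MonoidAlgebra.of ℂ _ (c g p ^ n)) = η ^ n • (1 : Module.End ℂ (V g p)) := by
  induction n with
  | zero => rw [pow_zero, map_one, act_one, pow_zero, one_smul]
  | succ n ih => rw [pow_succ, act_of_mul, ih, act_of_c hp hη hg, smul_mul_smul_comm, mul_one,
      pow_succ']

theorem act_phiC (hg : 0 < g) : act hp hη (phiC g p η) = 1 := by
  have hp0 : (p : ℂ) ≠ 0 := Nat.cast_ne_zero.2 (NeZero.ne p)
  rw [phiC, map_smul, map_sum]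
  have : ∀ n : ZMod p, act hp hη (ePow η (-n) • MonoidAlgebra.of ℂ (G g p) (c g p ^ n.val)) = 1 := by
    intro n
    rw [map_smul, act_of_c_pow hp hη hg, smul_smul, ← ePow_natCast hη, ZMod.natCast_zmod_val,
      ← ePow_add hη]
    simp [ePow_zero]
  rw [Finset.sum_congr rfl fun n _ => this n]
  simp [ZMod.card, ← Nat.cast_smul_eq_nsmul ℂ, smul_smul, hp0]

theorem xPow_comm (hη : IsPrimitiveRoot η p) (l m : Fin (2 * g)) (a b : ZMod p) :
    xPow η l a * xPow η m b =
      ePow η (-(a * b * (omegaMat l m : ZMod p))) • (xPow η m b * xPow η l a) := by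
  have aux : ∀ (l m : Fin (2 * g)) (a b : ZMod p), (l : ℕ) % 2 = 0 → ¬ (m : ℕ) % 2 = 0 →
      xPow η l a * xPow η m b =
        ePow η (-(a * b * (omegaMat l m : ZMod p))) • (xPow η m b * xPow η l a) := by
    intro l m a b hl hm
    apply V_ext
    intro j
    simp only [Module.End.mul_apply, LinearMap.smul_apply]
    rw [xPow_even η hl, map_smul, xPow_odd η hm, xPow_even η hl, smul_smul, ← ePow_add hη,
      ← step_half l m hl hm]
    congr 2
    simp
    ring
  by_cases hl : (l : ℕ) % 2 = 0 <;> by_cases hm : (m : ℕ) % 2 = 0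
  · rw [omegaMat_parity l m (by omega)]
    simp only [Int.cast_zero, mul_zero, neg_zero, ePow_zero, one_smul]
    apply V_ext
    intro j
    simp only [Module.End.mul_apply]
    rw [xPow_even η hl, map_smul, xPow_even η hm, map_smul, xPow_even η hl, smul_comm]
  · exact aux l m a b hl hm
  · rw [aux m l b a hm hl, smul_smul, ← ePow_add hη, omegaMat_antisymm l m]
    have : -(a * b * ((-omegaMat m l : ℤ) : ZMod p)) + -(b * a * (omegaMat m l : ZMod p)) = 0 := by
      push_cast; ring
    rw [this, ePow_zero, one_smul]
  · rw [omegaMat_parity l m (by omega)]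
    simp only [Int.cast_zero, mul_zero, neg_zero, ePow_zero, one_smul]
    apply V_ext
    intro j
    simp only [Module.End.mul_apply]
    rw [xPow_odd η hl, xPow_odd η hm, xPow_odd η hm, xPow_odd η hl]
    congr 1
    abel

/-! ### The operators `Ψ_l` as quadratic Gauss sums -/

/-- The quadratic Gauss sum `(G(1/2)/p) ∑_s η^{-(1/2)(s+1/2)^2} u^{-s}` in an element `u ∈ G`,
acting on `V`. -/
def gaussOp (u : G g p) : Module.End ℂ (V g p) :=
  (gauss p η (1 / 2) / p) • ∑ s : ZMod p,
    ePow η (-(1 / 2) * (s + 1 / 2) ^ 2) • act hp hη (MonoidAlgebra.of ℂ _ (u ^ (-s).val))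

/-- Both kinds of operators `Ψ_l` are the same Gauss sum in `x_l`; for the diagonal ones this is
`∑_s η^{-(s+j+1/2)^2/2} = G(-1/2)` together with `G(1/2) G(-1/2) = p`. -/
theorem psiV_eq_sum (hp : p ≠ 2) (hη : IsPrimitiveRoot η p) (l : Fin (2 * g)) : psiV η l = (gauss p η (1 / 2) / p) • ∑ s : ZMod p,
    ePow η (-(1 / 2) * (s + 1 / 2) ^ 2) • xPow η l (-s) := by
  have h2 := two_ne_zero_zmod hp
  have hp0 : (p : ℂ) ≠ 0 := Nat.cast_ne_zero.2 (NeZero.ne p)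
  apply V_ext
  intro j
  rw [psiV, Finsupp.linearCombination_single, one_smul]
  simp only [LinearMap.smul_apply, LinearMap.sum_apply]
  split_ifs with h
  · simp only [xPow_even η h, smul_smul, ← Finset.sum_smul]
    congr 1
    set t := j (half l)
    have : ∀ s : ZMod p, ePow η (-(1 / 2) * (s + 1 / 2) ^ 2) * ePow η (-s * t) =
        ePow η ((t + 1) * t / 2) * ePow η (-(1 / 2) * (s + (t + 1 / 2)) ^ 2) := by
      intro s
      rw [← ePow_add hη, ← ePow_add hη]
      congr 1
      field_simp
      ring
    have hG := gauss_mul_gauss_neg hp hη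
    have hs : ∑ s, ePow η (-(1 / 2) * (s + (t + 1 / 2)) ^ 2) = gauss p η (-(1 / 2)) :=
      Equiv.sum_comp (Equiv.addRight (t + 1 / 2)) fun s => ePow η (-(1 / 2) * s ^ 2)
    rw [Finset.sum_congr rfl fun s _ => this s, ← Finset.mul_sum, hs]
    rw [div_mul_eq_mul_div, mul_left_comm, hG, mul_div_cancel_right₀ _ hp0]
  · simp only [xPow_odd η h]
    congr 2
    funext s
    simp [sub_eq_add_neg]

theorem gaussOp_gen (l : Fin (2 * g)) :
    gaussOp hp hη (rho g p (FreeGroup.of l)) = psiV η l := by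
  rw [psiV_eq_sum hp hη, gaussOp]
  simp only [act_gen_pow]

theorem isUnit_psiV (hp : p ≠ 2) (hη : IsPrimitiveRoot η p) (l : Fin (2 * g)) : IsUnit (psiV (p := p) η l) := by
  have h2 := two_ne_zero_zmod hp
  have hp0 : (p : ℂ) ≠ 0 := Nat.cast_ne_zero.2 (NeZero.ne p)
  -- the inverse is the adjoint, as `x_l` is unitary and `G(1/2)` has conjugate `G(-1/2)`
  let P : Module.End ℂ (V g p) := (gauss p η (-(1 / 2)) / p) • ∑ t : ZMod p,
    ePow η (1 / 2 * (t + 1 / 2) ^ 2) • xPow η l t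
  have key : psiV η l * P = 1 := by
    rw [psiV_eq_sum hp hη, smul_mul_smul_comm, Finset.sum_mul_sum]
    have h1 : ∀ s : ZMod p, ∑ t, (ePow η (-(1 / 2) * (s + 1 / 2) ^ 2) • xPow η l (-s)) *
        (ePow η (1 / 2 * (t + 1 / 2) ^ 2) • xPow η l t) =
        ∑ u, (ePow η (1 / 2 * u * (u + 1)) * ePow η (u * s)) • xPow η l u := by
      intro s
      rw [← Equiv.sum_comp (Equiv.addRight s)]
      refine Finset.sum_congr rfl fun u _ => ?_
      rw [smul_mul_smul_comm, xPow_mul hη, ← ePow_add hη, ← ePow_add hη, Equiv.coe_addRight]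
      congr 2
      · field_simp
        ring
      · ring
    rw [Finset.sum_congr rfl fun s _ => h1 s, Finset.sum_comm]
    simp_rw [← Finset.sum_smul, ← Finset.mul_sum, sum_ePow_mul hη, mul_ite, mul_zero, ite_smul,
      zero_smul]
    rw [Finset.sum_ite_eq' Finset.univ (0 : ZMod p), if_pos (Finset.mem_univ _), xPow_zero,
      smul_smul]
    have hG := gauss_mul_gauss_neg hp hη
    have : gauss p η (1 / 2) / p * (gauss p η (-(1 / 2)) / p) *
        (ePow η (1 / 2 * (0 : ZMod p) * (0 + 1)) * p) = 1 := by
      rw [div_mul_div_comm, hG]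
      simp [ePow_zero, hp0]
    rw [this, one_smul]
  exact ⟨⟨psiV η l, P, key, mul_eq_one_comm.1 key⟩, rfl⟩

theorem psiV_mul_xPow (hp : p ≠ 2) (hη : IsPrimitiveRoot η p) (l m : Fin (2 * g)) (t : ZMod p) : psiV η l * xPow η m t =
    (gauss p η (1 / 2) / p) • ∑ s : ZMod p,
      ePow η (-(1 / 2) * (s + 1 / 2) ^ 2 + s * t * (omegaMat l m : ZMod p)) •
        (xPow η m t * xPow η l (-s)) := by
  rw [psiV_eq_sum hp hη, smul_mul_assoc, Finset.sum_mul]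
  refine congrArg (HSMul.hSMul _) (Finset.sum_congr rfl fun s _ => ?_)
  rw [smul_mul_assoc, xPow_comm hη, smul_smul, ← ePow_add hη]
  congr 3
  ring

theorem psiV_mul_gen (l m : Fin (2 * g)) :
    psiV η l * act hp hη (MonoidAlgebra.of ℂ _ (rho g p (FreeGroup.of m))) =
      act hp hη (MonoidAlgebra.of ℂ _ (rho g p (sigmaF l (FreeGroup.of m)))) * psiV η l := by
  have h2 := two_ne_zero_zmod hp
  rw [act_gen, psiV_mul_xPow hp hη]
  by_cases h1 : (m : ℕ) + 1 = l
  · have ho : omegaMat l m = -1 := by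
      have e : (l : ℤ) = m + 1 := by omega
      simp [omegaMat, e]
    rw [sigmaF_of_prev h1, map_mul, act_of_mul, act_gen, act_gen, ho, xPow_comm hη, ho, smul_mul_assoc,
      psiV_eq_sum hp hη, mul_smul_comm, smul_comm (ePow η _)]
    refine congrArg (HSMul.hSMul _) ?_
    rw [Finset.mul_sum, Finset.smul_sum]
    refine (Equiv.sum_comp (Equiv.subRight (1 : ZMod p)) _).symm.trans
      (Finset.sum_congr rfl fun s _ => ?_)
    rw [mul_smul_comm, mul_assoc (xPow η m 1), xPow_mul hη, smul_smul, ← ePow_add hη,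
      Equiv.subRight_apply]
    congr 2
    · push_cast
      field_simp
      ring
    · congr 2
      ring
  by_cases h3 : (l : ℕ) + 1 = m
  · have ho : omegaMat l m = 1 := by
      have e : (m : ℤ) = l + 1 := by omega
      simp [omegaMat, e]
    rw [sigmaF_of_next h3, map_mul, act_of_mul, map_inv, act_gen, act_gen_inv, ho,
      psiV_eq_sum hp hη, mul_smul_comm, Finset.mul_sum]
    refine congrArg (HSMul.hSMul _) ((Equiv.sum_comp (Equiv.addRight (1 : ZMod p)) _).symm.trans
      (Finset.sum_congr rfl fun s _ => ?_))
    rw [mul_smul_comm, mul_assoc (xPow η m 1), xPow_mul hη, Equiv.coe_addRight]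
    congr 2
    · push_cast
      field_simp
      ring
    · congr 2
      ring
  · have ho : omegaMat l m = 0 := by
      rw [omegaMat, if_neg]
      intro h
      rcases (abs_eq (by norm_num)).1 h with h | h <;> omega
    rw [sigmaF_of_far h1 h3, act_gen, psiV_eq_sum hp hη, mul_smul_comm, Finset.mul_sum, ho]
    simp

/-- `Ψ_l (v a) = Ψ_l(v) σ_l(a)` for `a ∈ G`: the operators `Ψ_l` implement the braid group action
on `G`. -/
theorem psiV_mul_act_of (l : Fin (2 * g)) (w : F g) :
    psiV η l * act hp hη (MonoidAlgebra.of ℂ _ (rho g p w)) =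
      act hp hη (MonoidAlgebra.of ℂ _ (rho g p (sigmaF l w))) * psiV η l := by
  induction w using F_induction with
  | one => simp only [map_one, act_one, one_mul, mul_one]
  | of m => exact psiV_mul_gen hp hη l m
  | inv a h =>
    have h1 := act_mul_of_inv hp hη (rho g p a)
    have h2 := act_of_inv_mul hp hη (rho g p (sigmaF l a))
    rw [map_inv (rho g p), map_inv (sigmaF l), map_inv (rho g p)]
    calc _ = (act hp hη (MonoidAlgebra.of ℂ _ (rho g p (sigmaF l a))⁻¹) *
          act hp hη (MonoidAlgebra.of ℂ _ (rho g p (sigmaF l a)))) *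
          (psiV η l * act hp hη (MonoidAlgebra.of ℂ _ (rho g p a)⁻¹)) := by rw [h2, one_mul]
      _ = act hp hη (MonoidAlgebra.of ℂ _ (rho g p (sigmaF l a))⁻¹) *
          (psiV η l * act hp hη (MonoidAlgebra.of ℂ _ (rho g p a))) *
          act hp hη (MonoidAlgebra.of ℂ _ (rho g p a)⁻¹) := by rw [h]; simp only [mul_assoc]
      _ = _ := by rw [mul_assoc, mul_assoc, h1, mul_one]
  | mul a b ha hb =>
    rw [map_mul (rho g p), map_mul (sigmaF l), map_mul (rho g p), act_of_mul, act_of_mul, ← mul_assoc, hb, mul_assoc, ha,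
      mul_assoc]

theorem psiV_mul_gaussOp (l : Fin (2 * g)) (w : F g) :
    psiV η l * gaussOp hp hη (rho g p w) = gaussOp hp hη (rho g p (sigmaF l w)) * psiV η l := by
  rw [gaussOp, gaussOp, mul_smul_comm, smul_mul_assoc, Finset.mul_sum, Finset.sum_mul]
  congr 1
  refine Finset.sum_congr rfl fun s _ => ?_
  rw [mul_smul_comm, smul_mul_assoc, ← map_pow, psiV_mul_act_of, map_pow, map_pow]

theorem pow_val_neg (u : G g p) (s : ZMod p) : u ^ (-s).val = (u ^ s.val)⁻¹ := by
  rw [eq_inv_iff_mul_eq_one, ← pow_add]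
  have hd : p ∣ (-s).val + s.val := by
    rw [← ZMod.natCast_eq_zero_iff]; simp
  obtain ⟨k, hk⟩ := hd
  rw [hk, pow_mul, G_pow, one_pow]

/-- The Gauss sum is invariant under `u ↦ (uc)⁻¹`, by completing the square. -/
theorem gaussOp_inv (hg : 0 < g) (u : G g p) :
    gaussOp hp hη (u * c g p)⁻¹ = gaussOp hp hη u := by
  have h2 := two_ne_zero_zmod hp
  rw [gaussOp, gaussOp]
  congr 1
  rw [← Equiv.sum_comp (Equiv.neg (ZMod p))]
  refine Finset.sum_congr rfl fun s _ => ?_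
  rw [Equiv.neg_apply, pow_val_neg, inv_pow, inv_inv, (c_comm u).symm.mul_pow, act_of_mul,
    act_of_c_pow hp hη hg, smul_mul_assoc, one_mul, smul_smul, ← ePow_natCast hη,
    ZMod.natCast_zmod_val, ← ePow_add hη]
  congr 2
  field_simp
  ring

/-- With `K` the Gauss sum in `σ_i(x_j)`, one has `Ψ_i Ψ_j = K Ψ_i` and `Ψ_j K = Ψ_i Ψ_j`, the
latter because `σ_j(σ_i(x_j)) = (x_i c)⁻¹` in `G`. -/
theorem psiV_braid (hp : p ≠ 2) (hη : IsPrimitiveRoot η p) (hg : 0 < g) {i j : Fin (2 * g)} (h : (i : ℕ) + 1 = j) :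
    psiV (p := p) η i * psiV η j * psiV η i = psiV η j * psiV η i * psiV η j := by
  have hij : psiV η i * psiV η j =
      gaussOp hp hη (rho g p (sigmaF i (FreeGroup.of j))) * psiV η i := by
    rw [← gaussOp_gen hp hη j, psiV_mul_gaussOp]
  have hji : psiV η j * gaussOp hp hη (rho g p (sigmaF i (FreeGroup.of j))) =
      psiV η i * psiV η j := by
    rw [psiV_mul_gaussOp, ← gaussOp_gen hp hη i, ← gaussOp_inv hp hη hg (rho g p (FreeGroup.of i))]
    congr 2
    have ho : omegaMat i j = 1 := by
      have e : (j : ℤ) = i + 1 := by omega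
      simp [omegaMat, e]
    have hc := rho_commutator (p := p) hg (FreeGroup.of i) (FreeGroup.of j)
    rw [omega_of_of, ho, Int.cast_one, ZMod.val_one, pow_one] at hc
    rw [commutatorElement_def, mul_inv_eq_iff_eq_mul, mul_inv_eq_iff_eq_mul] at hc
    rw [sigmaF_of_next h, map_mul, map_inv, sigmaF_of_prev h, sigmaF_of_self, map_mul, map_inv,
      map_mul, ← (c_comm _).eq, eq_inv_iff_mul_eq_one]
    calc _ = ((rho g p (FreeGroup.of i) * rho g p (FreeGroup.of j))⁻¹ *
          (rho g p (FreeGroup.of j) * c g p * rho g p (FreeGroup.of i))) := by group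
      _ = 1 := by rw [← (c_comm _).eq, ← hc, inv_mul_cancel]
  rw [mul_assoc (psiV η j), hij, ← mul_assoc, hji, hij]

theorem psiV_comm (hp : p ≠ 2) (hη : IsPrimitiveRoot η p) {i j : Fin (2 * g)} (h : (i : ℕ) + 1 < j) :
    psiV (p := p) η i * psiV η j = psiV η j * psiV η i := by
  rw [← gaussOp_gen hp hη j, psiV_mul_gaussOp, sigmaF_of_far (by omega) (by omega)]

end operators

/-! ### Matrix units -/

section matrixUnits

variable {g p : ℕ} [Fact p.Prime] {η : ℂ} (hp : p ≠ 2) (hη : IsPrimitiveRoot η p)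

theorem sum_ePow_dot (hη : IsPrimitiveRoot η p) (i : Fin g → ZMod p) :
    ∑ a : Fin g → ZMod p, ePow η (∑ k, i k * a k) = if i = 0 then (p : ℂ) ^ g else 0 := by
  have h1 : ∀ a : Fin g → ZMod p, ePow η (∑ k, i k * a k) = ∏ k, ePow η (i k * a k) := by
    intro a
    refine Finset.induction_on (Finset.univ : Finset (Fin g)) (by simp [ePow_zero]) ?_
    intro k s hk ih
    rw [Finset.sum_insert hk, Finset.prod_insert hk, ePow_add hη, ih]
  rw [Finset.sum_congr rfl fun a _ => h1 a,
    ← Fintype.prod_sum fun k (t : ZMod p) => ePow η (i k * t)]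
  simp_rw [sum_ePow_mul hη]
  split_ifs with h
  · simp [h]
  · obtain ⟨k, hk⟩ := Function.ne_iff.1 h
    exact Finset.prod_eq_zero (Finset.mem_univ k) (if_neg hk)

theorem act_odd_gen_pow (k : Fin g) (n : ZMod p) (j : Fin g → ZMod p) :
    act hp hη (MonoidAlgebra.of ℂ _ (x g p (2 * (k : ℕ) + 1) ^ n.val)) (Finsupp.single j 1) =
      ePow η (n * j k) • Finsupp.single j 1 := by
  have hk : half (⟨2 * (k : ℕ), by omega⟩ : Fin (2 * g)) = k := Fin.ext (by simp [half])
  rw [x, xF_succ g ⟨2 * (k : ℕ), by omega⟩, act_gen_pow, xPow_even η (by simp), hk]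

theorem act_even_gen_pow (k : Fin g) (n : ZMod p) (j : Fin g → ZMod p) :
    act hp hη (MonoidAlgebra.of ℂ _ (x g p (2 * (k : ℕ) + 2) ^ n.val)) (Finsupp.single j 1) =
      Finsupp.single (j - n • (eVec g p k - eVec g p (k + 1))) 1 := by
  rw [x, xF_succ g ⟨2 * (k : ℕ) + 1, by omega⟩, act_gen_pow, xPow_odd η (by simp)]
  simp only [step]
  rw [show (2 * (k : ℕ) + 1) / 2 = k by omega]

theorem act_odd_prod (L : List (Fin g)) (a j : Fin g → ZMod p) :
    act hp hη (MonoidAlgebra.of ℂ _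
      (L.map fun k : Fin g => x g p (2 * (k : ℕ) + 1) ^ (a k).val).prod) (Finsupp.single j 1) =
      ePow η (L.map fun k => a k * j k).sum • Finsupp.single j 1 := by
  induction L with
  | nil =>
    simp only [List.map_nil, List.prod_nil, List.sum_nil]
    rw [map_one, act_one, ePow_zero, one_smul, Module.End.one_apply]
  | cons k L ih =>
    simp only [List.map_cons, List.prod_cons, List.sum_cons]
    rw [act_of_mul, Module.End.mul_apply, act_odd_gen_pow, map_smul, ih, smul_smul, ← ePow_add hη]

theorem act_even_prod (L : List (Fin g)) (a j : Fin g → ZMod p) :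
    act hp hη (MonoidAlgebra.of ℂ _
      (L.map fun k : Fin g => x g p (2 * (k : ℕ) + 2) ^ (a k).val).prod) (Finsupp.single j 1) =
      Finsupp.single
        (j - (L.map fun k : Fin g => a k • (eVec g p k - eVec g p (k + 1))).sum) 1 := by
  induction L generalizing j with
  | nil =>
    simp only [List.map_nil, List.prod_nil, List.sum_nil]
    rw [map_one, act_one, sub_zero, Module.End.one_apply]
  | cons k L ih =>
    simp only [List.map_cons, List.prod_cons, List.sum_cons]
    rw [act_of_mul, Module.End.mul_apply, act_even_gen_pow, ih, sub_sub]

theorem act_phiOdd (i j : Fin g → ZMod p) :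
    act hp hη (phiOdd η i) (Finsupp.single j 1) = if i = j then Finsupp.single j 1 else 0 := by
  have hp0 : (p : ℂ) ≠ 0 := Nat.cast_ne_zero.2 (NeZero.ne p)
  rw [phiOdd, map_smul, map_sum, LinearMap.smul_apply, LinearMap.sum_apply]
  have h1 : ∀ a : Fin g → ZMod p, act hp hη (ePow η (-(∑ k, i k * a k)) •
      MonoidAlgebra.of ℂ (G g p) (List.ofFn fun k : Fin g =>
        x g p (2 * (k : ℕ) + 1) ^ (a k).val).prod) (Finsupp.single j 1) =
      ePow η (∑ k, (j - i) k * a k) • Finsupp.single j 1 := by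
    intro a
    rw [map_smul, LinearMap.smul_apply, List.ofFn_eq_map, act_odd_prod, smul_smul, ← ePow_add hη,
      ← Fin.sum_univ_def, ← Finset.sum_neg_distrib, ← Finset.sum_add_distrib]
    congr 2
    refine Finset.sum_congr rfl fun k _ => ?_
    simp only [Pi.sub_apply]
    ring
  rw [Finset.sum_congr rfl fun a _ => h1 a, ← Finset.sum_smul, sum_ePow_dot hη, smul_smul]
  by_cases h : i = j
  · simp [h, hp0]
  · rw [if_neg (sub_ne_zero.2 (Ne.symm h)), if_neg h, mul_zero, zero_smul]

/-- The vectors `ε_k - ε_{k+1}` form a basis of `(ℤ/p)^g`. -/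
theorem bijective_steps (j : Fin g → ZMod p) : Function.Bijective fun a : Fin g → ZMod p =>
    j - ∑ k : Fin g, a k • (eVec g p k - eVec g p (k + 1)) := by
  have hs : ∀ (a : Fin g → ZMod p) (m : Fin g),
      (∑ k : Fin g, a k • (eVec g p k - eVec g p (k + 1))) m =
        a m - ∑ k : Fin g, if (m : ℕ) = k + 1 then a k else 0 := by
    intro a m
    simp only [Finset.sum_apply, Pi.smul_apply, Pi.sub_apply, eVec_apply, smul_eq_mul, mul_sub,
      Finset.sum_sub_distrib, mul_ite, mul_one, mul_zero]
    congr 1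
    rw [Finset.sum_eq_single m]
    · simp
    · intro k _ hk
      rw [if_neg fun h => hk (Fin.ext h.symm)]
    · simp
  refine Finite.injective_iff_bijective.1 fun a b h => ?_
  have h0 := sub_right_injective h
  have key : ∀ n (hn : n < g), a ⟨n, hn⟩ = b ⟨n, hn⟩ := by
    intro n
    induction n with
    | zero =>
      intro hn
      have := congrFun h0 ⟨0, hn⟩
      rw [hs, hs] at this
      simpa using this
    | succ n ih =>
      intro hn
      have := congrFun h0 ⟨n + 1, hn⟩
      rw [hs, hs, Finset.sum_eq_single ⟨n, by omega⟩, Finset.sum_eq_single ⟨n, by omega⟩] at this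
      · simp only [if_true, ih] at this
        exact sub_left_injective this
      · intro k _ hk
        exact if_neg fun h => hk (Fin.ext (by simp at h ⊢; omega))
      · simp
      · intro k _ hk
        exact if_neg fun h => hk (Fin.ext (by simp at h ⊢; omega))
      · simp
  exact funext fun m => key m m.2

theorem act_phiEven_zero (j : Fin g → ZMod p) :
    act hp hη (phiEven η 0) (Finsupp.single j 1) =
      (1 / p ^ g : ℂ) • ∑ m : Fin g → ZMod p, Finsupp.single m 1 := by
  rw [phiEven, map_smul, map_sum, LinearMap.smul_apply, LinearMap.sum_apply]
  congr 1
  refine Fintype.sum_bijective _ (bijective_steps j) _ _ fun a => ?_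
  rw [map_smul, LinearMap.smul_apply, List.ofFn_eq_map, act_even_prod, ← Fin.sum_univ_def]
  simp [ePow_zero]

/-- Up to the factor `p^{-g}`, the elements `E_{i,j}` act on `V` as matrix units. -/
theorem act_Emat (hg : 0 < g) (i j k : Fin g → ZMod p) :
    act hp hη (Emat η i j) (Finsupp.single k 1) =
      if i = k then (1 / p ^ g : ℂ) • Finsupp.single j 1 else 0 := by
  rw [Emat, act_mul, act_phiC hp hη hg, mul_one, act_mul, act_mul, Module.End.mul_apply,
    Module.End.mul_apply, act_phiOdd]
  split_ifs with h
  · rw [act_phiEven_zero, map_smul, map_sum]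
    simp_rw [act_phiOdd]
    simp
  · simp

/-- The map `V* ⊗ V → ℂ[G]` with `e'_i ⊗ e_j ↦ E_{i,j}`. -/
def matUnit (g p : ℕ) [Fact p.Prime] (η : ℂ) :
    Module.Dual ℂ (V g p) ⊗[ℂ] V g p →ₗ[ℂ] MonoidAlgebra ℂ (G g p) :=
  TensorProduct.lift (LinearMap.mk₂ ℂ
    (fun ξ v => ∑ i, ∑ j, (ξ (Finsupp.single i 1) * v j) • Emat η i j)
    (fun _ _ _ => by simp only [LinearMap.add_apply, add_mul, add_smul, Finset.sum_add_distrib])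
    (fun _ _ _ => by simp only [LinearMap.smul_apply, smul_eq_mul, mul_assoc, mul_smul,
      Finset.smul_sum])
    (fun _ _ _ => by simp only [Finsupp.add_apply, mul_add, add_smul, Finset.sum_add_distrib])
    (fun r _ _ => by simp only [Finsupp.smul_apply, smul_eq_mul, mul_left_comm _ r, mul_smul,
      Finset.smul_sum]))

theorem matUnit_tmul (ξ : Module.Dual ℂ (V g p)) (v : V g p) : matUnit g p η (ξ ⊗ₜ v) =
    ∑ i, ∑ j, (ξ (Finsupp.single i 1) * v j) • Emat η i j := by
  simp [matUnit]

theorem matUnit_basis (i j : Fin g → ZMod p) :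
    matUnit g p η ((Finsupp.lapply i : Module.Dual ℂ (V g p)) ⊗ₜ Finsupp.single j 1) =
      Emat η i j := by
  rw [matUnit_tmul, Finset.sum_eq_single i, Finset.sum_eq_single j]
  · simp
  · intro k _ hk
    simp [hk]
  · simp
  · intro k _ hk
    simp [hk]
  · simp

theorem act_matUnit (hg : 0 < g) (t : Module.Dual ℂ (V g p) ⊗[ℂ] V g p) :
    act hp hη (matUnit g p η t) = (1 / p ^ g : ℂ) • dualTensorHom ℂ (V g p) (V g p) t := by
  induction t with
  | zero => simp
  | add a b ha hb => rw [map_add, map_add, ha, hb, map_add, smul_add]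
  | tmul ξ v =>
    apply V_ext
    intro k
    rw [matUnit_tmul, LinearMap.smul_apply, dualTensorHom_apply]
    simp only [map_sum, map_smul, LinearMap.sum_apply, LinearMap.smul_apply,
      act_Emat hp hη hg]
    rw [Finset.sum_eq_single k]
    · simp only [if_true]
      conv_rhs => rw [← Finsupp.univ_sum_single v, Finset.smul_sum, Finset.smul_sum]
      refine Finset.sum_congr rfl fun j _ => ?_
      simp only [Finsupp.smul_single, smul_eq_mul, mul_one]
      congr 1
      ring
    · intro i _ hi
      simp [hi]
    · simp

theorem matUnit_mem (t : Module.Dual ℂ (V g p) ⊗[ℂ] V g p) :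
    matUnit g p η t ∈ phiPart g p η := by
  induction t with
  | zero => simp
  | add a b ha hb => rw [map_add]; exact add_mem ha hb
  | tmul ξ v =>
    rw [matUnit_tmul]
    refine sum_mem fun i _ => sum_mem fun j _ => Submodule.smul_mem _ _ ⟨_, rfl⟩

theorem finrank_V (g p : ℕ) [Fact p.Prime] : Module.finrank ℂ (V g p) = p ^ g := by
  simp [ZMod.card]

theorem exists_matUnit_act (hg : 0 < g) (T : Module.End ℂ (V g p)) :
    ∃ t, act hp hη (matUnit g p η t) = T := by
  have hp0 : (p : ℂ) ≠ 0 := Nat.cast_ne_zero.2 (NeZero.ne p)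
  obtain ⟨t, ht⟩ := (dualTensorHomEquiv ℂ (V g p) (V g p)).surjective ((p ^ g : ℂ) • T)
  have ht' : dualTensorHom ℂ (V g p) (V g p) t = (p ^ g : ℂ) • T := by
    rw [← ht]; rfl
  refine ⟨t, ?_⟩
  rw [act_matUnit hp hη hg, ht', smul_smul, one_div, inv_mul_cancel₀ (pow_ne_zero _ hp0), one_smul]

/-- The action of `φ(c;η) ℂ[G]` on `V` is faithful: it is onto `End V`, and
`dim φ(c;η) ℂ[G] ≤ p^{2g}`. -/
theorem act_injOn (hg : 0 < g) {a b : MonoidAlgebra ℂ (G g p)} (ha : a ∈ phiPart g p η)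
    (hb : b ∈ phiPart g p η) (h : act hp hη a = act hp hη b) : a = b := by
  obtain ⟨hfin, hle⟩ := finite_phiPart (p := p) hg hη
  let f : phiPart g p η →ₗ[ℂ] Module.End ℂ (V g p) := (act hp hη).domRestrict (phiPart g p η)
  have hsurj : Function.Surjective f := fun T => by
    obtain ⟨t, ht⟩ := exists_matUnit_act hp hη hg T
    exact ⟨⟨_, matUnit_mem t⟩, ht⟩
  have hdim : Module.finrank ℂ (Module.End ℂ (V g p)) = p ^ (2 * g) := by
    rw [Module.finrank_linearMap, finrank_V, ← pow_add, two_mul]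
  have hge := LinearMap.finrank_le_finrank_of_surjective hsurj
  obtain ⟨e⟩ := FiniteDimensional.nonempty_linearEquiv_of_finrank_eq
    ((hle.trans hdim.ge).antisymm hge)
  have hinj := OrzechProperty.injective_of_surjective_of_injective e.toLinearMap f e.injective hsurj
  exact congrArg Subtype.val (@hinj ⟨a, ha⟩ ⟨b, hb⟩ h)

theorem exists_matUnit (hp : p ≠ 2) (hη : IsPrimitiveRoot η p) (hg : 0 < g)
    {a : MonoidAlgebra ℂ (G g p)} (ha : a ∈ phiPart g p η) : ∃ t, matUnit g p η t = a := by
  obtain ⟨t, ht⟩ := exists_matUnit_act hp hη hg (act hp hη a)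
  exact ⟨t, act_injOn hp hη hg (matUnit_mem t) ha ht⟩

theorem matUnit_mul (hg : 0 < g) (ξ : Module.Dual ℂ (V g p)) (v : V g p)
    (b : MonoidAlgebra ℂ (G g p)) :
    matUnit g p η (ξ ⊗ₜ v) * b = matUnit g p η (ξ ⊗ₜ act hp hη b v) := by
  refine act_injOn hp hη hg (phiPart_mul hη (matUnit_mem _) _) (matUnit_mem _) ?_
  rw [act_mul, act_matUnit hp hη hg, act_matUnit hp hη hg, mul_smul_comm]
  congr 1
  ext w
  simp

/-- The action of a braid on the group algebra `ℂ[G]`. -/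
def braidAlg (g p : ℕ) (s : Braid g) : MonoidAlgebra ℂ (G g p) →+* MonoidAlgebra ℂ (G g p) :=
  MonoidAlgebra.mapDomainRingHom ℂ (braidG g p s)

theorem mapDomainRingHom_smul {Γ Γ' : Type*} [Group Γ] [Group Γ'] (f : Γ →* Γ') (r : ℂ)
    (a : MonoidAlgebra ℂ Γ) : MonoidAlgebra.mapDomainRingHom ℂ f (r • a) =
      r • MonoidAlgebra.mapDomainRingHom ℂ f a := by
  exact MonoidAlgebra.mapDomain_smul ..

/-- An endomorphism of `F_{2g}` inducing an endomorphism `f` of `G` and preserving the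
intersection form fixes `φ(c;η)`. -/
theorem mapDomainRingHom_phiC (hg : 0 < g) {φ : F g → F g} {f : G g p →* G g p}
    (hf : ∀ w, f (rho g p w) = rho g p (φ w)) (hφ : ∀ a b, omega (φ a) (φ b) = omega a b) :
    MonoidAlgebra.mapDomainRingHom ℂ f (phiC g p η) = phiC g p η := by
  have hc : f (c g p) = c g p := by
    have h1 := rho_commutator (p := p) hg (φ (xF g 1)) (φ (xF g 2))
    have h2 := rho_commutator (p := p) hg (xF g 1) (xF g 2)
    rw [hφ, ← h2] at h1
    rw [c, map_commutatorElement, x, x, hf, hf, h1]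
  rw [phiC, mapDomainRingHom_smul, map_sum]
  congr 1
  refine Finset.sum_congr rfl fun n _ => ?_
  rw [mapDomainRingHom_smul]
  congr 1
  simp [MonoidAlgebra.of_apply, MonoidAlgebra.mapDomain_single, hc]

theorem braidAlg_mem (hg : 0 < g) (hη : IsPrimitiveRoot η p) (s : Braid g)
    {a : MonoidAlgebra ℂ (G g p)} (ha : a ∈ phiPart g p η) :
    braidAlg g p s a ∈ phiPart g p η := by
  rw [mem_phiPart hη] at *
  conv_rhs => rw [← ha]
  rw [map_mul]
  congr 1
  exact (mapDomainRingHom_phiC hg (fun _ => rfl) (omega_braid s)).symm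

theorem psiV_mul_act (l : Fin (2 * g)) (a : MonoidAlgebra ℂ (G g p)) :
    psiV η l * act hp hη a = act hp hη (braidAlg g p (sigma l) a) * psiV η l := by
  induction a using MonoidAlgebra.induction_on with
  | of γ =>
    obtain ⟨w, rfl⟩ := rho_surjective g p γ
    rw [psiV_mul_act_of, braidAlg, mapDomain_of_rho, braidAut_sigma, sigmaAut_apply]
  | add a b ha hb => rw [map_add, map_add, map_add, mul_add, add_mul, ha, hb]
  | smul r a ha =>
    rw [braidAlg, mapDomainRingHom_smul, map_smul, map_smul, mul_smul_comm, ha, smul_mul_assoc]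
    rfl

/-- The map `V* ⊗ V → ℂ[G]` is equivariant under the Artin generators. -/
theorem braidAlg_matUnit (hp : p ≠ 2) (hη : IsPrimitiveRoot η p) (hg : 0 < g) (l : Fin (2 * g))
    (P : Module.End ℂ (V g p)) (hP : P * psiV η l = 1)
    (ξ : Module.Dual ℂ (V g p)) (v : V g p) :
    braidAlg g p (sigma l) (matUnit g p η (ξ ⊗ₜ v)) =
      matUnit g p η ((ξ ∘ₗ P) ⊗ₜ psiV η l v) := by
  refine act_injOn hp hη hg (braidAlg_mem hg hη _ (matUnit_mem _)) (matUnit_mem _) ?_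
  have h1 := psiV_mul_act hp hη l (matUnit g p η (ξ ⊗ₜ v))
  have h2 : psiV η l * P = 1 := mul_eq_one_comm.1 hP
  have h3 : act hp hη (braidAlg g p (sigma l) (matUnit g p η (ξ ⊗ₜ v))) =
      psiV η l * act hp hη (matUnit g p η (ξ ⊗ₜ v)) * P := by
    rw [h1, mul_assoc, h2, mul_one]
  rw [h3, act_matUnit hp hη hg, act_matUnit hp hη hg, mul_smul_comm, smul_mul_assoc]
  congr 1
  ext w
  simp

end matrixUnits

/-! ### A basis of the Magnus module adapted to the braid action -/

section magnus

variable {g p : ℕ}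

/-- The automorphism `γ ↦ Δ⁻¹ γ Δ` of `G`. -/
def thetaG (g p : ℕ) : G g p →* G g p :=
  QuotientGroup.map (N g p) (N g p) (theta g).toMonoidHom (N_le_comap p _ omega_theta)

theorem thetaG_rho (w : F g) : thetaG g p (rho g p w) = rho g p (theta g w) := rfl

/-- The automorphism `a ↦ Δ⁻¹ a Δ` of `ℂ[G]`. -/
def thetaAlg (g p : ℕ) : MonoidAlgebra ℂ (G g p) →+* MonoidAlgebra ℂ (G g p) :=
  MonoidAlgebra.mapDomainRingHom ℂ (thetaG g p)

theorem mapDomainRingHom_of {Γ Γ' : Type*} [Group Γ] [Group Γ'] (f : Γ →* Γ') (γ : Γ) :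
    MonoidAlgebra.mapDomainRingHom ℂ f (MonoidAlgebra.of ℂ Γ γ) =
      MonoidAlgebra.of ℂ Γ' (f γ) := by
  simp [MonoidAlgebra.of_apply, MonoidAlgebra.mapDomain_single]

theorem thetaAlg_of (w : F g) : thetaAlg g p (MonoidAlgebra.of ℂ _ (rho g p w)) =
    MonoidAlgebra.of ℂ _ (rho g p (theta g w)) := by
  rw [thetaAlg, mapDomainRingHom_of, thetaG_rho]

theorem thetaAlg_smul (r : ℂ) (a : MonoidAlgebra ℂ (G g p)) :
    thetaAlg g p (r • a) = r • thetaAlg g p a := mapDomainRingHom_smul _ r a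

theorem thetaAlg_surjective (g p : ℕ) : Function.Surjective (thetaAlg g p) := by
  intro a
  induction a using MonoidAlgebra.induction_on with
  | of γ =>
    obtain ⟨w, rfl⟩ := rho_surjective g p γ
    exact ⟨MonoidAlgebra.of ℂ _ (rho g p ((theta g).symm w)), by rw [thetaAlg_of]; simp⟩
  | add a b ha hb =>
    obtain ⟨⟨a, rfl⟩, ⟨b, rfl⟩⟩ := And.intro ha hb
    exact ⟨a + b, map_add _ _ _⟩
  | smul r a ha =>
    obtain ⟨a, rfl⟩ := ha
    exact ⟨r • a, thetaAlg_smul r a⟩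

theorem braidAlg_of (l : Fin (2 * g)) (w : F g) :
    braidAlg g p (sigma l) (MonoidAlgebra.of ℂ _ (rho g p w)) =
      MonoidAlgebra.of ℂ _ (rho g p (sigmaF l w)) := by
  rw [braidAlg, mapDomain_of_rho, braidAut_sigma, sigmaAut_apply]

theorem braidAlg_thetaAlg (l : Fin (2 * g)) (a : MonoidAlgebra ℂ (G g p)) :
    braidAlg g p (sigma l) (thetaAlg g p a) = thetaAlg g p (braidAlg g p (sigma l) a) := by
  induction a using MonoidAlgebra.induction_on with
  | of γ =>
    obtain ⟨w, rfl⟩ := rho_surjective g p γ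
    rw [thetaAlg_of, braidAlg_of, braidAlg_of, thetaAlg_of, sigmaF_theta]
  | add a b ha hb => simp only [map_add, ha, hb]
  | smul r a ha =>
    have hb : ∀ a, braidAlg g p (sigma l) (r • a) = r • braidAlg g p (sigma l) a :=
      mapDomainRingHom_smul _ r
    rw [thetaAlg_smul, hb, ha, hb, thetaAlg_smul]

/-- The element `γ d_N(w)` of the Magnus module, `γ` being represented by the word `a`. -/
def transl (p : ℕ) (a w : F g) : LN g p := MonoidAlgebra.of ℂ (G g p) (rho g p a) • dN g p w

theorem dN_mul (a b : F g) :
    dN g p (a * b) = dN g p a + MonoidAlgebra.of ℂ (G g p) (rho g p a) • dN g p b :=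
  foxDeriv_mul _ _ _

theorem of_smul_transl (a b w : F g) :
    MonoidAlgebra.of ℂ (G g p) (rho g p a) • transl p b w = transl p (a * b) w := by
  rw [transl, transl, smul_smul, ← map_mul, ← map_mul]

theorem transl_mul (a v w : F g) :
    transl p a (v * w) = transl p a v + transl p (a * v) w := by
  rw [← of_smul_transl]
  simp only [transl]
  rw [dN_mul, smul_add]

theorem transl_one (a : F g) : transl p a 1 = 0 := by
  rw [transl, dN, foxDeriv_one, smul_zero]

theorem transl_inv (a w : F g) : transl p a w⁻¹ = -transl p (a * w⁻¹) w := by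
  have h := transl_mul (p := p) a w⁻¹ w
  rw [inv_mul_cancel, transl_one] at h
  exact eq_neg_of_add_eq_zero_left h.symm

theorem braidL_transl (l : Fin (2 * g)) (a w : F g) :
    braidL g p (sigma l) (transl p a w) = transl p (sigmaF l a) (sigmaF l w) := by
  rw [transl, braidL_smul, mapDomain_of_rho, braidL_dN, braidAut_sigma, sigmaAut_apply,
    sigmaAut_apply]
  rfl

/-- The elements `Δ⁻¹ u_m` of the Magnus module (the generator with usual number `m + 1`):
`Δ⁻² d_N(x_1 x_3 ⋯ x_{2k-1})` for the number `2k-1`, and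
`E⁻¹ d_N(E)` with `E = x_{2k} x_{2k+2} ⋯ x_{2g}` for the number `2k`. -/
def baseVec (g p : ℕ) (m : Fin (2 * g)) : LN g p :=
  if (m : ℕ) % 2 = 0 then transl p (deltaSq g)⁻¹ (oddWord g ((m : ℕ) / 2 + 1))
  else transl p (evenWord g ((m : ℕ) / 2 + 1))⁻¹ (evenWord g ((m : ℕ) / 2 + 1))

/-- The linear map `u_m ↦ Δ⁻¹ u_m` from `⟨u_1, …, u_{2g}⟩` to the Magnus module. -/
def baseMap (g p : ℕ) : U g →ₗ[ℂ] LN g p := Finsupp.linearCombination ℂ (baseVec g p)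

theorem baseMap_single (m : Fin (2 * g)) :
    baseMap g p (Finsupp.single m 1) = baseVec g p m := by
  simp [baseMap]

theorem uVec_eq_single (m : Fin (2 * g)) {n : ℤ} (h : n = (m : ℤ) + 1) :
    uVec g n = Finsupp.single m 1 := by
  rw [uVec, Finset.sum_eq_single m]
  · rw [if_pos h.symm]
  · intro k _ hk
    exact if_neg fun h' => hk (Fin.ext (by omega))
  · simp

theorem uVec_eq_zero {n : ℤ} (h : n < 1 ∨ 2 * g < n) : uVec g n = 0 :=
  Finset.sum_eq_zero fun m _ => if_neg (by omega)

theorem baseMap_uVec_odd {k : ℕ} (hk : k ≤ g) {n : ℤ} (hn : n = 2 * (k : ℤ) - 1) :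
    baseMap g p (uVec g n) = transl p (deltaSq g)⁻¹ (oddWord g k) := by
  rcases k with - | k
  · rw [uVec_eq_zero (by omega), map_zero, oddWord_zero, transl_one]
  · rw [uVec_eq_single ⟨2 * k, by omega⟩ (by push_cast at *; omega), baseMap_single, baseVec,
      if_pos (by simp)]
    simp

theorem baseMap_uVec_even {k : ℕ} (h1 : 1 ≤ k) (hk : k ≤ g + 1) {n : ℤ} (hn : n = 2 * (k : ℤ)) :
    baseMap g p (uVec g n) = transl p (evenWord g k)⁻¹ (evenWord g k) := by
  rcases hk.eq_or_lt with rfl | hk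
  · rw [uVec_eq_zero (by push_cast at *; omega), map_zero, evenWord_last, transl_one]
  · rw [uVec_eq_single ⟨2 * k - 1, by omega⟩ (by simp; omega), baseMap_single, baseVec,
      if_neg (by simp; omega)]
    rw [show (2 * k - 1) / 2 + 1 = k by omega]

theorem baseMap_sub_odd {l : Fin (2 * g)} (hl : (l : ℕ) % 2 = 0) :
    baseMap g p (uVec g ((l : ℤ) + 1) - uVec g ((l : ℤ) + 1 - 2)) =
      transl p ((deltaSq g)⁻¹ * oddWord g ((l : ℕ) / 2)) (FreeGroup.of l) := by
  rw [map_sub, baseMap_uVec_odd (k := (l : ℕ) / 2 + 1) (by omega) (by omega),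
    baseMap_uVec_odd (k := (l : ℕ) / 2) (by omega) (by omega), oddWord_succ, transl_mul,
    add_sub_cancel_left, xF_eq_of l (by omega)]

theorem baseMap_sub_even {l : Fin (2 * g)} (hl : (l : ℕ) % 2 = 1) :
    baseMap g p (uVec g ((l : ℤ) + 1) - uVec g ((l : ℤ) + 1 + 2)) =
      transl p (evenWord g ((l : ℕ) / 2 + 1))⁻¹ (FreeGroup.of l) := by
  have hE : evenWord g ((l : ℕ) / 2 + 1) = FreeGroup.of l * evenWord g ((l : ℕ) / 2 + 1 + 1) := by
    rw [evenWord_eq (by omega), xF_eq_of l (by omega)]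
  rw [map_sub, baseMap_uVec_even (k := (l : ℕ) / 2 + 1) (by omega) (by omega) (by omega),
    baseMap_uVec_even (k := (l : ℕ) / 2 + 1 + 1) (by omega) (by omega) (by push_cast; omega)]
  conv_lhs => arg 1; arg 3; rw [hE]
  rw [transl_mul]
  conv_lhs => arg 1; arg 2; arg 2; rw [hE]
  rw [mul_inv_rev, inv_mul_cancel_right, add_sub_cancel_right]

/-- The group element by which the correction term of `Ψ̂_{l+1}` is translated. -/
def corrElt (l : Fin (2 * g)) : F g :=
  if (l : ℕ) % 2 = 0 then oddWord g ((l : ℕ) / 2) * evenWord g ((l : ℕ) / 2 + 1)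
  else (oddWord g ((l : ℕ) / 2 + 1) * evenWord g ((l : ℕ) / 2 + 1))⁻¹

/-- The effect of the correction term of `Ψ̂_{l+1}` on the vectors `u_m`. -/
def corrMap (l : Fin (2 * g)) : U g →ₗ[ℂ] U g :=
  Finsupp.linearCombination ℂ fun m : Fin (2 * g) =>
    if (l : ℕ) % 2 = 0 then
      if (m : ℤ) + 1 = (l : ℤ) + 1 + 1 then
        -(uVec g ((l : ℤ) + 1) - uVec g ((l : ℤ) + 1 - 2)) else 0
    else
      if (m : ℤ) + 1 = (l : ℤ) + 1 - 1 then
        uVec g ((l : ℤ) + 1) - uVec g ((l : ℤ) + 1 + 2) else 0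

/-- On the vectors `Δ⁻¹ u_m` the Artin generators act by the correction terms of the `Ψ̂_l`;
conjugation by `Δ` turns the translating elements `h` into `h⁻¹ Δ²`. -/
theorem braidL_baseVec (l m : Fin (2 * g)) :
    braidL g p (sigma l) (baseVec g p m) = baseVec g p m +
      thetaAlg g p (MonoidAlgebra.of ℂ _ (rho g p (corrElt l))) •
        baseMap g p (corrMap l (Finsupp.single m 1)) := by
  rw [thetaAlg_of, corrMap, Finsupp.linearCombination_single, one_smul, corrElt]
  by_cases hl : (l : ℕ) % 2 = 0
  · rw [if_pos hl, if_pos hl]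
    have hth := theta_odd_even_succ (g := g) (k := (l : ℕ) / 2) (by omega)
    by_cases hm : (m : ℕ) % 2 = 0
    · rw [if_neg (by omega), map_zero, smul_zero, add_zero, baseVec, if_pos hm, braidL_transl,
        map_inv, sigmaF_deltaSq, sigmaF_oddWord_of_even hl (by omega)]
    · rw [baseVec, if_neg hm, braidL_transl, map_inv, sigmaF_evenWord_of_even hl (by omega) (by omega)]
      by_cases h : (m : ℕ) = l + 1
      · rw [if_pos (by omega), if_pos (by omega), map_neg, baseMap_sub_odd hl, smul_neg,
          of_smul_transl, hth, show (m : ℕ) / 2 = l / 2 by omega, transl_mul, transl_inv, add_comm]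
        congr 3 <;> group
      · rw [if_neg (by omega), if_neg (by omega), map_zero, smul_zero, add_zero, one_mul]
  · have hl' : (l : ℕ) % 2 = 1 := by omega
    rw [if_neg hl, if_neg hl, map_inv]
    have hth := theta_odd_even (g := g) (k := (l : ℕ) / 2 + 1) (by omega) (by omega)
    by_cases hm : (m : ℕ) % 2 = 0
    · rw [baseVec, if_pos hm, braidL_transl, map_inv, sigmaF_deltaSq,
        sigmaF_oddWord_of_odd hl' (by omega)]
      by_cases h : (m : ℕ) + 1 = l
      · rw [if_pos (by omega), if_pos (by omega), baseMap_sub_even hl', of_smul_transl, hth,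
          transl_mul, show (m : ℕ) / 2 = l / 2 by omega]
        congr 2
        group
      · rw [if_neg (by omega), if_neg (by omega), map_zero, smul_zero, add_zero, mul_one]
    · rw [if_neg (by omega), map_zero, smul_zero, add_zero, baseVec, if_neg hm, braidL_transl,
        map_inv, sigmaF_evenWord_of_odd hl' (by omega) (by omega)]

theorem braidL_baseMap (l : Fin (2 * g)) (u : U g) :
    braidL g p (sigma l) (baseMap g p u) = baseMap g p u +
      thetaAlg g p (MonoidAlgebra.of ℂ _ (rho g p (corrElt l))) • baseMap g p (corrMap l u) := by
  have : braidL g p (sigma l) ∘ₗ baseMap g p = baseMap g p +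
      Algebra.lsmul ℂ ℂ (LN g p) (thetaAlg g p (MonoidAlgebra.of ℂ _ (rho g p (corrElt l)))) ∘ₗ
        baseMap g p ∘ₗ corrMap l := by
    refine Finsupp.lhom_ext' fun m => LinearMap.ext_ring ?_
    have := braidL_baseVec (p := p) l m
    rw [← baseMap_single] at this
    exact this
  exact DFunLike.congr_fun this u

end magnus

/-! ### The isomorphism -/

section iso

variable {g p : ℕ} [Fact p.Prime] {η : ℂ}

theorem thetaAlg_phiC (hg : 0 < g) : thetaAlg g p (phiC g p η) = phiC g p η :=
  mapDomainRingHom_phiC hg thetaG_rho omega_theta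

theorem thetaAlg_mem (hg : 0 < g) (hη : IsPrimitiveRoot η p)
    {a : MonoidAlgebra ℂ (G g p)} (ha : a ∈ phiPart g p η) :
    thetaAlg g p a ∈ phiPart g p η := by
  rw [mem_phiPart hη] at *
  conv_rhs => rw [← ha]
  rw [map_mul, thetaAlg_phiC hg]

theorem exists_thetaAlg (hg : 0 < g) (hη : IsPrimitiveRoot η p)
    {a : MonoidAlgebra ℂ (G g p)} (ha : a ∈ phiPart g p η) :
    ∃ b ∈ phiPart g p η, thetaAlg g p b = a := by
  obtain ⟨b, rfl⟩ := thetaAlg_surjective g p a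
  refine ⟨phiC g p η * b, ⟨b, rfl⟩, ?_⟩
  rw [map_mul, thetaAlg_phiC hg]
  exact (mem_phiPart hη).1 ha

theorem psiHat_tmul (hp : p ≠ 2) (hη : IsPrimitiveRoot η p) (l : Fin (2 * g)) (v : V g p)
    (u : U g) : psiHat hp hη l (v ⊗ₜ u) = psiV η l v ⊗ₜ u +
      act hp hη (MonoidAlgebra.of ℂ _ (rho g p (corrElt l))) (psiV η l v) ⊗ₜ corrMap l u := by
  rw [act_of]
  by_cases hl : (l : ℕ) % 2 = 0
  · simp only [psiHat, corrElt, corrMap, if_pos hl, map_mul, rho_oddWord, rho_evenWord,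
      Nat.add_sub_cancel, LinearMap.add_apply, TensorProduct.map_tmul, LinearMap.id_apply,
      LinearMap.comp_apply]
  · simp only [psiHat, corrElt, corrMap, if_neg hl, map_mul, map_inv, rho_oddWord, rho_evenWord,
      LinearMap.add_apply, TensorProduct.map_tmul, LinearMap.id_apply,
      LinearMap.comp_apply]

/-- The map `t ⊗ u ↦ Δ⁻¹ E(t) Δ · Δ⁻¹ u`, bilinear in `t ∈ V* ⊗ V` and `u ∈ ⟨u_1, …, u_{2g}⟩`. -/
def isoBilin (g p : ℕ) [Fact p.Prime] (η : ℂ) :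
    Module.Dual ℂ (V g p) ⊗[ℂ] V g p →ₗ[ℂ] U g →ₗ[ℂ] LN g p :=
  LinearMap.mk₂ ℂ (fun t u => thetaAlg g p (matUnit g p η t) • baseMap g p u)
    (fun _ _ _ => by rw [map_add, map_add, add_smul])
    (fun _ _ _ => by rw [map_smul, thetaAlg_smul, smul_assoc])
    (fun _ _ _ => by rw [map_add, smul_add])
    (fun _ _ _ => by rw [map_smul, smul_comm])

/-- The map `V* ⊗ L → L_N` underlying the isomorphism. -/
def isoMap (g p : ℕ) [Fact p.Prime] (η : ℂ) :
    Module.Dual ℂ (V g p) ⊗[ℂ] Lmod g p →ₗ[ℂ] LN g p :=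
  TensorProduct.lift (isoBilin g p η) ∘ₗ
    (TensorProduct.assoc ℂ (Module.Dual ℂ (V g p)) (V g p) (U g)).symm.toLinearMap

theorem isoMap_tmul (ξ : Module.Dual ℂ (V g p)) (v : V g p) (u : U g) :
    isoMap g p η (ξ ⊗ₜ (v ⊗ₜ u)) = thetaAlg g p (matUnit g p η (ξ ⊗ₜ v)) • baseMap g p u := by
  simp [isoMap, isoBilin]

theorem isoMap_psiHat (hp : p ≠ 2) (hη : IsPrimitiveRoot η p) (hg : 0 < g) (l : Fin (2 * g))
    (P : Module.End ℂ (V g p)) (hP : P * psiV η l = 1) (ξ : Module.Dual ℂ (V g p))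
    (y : Lmod g p) :
    isoMap g p η ((ξ ∘ₗ P) ⊗ₜ psiHat hp hη l y) =
      braidL g p (sigma l) (isoMap g p η (ξ ⊗ₜ y)) := by
  induction y using TensorProduct.induction_on with
  | zero => simp only [map_zero, TensorProduct.tmul_zero]
  | add a b ha hb => simp only [map_add, TensorProduct.tmul_add, ha, hb]
  | tmul v u =>
    rw [psiHat_tmul, TensorProduct.tmul_add, map_add, isoMap_tmul, isoMap_tmul, isoMap_tmul,
      ← matUnit_mul hp hη hg, map_mul, mul_smul, ← smul_add, ← braidL_baseMap, braidL_smul]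
    congr 1
    rw [← braidAlg_matUnit hp hη hg l P hP]
    exact (braidAlg_thetaAlg l _).symm

theorem smul_baseMap_mem_range (hp : p ≠ 2) (hη : IsPrimitiveRoot η p) (hg : 0 < g)
    {a : MonoidAlgebra ℂ (G g p)} (ha : a ∈ phiPart g p η) (u : U g) :
    a • baseMap g p u ∈ LinearMap.range (isoMap g p η) := by
  obtain ⟨b, hb, rfl⟩ := exists_thetaAlg hg hη ha
  obtain ⟨t, rfl⟩ := exists_matUnit hp hη hg hb
  refine ⟨TensorProduct.assoc ℂ _ _ _ (t ⊗ₜ u), ?_⟩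
  simp [isoMap, isoBilin]

theorem smul_single_mem_range (hp : p ≠ 2) (hη : IsPrimitiveRoot η p) (hg : 0 < g)
    {a : MonoidAlgebra ℂ (G g p)} (ha : a ∈ phiPart g p η) (l : Fin (2 * g)) :
    a • (Pi.single l 1 : LN g p) ∈ LinearMap.range (isoMap g p η) := by
  have key : ∀ (b : F g) (u : U g), baseMap g p u = transl p b (FreeGroup.of l) →
      a • (Pi.single l 1 : LN g p) ∈ LinearMap.range (isoMap g p η) := by
    intro b u hu
    have h := smul_baseMap_mem_range hp hη hg
      (phiPart_mul hη ha (MonoidAlgebra.of ℂ _ (rho g p b⁻¹))) u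
    rwa [hu, mul_smul, of_smul_transl, inv_mul_cancel, transl, map_one, map_one, one_smul, dN,
      foxDeriv_of] at h
  by_cases hl : (l : ℕ) % 2 = 0
  · exact key _ _ (baseMap_sub_odd hl)
  · exact key _ _ (baseMap_sub_even (by omega))

/-- The differences of consecutive vectors `Δ⁻¹ u_m` are translates of the basis vectors of `L_N`,
so the image is all of `φ(c;η) L_N`. -/
theorem range_isoMap (hp : p ≠ 2) (hη : IsPrimitiveRoot η p) (hg : 0 < g) :
    LinearMap.range (isoMap g p η) = isotypic g p η := by
  apply le_antisymm
  · rintro _ ⟨z, rfl⟩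
    induction z with
    | zero => rw [map_zero]; exact zero_mem _
    | add a b ha hb => rw [map_add]; exact add_mem ha hb
    | tmul ξ y =>
      induction y using TensorProduct.induction_on with
      | zero => rw [TensorProduct.tmul_zero, map_zero]; exact zero_mem _
      | add a b ha hb => rw [TensorProduct.tmul_add, map_add]; exact add_mem ha hb
      | tmul v u =>
        rw [isoMap_tmul]
        refine ⟨thetaAlg g p (matUnit g p η (ξ ⊗ₜ v)) • baseMap g p u, (smul_smul _ _ _).trans ?_⟩
        rw [(mem_phiPart hη).1 (thetaAlg_mem hg hη (matUnit_mem _))]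
  · rintro _ ⟨v, rfl⟩
    have : Algebra.lsmul ℂ ℂ (LN g p) (phiC g p η) v =
        ∑ l, (phiC g p η * v l) • (Pi.single l 1 : LN g p) := by
      show phiC g p η • v = _
      conv_lhs => rw [← Finset.univ_sum_single v, Finset.smul_sum]
      refine Finset.sum_congr rfl fun l _ => ?_
      rw [← Pi.single_smul', ← Pi.single_smul', smul_eq_mul, smul_eq_mul, mul_one]
    rw [this]
    exact sum_mem fun l _ => smul_single_mem_range hp hη hg ⟨_, rfl⟩ l

/-- Letting the coordinates of `L_N` act on `V` gives a surjection `φ(c;η) L_N → (End V)^{2g}`, and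
`V* ⊗ L` has the dimension of the target. -/
theorem isoMap_injective (hp : p ≠ 2) (hη : IsPrimitiveRoot η p) (hg : 0 < g) :
    Function.Injective (isoMap g p η) := by
  let r : LN g p →ₗ[ℂ] (Fin (2 * g) → Module.End ℂ (V g p)) :=
    LinearMap.pi fun i => act hp hη ∘ₗ LinearMap.proj i
  have hsurj : Function.Surjective (r ∘ₗ isoMap g p η) := by
    intro T
    choose t ht using fun i => exists_matUnit_act hp hη hg (T i)
    have hv : (fun i => matUnit g p η (t i) : LN g p) ∈ isotypic g p η := by
      refine ⟨fun i => matUnit g p η (t i), funext fun i => ?_⟩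
      exact (mem_phiPart hη).1 (matUnit_mem (t i))
    rw [← range_isoMap hp hη hg] at hv
    obtain ⟨z, hz⟩ := hv
    refine ⟨z, ?_⟩
    rw [LinearMap.comp_apply, hz]
    exact funext ht
  have hdim : Module.finrank ℂ (Module.Dual ℂ (V g p) ⊗[ℂ] Lmod g p) =
      Module.finrank ℂ (Fin (2 * g) → Module.End ℂ (V g p)) := by
    rw [Module.finrank_tensorProduct, Module.finrank_tensorProduct, Subspace.dual_finrank_eq,
      Module.finrank_pi_fintype]
    simp only [Module.finrank_linearMap, Finset.sum_const, Finset.card_univ,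
      Fintype.card_fin, Module.finrank_finsupp_self, smul_eq_mul]
    ring
  obtain ⟨e⟩ := FiniteDimensional.nonempty_linearEquiv_of_finrank_eq hdim
  have hinj : Function.Injective (r ∘ isoMap g p η) :=
    OrzechProperty.injective_of_surjective_of_injective e.toLinearMap _ e.injective hsurj
  exact hinj.of_comp

end iso

/-! ### The embedding into `L_N⁺` -/

section plus

variable {g p : ℕ}

/-- The lift `x_i ↦ y_i y_{i+1}` of `iota` to the free group on the `y_i`. -/
def iotaT (g : ℕ) : F g →* T g :=
  FreeGroup.lift fun i => FreeGroup.of i.castSucc * FreeGroup.of i.succ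

theorem iotaT_of (i : Fin (2 * g)) :
    iotaT g (FreeGroup.of i) = FreeGroup.of i.castSucc * FreeGroup.of i.succ := by
  simp [iotaT]

theorem mk_iotaT (w : F g) : PresentedGroup.mk (squares g) (iotaT g w) = iota g w := by
  have : (PresentedGroup.mk (squares g)).comp (iotaT g) = iota g := by
    ext i
    rw [MonoidHom.comp_apply, iotaT_of, iota_of, map_mul]
    rfl
  exact DFunLike.congr_fun this w

theorem rhoPlus_eq (w : T g) : rhoPlus g p w =
    QuotientGroup.mk' (Nplus g p) (PresentedGroup.mk (squares g) w) := rfl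

theorem iotaG_rho (w : F g) :
    iotaG g p (rho g p w) = QuotientGroup.mk' (Nplus g p) (iota g w) := rfl

theorem rhoPlus_iotaT (w : F g) : rhoPlus g p (iotaT g w) = iotaG g p (rho g p w) := by
  rw [rhoPlus_eq, mk_iotaT, iotaG_rho]

theorem dPlus_mul (a b : T g) : dPlus g p (a * b) =
    dPlus g p a + MonoidAlgebra.of ℂ (Gplus g p) (rhoPlus g p a) • dPlus g p b := by
  rw [dPlus, foxDeriv_mul, map_add, map_smul]
  rfl

theorem dPlus_one : dPlus g p 1 = 0 := by rw [dPlus, foxDeriv_one, map_zero]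

theorem dPlus_inv (a : T g) : dPlus g p a⁻¹ =
    -(MonoidAlgebra.of ℂ (Gplus g p) (rhoPlus g p a)⁻¹ • dPlus g p a) := by
  rw [dPlus, foxDeriv_inv, map_neg, map_smul]
  rfl

/-- `d⁺` is well defined on `H_{2g+1}`. -/
theorem dPlus_congr {a b : T g}
    (h : PresentedGroup.mk (squares g) a = PresentedGroup.mk (squares g) b) :
    dPlus g p a = dPlus g p b := by
  have hm : b⁻¹ * a ∈ Subgroup.normalClosure (squares g) := QuotientGroup.eq.1 h.symm
  have hz : dPlus g p (b⁻¹ * a) = 0 :=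
    (Submodule.Quotient.mk_eq_zero _).2 (Submodule.subset_span ⟨_, hm, rfl⟩)
  have := dPlus_mul (p := p) b (b⁻¹ * a)
  rwa [mul_inv_cancel_left, hz, smul_zero, add_zero] at this

theorem iotaHat_add (v w : LN g p) : iotaHat g p (v + w) = iotaHat g p v + iotaHat g p w := by
  simp only [iotaHat, Pi.add_apply, map_add, add_smul, Finset.sum_add_distrib]

theorem iotaHat_smul (a : MonoidAlgebra ℂ (G g p)) (v : LN g p) : iotaHat g p (a • v) =
    MonoidAlgebra.mapDomainRingHom ℂ (iotaG g p) a • iotaHat g p v := by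
  simp only [iotaHat, Pi.smul_apply, smul_eq_mul, map_mul, Finset.smul_sum, smul_smul]

theorem iotaHat_dN (w : F g) : iotaHat g p (dN g p w) = dPlus g p (iotaT g w) := by
  have h0 : iotaHat g p 0 = 0 := by simp [iotaHat]
  have hneg : ∀ v : LN g p, iotaHat g p (-v) = -iotaHat g p v := fun v => by
    rw [eq_neg_iff_add_eq_zero, ← iotaHat_add, neg_add_cancel, h0]
  induction w using F_induction with
  | one => rw [map_one, dPlus_one, dN, foxDeriv_one, h0]
  | of j =>
    rw [dN, foxDeriv_of, iotaHat, iotaT_of, Finset.sum_eq_single j]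
    · simp
    · intro i _ hi
      simp [hi]
    · simp
  | inv a h =>
    rw [dN, foxDeriv_inv, hneg, iotaHat_smul, mapDomainRingHom_of, map_inv (iotaT g), dPlus_inv,
      rhoPlus_iotaT, map_inv (iotaG g p), ← h, dN]
  | mul a b ha hb =>
    rw [dN_mul, iotaHat_add, iotaHat_smul, mapDomainRingHom_of, ha, hb, map_mul (iotaT g),
      dPlus_mul, rhoPlus_iotaT]

theorem yUp_eq_one {a b : ℕ} (h : b < a) : yUp g a b = 1 := by
  simp [yUp, Nat.sub_eq_zero_of_le (show b + 1 ≤ a from h)]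

theorem yUp_succ {a b : ℕ} (h : a ≤ b + 1) : yUp g a (b + 1) = yUp g a b * yT g (b + 1) :=
  prod_range_sub_succ (yT g) h

theorem yUp_cons {a b : ℕ} (h : a ≤ b) : yUp g a b = yT g a * yUp g (a + 1) b :=
  prod_range_sub (yT g) (by omega)

theorem yUp_mul_yUp {a b d : ℕ} (hab : a ≤ b + 1) (hbd : b ≤ d) :
    yUp g a b * yUp g (b + 1) d = yUp g a d := by
  induction d, hbd using Nat.le_induction with
  | base => rw [yUp_eq_one (Nat.lt_succ_self b), mul_one]
  | succ d hd ih => rw [yUp_succ (by omega), ← mul_assoc, ih, yUp_succ (by omega)]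

theorem yDown_succ {a b : ℕ} (h : a ≤ b + 1) : yDown g a (b + 1) = yT g (b + 1) * yDown g a b := by
  rw [yDown, yDown, Nat.succ_sub h, List.range_succ_eq_map, List.map_cons, List.prod_cons,
    List.map_map]
  congr 3
  funext i
  simp only [Function.comp, Nat.succ_eq_add_one]
  congr 1
  omega

theorem mk_yDown (a b : ℕ) : PresentedGroup.mk (squares g) (yDown g a b) =
    PresentedGroup.mk (squares g) (yUp g a b)⁻¹ := by
  induction b with
  | zero =>
    rcases a with - | a
    · simp [yDown, yUp, yT]
    · simp [yDown, yUp]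
  | succ b ih =>
    by_cases h : a ≤ b + 1
    · rw [yDown_succ h, yUp_succ h, mul_inv_rev, map_mul, map_mul, ih, map_inv _ (yT g (b + 1))]
      congr 1
      exact (yH_inv g (b + 1)).symm
    · have h0 : b + 1 + 1 - a = 0 := by omega
      simp [yDown, yUp, h0]

theorem iotaT_xF {n : ℕ} (h : 1 ≤ n) (h' : n ≤ 2 * g) :
    iotaT g (xF g n) = yT g n * yT g (n + 1) := by
  rw [xF_eq_of ⟨n - 1, by omega⟩ (by simp; omega), iotaT_of, yT, yT, dif_pos ⟨h, by omega⟩,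
    dif_pos ⟨by omega, by omega⟩]
  congr 2
  exact Fin.ext (by simp; omega)

theorem iotaT_oddWord {k : ℕ} (hk : k ≤ g) : iotaT g (oddWord g k) = yUp g 1 (2 * k) := by
  induction k with
  | zero => rw [oddWord_zero, map_one, yUp_eq_one (by omega)]
  | succ k ih =>
    rw [oddWord_succ, map_mul, ih (by omega), iotaT_xF (by omega) (by omega),
      show 2 * (k + 1) = 2 * k + 1 + 1 by ring, yUp_succ (by omega), yUp_succ (by omega), mul_assoc]

theorem iotaT_evenWord {k : ℕ} (h1 : 1 ≤ k) (hk : k ≤ g + 1) :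
    iotaT g (evenWord g k) = yUp g (2 * k) (2 * g + 1) := by
  induction hk using Nat.decreasingInduction with
  | self => rw [evenWord_last, map_one, yUp_eq_one (by omega)]
  | of_succ k hk ih =>
    rw [evenWord_eq (by omega), map_mul, ih (by omega), iotaT_xF (by omega) (by omega),
      yUp_cons (a := 2 * k) (by omega), yUp_cons (a := 2 * k + 1) (by omega), mul_assoc]
    rfl

theorem mk_Delta (g : ℕ) : PresentedGroup.mk (squares g) (Delta g) = deltaH g := by
  rw [Delta, yUp_succ (by omega), ← iotaT_oddWord le_rfl, map_mul, mk_iotaT]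
  rfl

theorem rhoPlus_Delta (g p : ℕ) :
    rhoPlus g p (Delta g) = QuotientGroup.mk' (Nplus g p) (deltaH g) := by
  rw [rhoPlus_eq, mk_Delta]

theorem Delta_mul_thetaAlg (a : MonoidAlgebra ℂ (G g p)) :
    MonoidAlgebra.of ℂ (Gplus g p) (rhoPlus g p (Delta g)) *
        MonoidAlgebra.mapDomainRingHom ℂ (iotaG g p) (thetaAlg g p a) =
      MonoidAlgebra.mapDomainRingHom ℂ (iotaG g p) a *
        MonoidAlgebra.of ℂ (Gplus g p) (rhoPlus g p (Delta g)) := by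
  induction a using MonoidAlgebra.induction_on with
  | of γ =>
    obtain ⟨w, rfl⟩ := rho_surjective g p γ
    rw [thetaAlg_of, mapDomainRingHom_of, mapDomainRingHom_of, ← map_mul, ← map_mul,
      rhoPlus_Delta, iotaG_rho, iotaG_rho, ← map_mul, ← map_mul, iota_theta]
    congr 2
    group
  | add a b ha hb => rw [map_add, map_add, map_add, mul_add, add_mul, ha, hb]
  | smul r a ha =>
    rw [thetaAlg_smul, mapDomainRingHom_smul, mapDomainRingHom_smul, mul_smul_comm, ha,
      smul_mul_assoc]

theorem iotaHat_transl (a w : F g) : iotaHat g p (transl p a w) =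
    MonoidAlgebra.of ℂ (Gplus g p) (iotaG g p (rho g p a)) • dPlus g p (iotaT g w) := by
  rw [transl, iotaHat_smul, mapDomainRingHom_of, iotaHat_dN]

/-- The vectors `baseVec` are the translates `Δ⁻¹ u_m`. -/
theorem Delta_baseVec (m : Fin (2 * g)) :
    MonoidAlgebra.of ℂ (Gplus g p) (rhoPlus g p (Delta g)) • iotaHat g p (baseVec g p m) =
      uPlus g p ((m : ℕ) + 1) := by
  by_cases hm : (m : ℕ) % 2 = 0
  · have e : (m : ℕ) + 1 + 1 = 2 * ((m : ℕ) / 2 + 1) := by omega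
    rw [baseVec, if_pos hm, uPlus, if_neg (by omega), iotaHat_transl, iotaT_oddWord (by omega),
      ← e, smul_smul, ← map_mul, actPlus, dPlus_congr (mk_yDown 1 _), dPlus_inv, smul_neg, neg_neg,
      smul_smul, ← map_mul, rhoPlus_eq (yDown g _ _), mk_yDown, ← rhoPlus_eq, map_inv (rhoPlus g p),
      ← mul_inv_rev, ← map_mul (rhoPlus g p), yUp_mul_yUp (by omega) (by omega), ← Delta,
      map_inv (rho g p), map_inv (iotaG g p), iotaG_rho, iota_deltaSq,
      map_mul (QuotientGroup.mk' (Nplus g p)), ← rhoPlus_Delta]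
    congr 2
    group
  · have e : (m : ℕ) + 1 = 2 * ((m : ℕ) / 2 + 1) := by omega
    rw [baseVec, if_neg hm, uPlus, if_pos (by omega), iotaHat_transl,
      map_inv (rho g p), map_inv (iotaG g p), ← rhoPlus_iotaT, iotaT_evenWord (by omega) (by omega),
      ← e, smul_smul, ← map_mul, actPlus, Delta,
      ← yUp_mul_yUp (g := g) (a := 1) (b := (m : ℕ)) (by omega) (by omega), map_mul (rhoPlus g p),
      mul_inv_cancel_right, Nat.add_sub_cancel]

end plus

/-! ### The braid group representations -/

section reps

variable {g p : ℕ} [Fact p.Prime] {η : ℂ}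

/-- A family of invertible operators satisfying the Artin relations defines a representation of the
braid group. -/
theorem exists_rep_of_artin {W : Type*} [AddCommMonoid W] [Module ℂ W]
    (Ψ : Fin (2 * g) → Module.End ℂ W) (hu : ∀ l, IsUnit (Ψ l))
    (hb : ∀ i j : Fin (2 * g), (i : ℕ) + 1 = j → Ψ i * Ψ j * Ψ i = Ψ j * Ψ i * Ψ j)
    (hc : ∀ i j : Fin (2 * g), (i : ℕ) + 1 < j → Ψ i * Ψ j = Ψ j * Ψ i) :
    ∃ ρ : Representation ℂ (Braid g) W, ∀ l, ρ (sigma l) = Ψ l := by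
  choose u hu using hu
  let φ : Braid g →* (Module.End ℂ W)ˣ := PresentedGroup.toGroup (f := u) (by
    rintro r (⟨i, j, h, rfl⟩ | ⟨i, j, h, rfl⟩)
    · simp only [map_mul, map_inv, FreeGroup.lift_apply_of, mul_inv_eq_one]
      exact Units.ext (by simpa [hu] using hb i j h)
    · simp only [map_mul, map_inv, FreeGroup.lift_apply_of, mul_inv_eq_one]
      exact Units.ext (by simpa [hu] using hc i j h))
  refine ⟨(Units.coeHom _).comp φ, fun l => ?_⟩
  rw [← hu l]
  exact congrArg Units.val (PresentedGroup.toGroup.of _)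

theorem exists_rep_V (hp : p ≠ 2) (hη : IsPrimitiveRoot η p) (hg : 0 < g) :
    ∃ ρ : Representation ℂ (Braid g) (V g p), ∀ l, ρ (sigma l) = psiV η l :=
  exists_rep_of_artin _ (isUnit_psiV hp hη) (fun _ _ => psiV_braid hp hη hg)
    (fun _ _ => psiV_comm hp hη)

/-- Tensoring with an invertible operator on `V*` is faithful: the factor `B` is recovered from
`A ⊗ B` by evaluating the image of `A⁻¹ ξ ⊗ y` at a vector dual to `ξ`. -/
theorem map_right_injective {L : Type*} [AddCommMonoid L] [Module ℂ L]
    {A : Module.End ℂ (Module.Dual ℂ (V g p))} {B B' : Module.End ℂ L} (hA : IsUnit A)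
    (h : TensorProduct.map A B = TensorProduct.map A B') : B = B' := by
  obtain ⟨A, rfl⟩ := hA
  ext y
  let κ : Module.Dual ℂ (V g p) ⊗[ℂ] L →ₗ[ℂ] L :=
    TensorProduct.lift ((LinearMap.lsmul ℂ L) ∘ₗ Module.Dual.eval ℂ _ (Finsupp.single 0 1))
  have h1 : (A : Module.End ℂ (Module.Dual ℂ (V g p))) ((A⁻¹ : _ˣ).val (Finsupp.lapply 0)) =
      Finsupp.lapply 0 := by
    rw [← Module.End.mul_apply, Units.mul_inv, Module.End.one_apply]
  have h2 := congrArg κ (LinearMap.congr_fun h ((A⁻¹ : _ˣ).val (Finsupp.lapply 0) ⊗ₜ y))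
  simpa [h1, κ] using h2

/-- `V* ⊗ L → L_N` intertwines `Ψ_l* ⊗ Ψ̂_l` with the action of `σ_l`. -/
theorem isoMap_map (hp : p ≠ 2) (hη : IsPrimitiveRoot η p) (hg : 0 < g)
    {ρ : Representation ℂ (Braid g) (V g p)} (hρ : ∀ l, ρ (sigma l) = psiV η l)
    (l : Fin (2 * g)) (z : Module.Dual ℂ (V g p) ⊗[ℂ] Lmod g p) :
    isoMap g p η (TensorProduct.map (ρ.dual (sigma l)) (psiHat hp hη l) z) =
      magnusRep g p (sigma l) (isoMap g p η z) := by
  induction z with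
  | zero => simp only [map_zero]
  | add a b ha hb => simp only [map_add, ha, hb]
  | tmul ξ y =>
    rw [TensorProduct.map_tmul]
    refine isoMap_psiHat hp hη hg l (ρ (sigma l)⁻¹) ?_ ξ y
    rw [← hρ, ← map_mul, inv_mul_cancel, map_one]

/-- The braid relations and the invertibility of the operators `Ψ̂_l` are inherited from the Magnus
module: `V* ⊗ L → L_N` is injective and intertwines `Ψ_l* ⊗ Ψ̂_l` with the action of `σ_l`. -/
theorem exists_rep_L (hp : p ≠ 2) (hη : IsPrimitiveRoot η p) (hg : 0 < g) :
    ∃ ρ : Representation ℂ (Braid g) (Lmod g p), ∀ l, ρ (sigma l) = psiHat hp hη l := by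
  obtain ⟨ρ, hρ⟩ := exists_rep_V (g := g) hp hη hg
  have hinj := isoMap_injective (g := g) hp hη hg
  have hT := isoMap_map hp hη hg hρ
  refine exists_rep_of_artin (W := Lmod g p) (psiHat hp hη) (fun l => ?_) (fun i j h => ?_) (fun i j h => ?_)
  · have h : Function.Injective (psiHat hp hη l) := by
      intro y y' hy
      -- contraction of the dual factor with the vector `e_0`
      let κ : Module.Dual ℂ (V g p) ⊗[ℂ] Lmod g p →ₗ[ℂ] Lmod g p :=
        TensorProduct.lift ((LinearMap.lsmul ℂ (Lmod g p)) ∘ₗ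
          Module.Dual.eval ℂ _ (Finsupp.single 0 1))
      have h1 : magnusRep g p (sigma l) (isoMap g p η (Finsupp.lapply 0 ⊗ₜ y)) =
          magnusRep g p (sigma l) (isoMap g p η (Finsupp.lapply 0 ⊗ₜ y')) := by
        rw [← hT, ← hT, TensorProduct.map_tmul, TensorProduct.map_tmul, hy]
      have h2 := hinj (((magnusRep g p).apply_bijective (sigma l)).1 h1)
      simpa [κ] using congrArg κ h2
    exact (Module.End.isUnit_iff _).2 ⟨h, (LinearMap.injective_iff_surjective (K := ℂ) (V := Lmod g p)).1 h⟩
  · have hs : (sigma i * sigma j * sigma i : Braid g) = sigma j * sigma i * sigma j := by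
      refine mul_inv_eq_one.1 ?_
      have := PresentedGroup.one_of_mem (rels := artinRels (2 * g)) (Or.inl ⟨i, j, h, rfl⟩)
      exact this
    refine map_right_injective ((Group.isUnit (sigma i * sigma j * sigma i)).map ρ.dual) ?_
    conv_rhs => rw [hs]
    rw [map_mul, map_mul, map_mul, map_mul]
    simp only [TensorProduct.map_mul]
    refine LinearMap.ext fun z => hinj ?_
    simp only [Module.End.mul_apply, hT]
    simp only [← Module.End.mul_apply, ← map_mul]
    rw [← mul_assoc, hs, mul_assoc]
  · have hs : (sigma i * sigma j : Braid g) = sigma j * sigma i := by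
      refine mul_inv_eq_one.1 ?_
      have := PresentedGroup.one_of_mem (rels := artinRels (2 * g)) (Or.inr ⟨i, j, h, rfl⟩)
      exact this
    refine map_right_injective ((Group.isUnit (sigma i * sigma j)).map ρ.dual) ?_
    conv_rhs => rw [hs]
    rw [map_mul, map_mul]
    simp only [TensorProduct.map_mul]
    refine LinearMap.ext fun z => hinj ?_
    simp only [Module.End.mul_apply, hT]
    simp only [← Module.End.mul_apply, ← map_mul, hs]

/-- Equivariance under the Artin generators extends to the whole braid group. -/
theorem equivariant_of_sigma {W W' : Type*} [AddCommMonoid W] [Module ℂ W] [AddCommMonoid W']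
    [Module ℂ W'] (ρ : Representation ℂ (Braid g) W) (ρ' : Representation ℂ (Braid g) W')
    (f : W →ₗ[ℂ] W') (h : ∀ l z, f (ρ (sigma l) z) = ρ' (sigma l) (f z)) (s : Braid g) (z : W) :
    f (ρ s z) = ρ' s (f z) := by
  let S : Subgroup (Braid g) :=
    { carrier := {s | ∀ z, f (ρ s z) = ρ' s (f z)}
      one_mem' := fun z => by simp
      mul_mem' := fun {s t} hs ht z => by
        rw [map_mul, map_mul, Module.End.mul_apply, Module.End.mul_apply, hs, ht]
      inv_mem' := fun {s} hs z => by
        have h1 := hs (ρ s⁻¹ z)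
        rw [← Module.End.mul_apply, ← map_mul, mul_inv_cancel, map_one, Module.End.one_apply] at h1
        rw [h1, ← Module.End.mul_apply, ← map_mul, inv_mul_cancel, map_one,
          Module.End.one_apply] }
  exact PresentedGroup.generated_by _ S (fun l => h l) s z

end reps

end MagnusBraid

end

theorem mainTheorem2 (g p : ℕ) (hg : 0 < g) [Fact p.Prime] (hp : p ≠ 2) (η : ℂ)
    (hη : IsPrimitiveRoot η p) :
    ∃ (ρV : Representation ℂ (MagnusBraid.Braid g) (MagnusBraid.V g p))
      (ρL : Representation ℂ (MagnusBraid.Braid g) (MagnusBraid.Lmod g p)),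
      (∀ l, ρV (MagnusBraid.sigma l) = MagnusBraid.psiV η l) ∧
      (∀ l, ρL (MagnusBraid.sigma l) = MagnusBraid.psiHat hp hη l) ∧
      ∃ e : (Module.Dual ℂ (MagnusBraid.V g p) ⊗[ℂ] MagnusBraid.Lmod g p) ≃ₗ[ℂ]
          MagnusBraid.isotypic g p η,
        (∀ (s : MagnusBraid.Braid g)
            (z : Module.Dual ℂ (MagnusBraid.V g p) ⊗[ℂ] MagnusBraid.Lmod g p),
          (e ((ρV.dual.tprod ρL) s z) : MagnusBraid.LN g p) =
            MagnusBraid.magnusRep g p s (e z : MagnusBraid.LN g p)) ∧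
        (∀ (i j : Fin g → ZMod p) (l : Fin (2 * g)),
          MagnusBraid.actPlus g p (MagnusBraid.Delta g)
              (MagnusBraid.iotaHat g p
                (e ((Finsupp.lapply i : Module.Dual ℂ (MagnusBraid.V g p)) ⊗ₜ[ℂ]
                  (Finsupp.single j (1 : ℂ) ⊗ₜ[ℂ] Finsupp.single l (1 : ℂ))))) =
            MonoidAlgebra.mapDomainRingHom ℂ (MagnusBraid.iotaG g p)
                (MagnusBraid.Emat η i j) •
              MagnusBraid.uPlus g p ((l : ℕ) + 1)) := by
  obtain ⟨ρV, hV⟩ := MagnusBraid.exists_rep_V (g := g) hp hη hg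
  obtain ⟨ρL, hL⟩ := MagnusBraid.exists_rep_L (g := g) hp hη hg
  refine ⟨ρV, ρL, hV, hL,
    (LinearEquiv.ofInjective _ (MagnusBraid.isoMap_injective hp hη hg)).trans
      (LinearEquiv.ofEq _ _ (MagnusBraid.range_isoMap hp hη hg)), ?_, ?_⟩
  · refine MagnusBraid.equivariant_of_sigma (ρV.dual.tprod ρL) (MagnusBraid.magnusRep g p)
      (MagnusBraid.isoMap g p η) fun l z => ?_
    rw [← MagnusBraid.isoMap_map hp hη hg hV, ← hL]
    rfl
  · intro i j l
    rw [LinearEquiv.trans_apply, LinearEquiv.coe_ofEq_apply, LinearEquiv.ofInjective_apply,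
      MagnusBraid.isoMap_tmul, MagnusBraid.matUnit_basis, MagnusBraid.baseMap_single,
      MagnusBraid.iotaHat_smul, MagnusBraid.actPlus, smul_smul, MagnusBraid.Delta_mul_thetaAlg,
      mul_smul, MagnusBraid.Delta_baseVec]
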